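/- **Setting.** A *convenient algebra* is a unital real algebra $\mathfrak A$ with a decreasing filtration $\mathfrak A=\mathfrak A^{(0)}\supset\mathfrak A^{(1)}\supset\cdots$ by linear subspaces, $\mathfrak A^{(i)}\mathfrak A^{(j)}\subset\mathfrak A^{(i+j)}$, complete and Hausdorff, with all $\mathfrak A/\mathfrak A^{(i)}$ finite-dimensional; convergence means convergence in every $\mathfrak A/\mathfrak A^{(i)}$. Homomorphisms are unital and respect the filtrations. Finite-dimensional algebras may be given the trivial filtration ($\mathfrak A^{(1)}=0$); $\mathfrak A\oplus\mathfrak B$ is filtered termwise; in $\mathfrak A[[t_1,\dots,t_m]]$ the variables are central of filtration degree $1$. A tuple $Q\in\mathfrak A^n$ is a *Clifford system* if $Q_iQ_j+Q_jQ_i=-2\delta_{ij}1$. For $n\ge1$ it is a *floating Clifford system* if $Q_1$ is invertible and $\tilde Q:=(Q_2Q_1^{-1},\dots,Q_nQ_1^{-1})$ is a Clifford system. The *(floating) formal domain* consists of the tuples $A\in\mathfrak A^n$ with $A-Q\in(\mathfrak A^{(1)})^n$ for some (floating) Clifford system $Q$. For $\iota\in\{0,1\}^n$ put $Q^\iota=Q_1^{\iota_1}\cdots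 Q_n^{\iota_n}$. For $\epsilon\in\{0,1\}$ put $X_Q^{\epsilon}=\frac12(X+(-1)^{\epsilon}Q^{-1}XQ)$, and let $X^{\iota_1}_{Q_1}\cdots{}^{\iota_n}_{Q_n}$ denote the iterated operation. *Connections.* Let $\omega=(\omega_j^\iota)$, $1\le j\le n$, $\iota\in\{0,1\}^n$, be real numbers with $\omega_j^{\iota}=0$ if $\iota_j=0$, and $\sum_j\omega_j^\iota=1$ if $\iota\ne0$. Examples: $\mathrm{GS}_j^\iota=1$ if $j=\min\{h:\iota_h=1\}$ and $0$ otherwise; $\mathrm{Sy}_j^\iota=\iota_j/(\iota_1+\cdots+\iota_n)$ (and $0$ for $\iota=0$). For a Clifford system $Q$ and $R\in\mathfrak A^n$ let $$\Pi^\omega_QR=\tfrac12\sum_{j,\iota}\omega^\iota_j\,(R_jQ_j^{-1})^{\iota_1}_{Q_1}\cdots{}^{\iota_n}_{Q_n},\qquad (\mathrm{Step}^\omega_AQ)_i=e^{X}Q_ie^{-X},\quad X=\Pi_Q^\omega(A-Q).$$ For a floating Clifford system $Q$ let $(\mathrm{Step}^{\mathrm f\omega}_AQ)_i=e^{X}Q_ie^{Y}$,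 where, with $R=A-Q$ and $\iota_s-\iota_1$ taken mod $2$, $$X=\tfrac12\sum_{j,\iota}\omega^\iota_j(R_jQ_j^{-1})^{\iota_1-\iota_1}_{Q_1Q_1^{-1}}\cdots{}^{\iota_n-\iota_1}_{Q_nQ_1^{-1}},\qquad Y=\tfrac12\sum_{j,\iota}\omega^\iota_j(Q_j^{-1}R_j)^{\iota_1-\iota_1}_{Q_1^{-1}Q_1}\cdots{}^{\iota_n-\iota_1}_{Q_1^{-1}Q_n}.$$ Define $\underline{\mathcal O}^\omega(A)=B$ to mean that $A$ is in the formal domain and, for every Clifford system $Q$ with $A-Q\in(\mathfrak A^{(1)})^n$, the iterates $(\mathrm{Step}^\omega_A)^kQ$ converge to $B$; define $\underline{\mathcal O}^{\mathrm f\omega}$ in the same way with floating Clifford systems and $\mathrm{Step}^{\mathrm f\omega}_A$. *Gram–Schmidt.* Let $\operatorname{pol}H=H(-H^2)^{-1/2}$ with $S^{-1/2}=\int_0^{2\pi}(\cos^2t+S\sin^2t)^{-1}\frac{dt}{2\pi}$, defined if all these inverses exist. Then $\mathcal O^{\mathrm{GS}}(A)=Q$ is given recursively by $Q_k=\operatorname{pol}\big((A_k)^{1}_{Q_1}\cdots{}^{1}_{Q_{k-1}}\big)$,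 and $\mathcal O^{\mathrm{fGS}}(A)=(A_1,C_2A_1,\dots,C_nA_1)$ with $(C_2,\dots,C_n)=\mathcal O^{\mathrm{GS}}(A_2A_1^{-1},\dots,A_nA_1^{-1})$ and $A_1$ invertible. **Theorem.** (a) Let $n\ge0$. For every $\omega$ as above, $\Psi=\underline{\mathcal O}^\omega$ is a formal FQ orthogonalization procedure, that is: - it is single-valued; - (Nat) $\Psi(A)=B$ implies $\Psi(\phi(A))=\phi(B)$ for all homomorphisms $\phi:\mathfrak A\to\mathfrak B$, and the domain on $\mathfrak A\oplus\mathfrak B$ contains the product of the domains on $\mathfrak A$ and $\mathfrak B$; - (Frm) its domain is the formal domain; - (Ana) there are universal real coefficients $\psi$ such that for every Clifford system $Q$ and $R\in(\mathfrak A^{(1)})^n$, $\Psi(Q+R)_k=\sum_{r\ge0}\sum_{\iota_0,\dots,\iota_r\in\{0,1\}^n,\ 1\le j_1,\dots,j_r\le n}\psi^{[k];j_1,\dots,j_r}_{\iota_0,\dots,\iota_r}Q^{\iota_0}R_{j_1}Q^{\iota_1}\cdots R_{j_r}Q^{\iota_r}$; - (CP) its values are Clifford systems. Moreover, it satisfies: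 - (vL) $\Psi(A)=B$ implies $\Psi(\pm A_1,\dots,\pm A_n)=(\pm B_1,\dots,\pm B_n)$ (same signs); - (vC) $\Psi(Q)=Q$ for Clifford systems $Q$; - (H⁰) $\Psi(A)=B$ implies $\Psi((1+t)A)=B$ in $\mathfrak A[[t]]$; - (FSt) $\Psi(A)=B$ implies $\Psi(tA+(1-t)B)=B$ for all $t\in\mathbb R$. For $\omega=\mathrm{GS}$, $\underline{\mathcal O}^{\omega}$ is the restriction of $\mathcal O^{\mathrm{GS}}$ to the formal domain: $\underline{\mathcal O}^{\mathrm{GS}}(A)=B$ if and only if $A$ is in the formal domain and $\mathcal O^{\mathrm{GS}}(A)=B$. For $\omega=\mathrm{Sy}$, $\Psi=\underline{\mathcal O}^{\mathrm{Sy}}$ satisfies: - (PSy) let $(V,q)$ be a finite-dimensional real vector space with a positive definite metric, $\mathrm{cl}:V\to\mathrm{Cl}(V,q)$ with $\mathrm{cl}(v)^2=-q(v,v)$, $m\ge0$, and $a_1,\dots,a_n\in V[[t_1,\dots,t_m]]$ with orthonormal constant terms; let $S=(q(a_j,a_i))_{i,j}$ be their Gram matrix over $\mathbb R[[t_1,\dots,t_m]]$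 and $\sqrt S$ its square root with constant term the identity matrix; then $\Psi(\mathrm{cl}(a_1),\dots,\mathrm{cl}(a_n))=(\mathrm{cl}(\hat a_1),\dots,\mathrm{cl}(\hat a_n))$ in $\mathrm{Cl}(V,q)[[t_1,\dots,t_m]]$, where $[\hat a_1\cdots\hat a_n]=[a_1\cdots a_n]\sqrt S^{\,-1}$; - ($\Sigma$) $\Psi(A)=B$ implies $\Psi(\sigma A)=\sigma B$ for all permutations $\sigma$; - (O) $\Psi(A)=B$ implies $\Psi(UA)=UB$ for all $U\in\mathrm O(n)$. (b) Let $n\ge1$. For every $\omega$ as above, $\Psi=\underline{\mathcal O}^{\mathrm f\omega}$ is a formal FQ conform-orthogonalization procedure, that is: - it is single-valued and satisfies (Nat); - (Biv′) $\Psi(A)=B$ implies $\Psi(\theta_1A\theta_2)=\theta_1B\theta_2$ for all invertible $\theta_1,\theta_2\in\mathfrak A$; - (Frm′) its domain is the floating formal domain; - (Ana′) there are universal real coefficients $\psi$ such that for every floating Clifford system $Q$ and $R\in(\mathfrak A^{(1)})^n$, with $\tilde R_j=R_jQ_1^{-1}$, $\Psi(Q+R)_k=\sum_{r\ge0}\sum_{\iota_0,\dots,\iota_r\in\{0,1\}^{n-1},\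 1\le j_1,\dots,j_r\le n}\psi^{[k];j_1,\dots,j_r}_{\iota_0,\dots,\iota_r}\tilde Q^{\iota_0}\tilde R_{j_1}\tilde Q^{\iota_1}\cdots\tilde R_{j_r}\tilde Q^{\iota_r}Q_1$; - (CP′) its values are floating Clifford systems. Moreover, it satisfies (vL), (FSt), and (vC′): $\Psi(Q)=Q$ for floating Clifford systems $Q$. For $\omega=\mathrm{GS}$ it is the restriction of $\mathcal O^{\mathrm{fGS}}$ to the floating formal domain. For $\omega=\mathrm{Sy}$ it satisfies ($\Sigma$), (O), and (PSy′): for $(V,q)$ and $m$ as in (PSy), let $a_1,\dots,a_n\in V[[t_1,\dots,t_m]]$ have pairwise orthogonal constant terms of the same square length $c>0$, with Gram matrix $S$, and let $\sqrt S$ be its square root with constant term $\sqrt c$ times the identity matrix; then $\Psi(\mathrm{cl}(a_1),\dots,\mathrm{cl}(a_n))=(\mathrm{cl}(\check a_1),\dots,\mathrm{cl}(\check a_n))$, where $[\check a_1\cdots\check a_n]=[a_1\cdots a_n]\sqrt S^{\,-1}\cdot\frac{\operatorname{tr}\sqrt S}{n}$. -/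

import Mathlib

universe u

noncomputable section

namespace FQ


/-! ### Convenient algebras -/

/-- A convenient algebra: a unital real algebra with a decreasing multiplicative filtration
`filt 0 = ⊤ ⊇ filt 1 ⊇ ...` which is Hausdorff and complete (it is the inverse limit of its
filtration quotients), all of whose filtration quotients are finite dimensional. -/
class ConvenientAlgebra (𝔄 : Type u) [Ring 𝔄] [Algebra ℝ 𝔄] where
  filt : ℕ → Submodule ℝ 𝔄
  filt_zero : filt 0 = ⊤
  filt_antitone : Antitone filt
  mul_mem_filt : ∀ {i j : ℕ} {a b : 𝔄}, a ∈ filt i → b ∈ filt j → a * b ∈ filt (i + j)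
  hausdorff : ∀ a : 𝔄, (∀ i, a ∈ filt i) → a = 0
  complete : ∀ x : ℕ → 𝔄, (∀ i, x (i + 1) - x i ∈ filt i) → ∃ a : 𝔄, ∀ i, a - x i ∈ filt i
  finite_quotient : ∀ i, Module.Finite ℝ (𝔄 ⧸ filt i)


open ConvenientAlgebra (filt)

theorem finite_quotient_of_ker_le {M N : Type*} [AddCommGroup M] [Module ℝ M]
    [AddCommGroup N] [Module ℝ N] [Module.Finite ℝ N] (f : M →ₗ[ℝ] N) (p : Submodule ℝ M)
    (h : LinearMap.ker f ≤ p) : Module.Finite ℝ (M ⧸ p) := by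
  have h1 : Module.Finite ℝ (M ⧸ LinearMap.ker f) :=
    Module.Finite.equiv f.quotKerEquivRange.symm
  exact Module.Finite.of_surjective (Submodule.factor h) (Submodule.factor_surjective h)

/-- The direct sum (product) of two convenient algebras. -/
instance instProd (𝔄 𝔅 : Type u) [Ring 𝔄] [Algebra ℝ 𝔄] [ConvenientAlgebra 𝔄]
    [Ring 𝔅] [Algebra ℝ 𝔅] [ConvenientAlgebra 𝔅] : ConvenientAlgebra (𝔄 × 𝔅) where
  filt i := (filt i : Submodule ℝ 𝔄).prod (filt i : Submodule ℝ 𝔅)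
  filt_zero := by simp [ConvenientAlgebra.filt_zero]
  filt_antitone i j hij := Submodule.prod_mono
    (ConvenientAlgebra.filt_antitone hij) (ConvenientAlgebra.filt_antitone hij)
  mul_mem_filt ha hb :=
    ⟨ConvenientAlgebra.mul_mem_filt ha.1 hb.1, ConvenientAlgebra.mul_mem_filt ha.2 hb.2⟩
  hausdorff a h := Prod.ext (ConvenientAlgebra.hausdorff _ fun i => (h i).1)
    (ConvenientAlgebra.hausdorff _ fun i => (h i).2)
  complete x hx := by
    obtain ⟨a, ha⟩ := ConvenientAlgebra.complete (fun i => (x i).1) fun i => (hx i).1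
    obtain ⟨b, hb⟩ := ConvenientAlgebra.complete (fun i => (x i).2) fun i => (hx i).2
    exact ⟨(a, b), fun i => ⟨ha i, hb i⟩⟩
  finite_quotient i := by
    have h1 := ConvenientAlgebra.finite_quotient (𝔄 := 𝔄) i
    have h2 := ConvenientAlgebra.finite_quotient (𝔄 := 𝔅) i
    refine finite_quotient_of_ker_le
      ((filt i : Submodule ℝ 𝔄).mkQ.prodMap (filt i : Submodule ℝ 𝔅).mkQ) _ ?_
    intro x hx
    simpa [Prod.ext_iff, Submodule.mem_prod] using hx

/-- Formal power series over a convenient algebra in finitely many commuting variables, which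
also commute with the coefficients and have filtration degree `1`. -/
instance instMvPowerSeries (σ : Type) [Finite σ] (𝔄 : Type u) [Ring 𝔄] [Algebra ℝ 𝔄]
    [ConvenientAlgebra 𝔄] : ConvenientAlgebra (MvPowerSeries σ 𝔄) where
  filt i :=
    { carrier := {f | ∀ d : σ →₀ ℕ, MvPowerSeries.coeff d f ∈ (filt (i - d.degree) : Submodule ℝ 𝔄)}
      add_mem' := fun ha hb d => by
        rw [map_add]; exact Submodule.add_mem _ (ha d) (hb d)
      zero_mem' := fun d => by rw [map_zero]; exact Submodule.zero_mem _
      smul_mem' := fun c f hf d => Submodule.smul_mem _ c (hf d) }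
  filt_zero := by
    ext f
    simp [ConvenientAlgebra.filt_zero]
  filt_antitone i j hij f hf d :=
    ConvenientAlgebra.filt_antitone (Nat.sub_le_sub_right hij _) (hf d)
  mul_mem_filt {i j a b} ha hb d := by
    classical
    rw [MvPowerSeries.coeff_mul]
    refine Submodule.sum_mem _ fun p hp => ?_
    have h := ConvenientAlgebra.mul_mem_filt (ha p.1) (hb p.2)
    refine ConvenientAlgebra.filt_antitone ?_ h
    have : d.degree = p.1.degree + p.2.degree := by
      rw [← Finset.HasAntidiagonal.mem_antidiagonal.mp hp, map_add]
    omega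
  hausdorff f h := by
    ext d
    refine ConvenientAlgebra.hausdorff _ fun i => ?_
    have := h (i + d.degree) d
    simpa using this
  complete x hx := by
    have key : ∀ d : σ →₀ ℕ, ∃ a : 𝔄, ∀ i,
        a - MvPowerSeries.coeff d (x (i + d.degree)) ∈ (filt i : Submodule ℝ 𝔄) := by
      intro d
      refine ConvenientAlgebra.complete
        (fun i => MvPowerSeries.coeff d (x (i + d.degree))) fun i => ?_
      have := hx (i + d.degree) d
      rw [map_sub] at this
      simpa [Nat.add_right_comm] using this
    choose a ha using key
    refine ⟨a, fun i d => ?_⟩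
    change a d - MvPowerSeries.coeff d (x i) ∈ (filt (i - d.degree) : Submodule ℝ 𝔄)
    by_cases h : d.degree ≤ i
    · have := ha d (i - d.degree)
      rw [Nat.sub_add_cancel h] at this
      exact this
    · have : i - d.degree = 0 := by omega
      rw [this, ConvenientAlgebra.filt_zero]
      trivial
  finite_quotient i := by
    have hfin : Finite {d : σ →₀ ℕ | d.degree < i} := Finsupp.finite_of_degree_lt i
    have hq : ∀ j, Module.Finite ℝ (𝔄 ⧸ (filt j : Submodule ℝ 𝔄)) :=
      ConvenientAlgebra.finite_quotient
    let f : MvPowerSeries σ 𝔄 →ₗ[ℝ]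
        ((d : {d : σ →₀ ℕ | d.degree < i}) → 𝔄 ⧸ (filt (i - d.1.degree) : Submodule ℝ 𝔄)) :=
      LinearMap.pi fun d => (filt (i - d.1.degree) : Submodule ℝ 𝔄).mkQ ∘ₗ
        { toFun := fun g => MvPowerSeries.coeff d.1 g
          map_add' := fun _ _ => map_add _ _ _
          map_smul' := fun _ _ => rfl }
    refine finite_quotient_of_ker_le f _ ?_
    intro g hg d
    by_cases h : d.degree < i
    · have h1 := congrFun (LinearMap.mem_ker.mp hg) ⟨d, h⟩
      exact (Submodule.Quotient.mk_eq_zero _).mp h1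
    · have : i - d.degree = 0 := by omega
      rw [this, ConvenientAlgebra.filt_zero]
      trivial

theorem finite_cliffordAlgebra (V : Type u) [AddCommGroup V] [Module ℝ V]
    [FiniteDimensional ℝ V] (q : QuadraticForm ℝ V) : Module.Finite ℝ (CliffordAlgebra q) := by
  have : Invertible (2 : ℝ) := invertibleOfNonzero two_ne_zero
  have h : Module.Finite ℝ (ExteriorAlgebra ℝ V) :=
    Module.Finite.of_basis (Module.finBasis ℝ V).ExteriorAlgebra
  exact Module.Finite.equiv (CliffordAlgebra.equivExterior q).symm

/-- The Clifford algebra of a finite dimensional quadratic space, with the trivial filtration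
(everything in degree `0`). -/
instance instClifford (V : Type u) [AddCommGroup V] [Module ℝ V] [FiniteDimensional ℝ V]
    (q : QuadraticForm ℝ V) : ConvenientAlgebra (CliffordAlgebra q) where
  filt i := if i = 0 then ⊤ else ⊥
  filt_zero := if_pos rfl
  filt_antitone i j hij := by
    rcases Nat.eq_zero_or_pos i with h | h
    · simp [h]
    · have : j ≠ 0 := by omega
      simp [this]
  mul_mem_filt {i j a b} ha hb := by
    by_cases hi : i = 0
    · by_cases hj : j = 0
      · simp [hi, hj]
      · simp only [hj, if_false, Submodule.mem_bot] at hb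
        simp [hb]
    · simp only [hi, if_false, Submodule.mem_bot] at ha
      simp [ha]
  hausdorff a h := by simpa using h 1
  complete x hx := by
    refine ⟨x 1, fun i => ?_⟩
    by_cases hi : i = 0
    · simp [hi]
    · have h1 : ∀ k, x (k + 1) = x 1 := by
        intro k
        induction k with
        | zero => rfl
        | succ k ih =>
          have := hx (k + 1)
          simp only [Nat.add_eq_zero_iff, one_ne_zero, and_false, if_false,
            Submodule.mem_bot] at this
          rw [← ih, ← sub_eq_zero, this]
      obtain ⟨k, rfl⟩ := Nat.exists_eq_succ_of_ne_zero hi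
      simp [h1]
  finite_quotient i := by
    have := finite_cliffordAlgebra V q
    infer_instance

section Topology

variable {𝔄 : Type u} [Ring 𝔄] [Algebra ℝ 𝔄] [ConvenientAlgebra 𝔄]

/-- The linear functionals which factor through some filtration quotient, i.e. the continuous
functionals of the natural topology. -/
def IsContinuousFunctional (f : 𝔄 →ₗ[ℝ] ℝ) : Prop :=
  ∃ i, ∀ a ∈ (filt i : Submodule ℝ 𝔄), f a = 0

/-- Convergence in the natural topology, i.e. in every (finite dimensional) filtration
quotient, where it can be tested by linear functionals. -/
def ConvergesTo (x : ℕ → 𝔄) (a : 𝔄) : Prop :=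
  ∀ f : 𝔄 →ₗ[ℝ] ℝ, IsContinuousFunctional f →
    Filter.Tendsto (fun k => f (x k)) Filter.atTop (nhds (f a))

open Classical in
/-- The limit of a convergent sequence. -/
def limit (x : ℕ → 𝔄) : 𝔄 :=
  if h : ∃ a, ConvergesTo x a then h.choose else 0

/-- The exponential `∑ Xʳ / r!` (the series converges for every `X`). -/
def expo (X : 𝔄) : 𝔄 :=
  limit fun N => ∑ r ∈ Finset.range N, ((r.factorial : ℝ)⁻¹) • X ^ r

end Topology

/-! ### (Floating) Clifford systems and multipowers -/

section Clifford

variable {𝔄 : Type u} [Ring 𝔄] [Algebra ℝ 𝔄]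

/-- `Q i * Q j + Q j * Q i = - 2 δ_ij`. -/
def IsClifford {n : ℕ} (Q : Fin n → 𝔄) : Prop :=
  ∀ i j, Q i * Q j + Q j * Q i = if i = j then -2 else 0

/-- The `n`-tuple `(Q₂ Q₁⁻¹, ..., Qₙ₊₁ Q₁⁻¹)`. -/
def tilde {n : ℕ} (Q : Fin (n + 1) → 𝔄) : Fin n → 𝔄 :=
  fun i => Q i.succ * Ring.inverse (Q 0)

/-- Floating Clifford systems: `Q₁` is invertible and `(Q₂ Q₁⁻¹, ..., Qₙ₊₁ Q₁⁻¹)` is a Clifford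
system. -/
def IsFloatingClifford {n : ℕ} (Q : Fin (n + 1) → 𝔄) : Prop :=
  IsUnit (Q 0) ∧ IsClifford (tilde Q)

/-- `Q₁^{ι₁} ⋯ Qₙ^{ιₙ}`. -/
def multipower {n : ℕ} (Q : Fin n → 𝔄) (e : Fin n → Fin 2) : 𝔄 :=
  (List.ofFn fun i => Q i ^ (e i : ℕ)).prod

/-- `Q^{ι₀} R_{j₁} Q^{ι₁} R_{j₂} ⋯ R_{jᵣ} Q^{ιᵣ}`. -/
def word {n m r : ℕ} (Q : Fin n → 𝔄) (R : Fin m → 𝔄) (e : Fin (r + 1) → Fin n → Fin 2)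
    (j : Fin r → Fin m) : 𝔄 :=
  multipower Q (e 0) * (List.ofFn fun s : Fin r => R (j s) * multipower Q (e s.succ)).prod

/-- Real coefficients `ψ_{ι₀, ..., ιᵣ}^{[k]; j₁, ..., jᵣ}` of power series expansions, with
multiindices `ι` in `{0,1}ⁿ` and `j, k` in `{1, ..., m}`. -/
abbrev SeriesData (n m : ℕ) : Type :=
  (k : Fin m) → (r : ℕ) → (Fin (r + 1) → Fin n → Fin 2) → (Fin r → Fin m) → ℝ

/-- The `r`-th expansion term `∑ ψ Q^{ι₀} R_{j₁} Q^{ι₁} ⋯ R_{jᵣ} Q^{ιᵣ}`. -/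
def expansionTerm {n m : ℕ} (ψ : SeriesData n m) (Q : Fin n → 𝔄) (R : Fin m → 𝔄)
    (k : Fin m) (r : ℕ) : 𝔄 :=
  ∑ e : Fin (r + 1) → Fin n → Fin 2, ∑ j : Fin r → Fin m, ψ k r e j • word Q R e j

/-- `R_Q^0 = (R + Q⁻¹ R Q) / 2` and `R_Q^1 = (R - Q⁻¹ R Q) / 2`. -/
def symmetrization (Q : 𝔄) (e : Fin 2) (R : 𝔄) : 𝔄 :=
  (1 / 2 : ℝ) • (R + (-1 : ℝ) ^ (e : ℕ) • (Ring.inverse Q * R * Q))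

/-- `R_{Q₁}^{ι₁} ⋯ _{Qₙ}^{ιₙ}`. -/
def component {n : ℕ} (Q : Fin n → 𝔄) (e : Fin n → Fin 2) (R : 𝔄) : 𝔄 :=
  (List.finRange n).foldl (fun X i => symmetrization (Q i) (e i) X) R

end Clifford

/-! ### Connections and the formal `ω`-orthogonalization -/

/-- Connection data `ω_j^ι` with `ω_j^ι = 0` if `ι_j = 0` and `∑_j ω_j^ι = 1` if `ι ≠ 0`. -/
structure ConnectionData (n : ℕ) where
  coeff : Fin n → (Fin n → Fin 2) → ℝ
  coeff_eq_zero : ∀ j e, e j = 0 → coeff j e = 0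
  sum_coeff : ∀ e, e ≠ 0 → ∑ j, coeff j e = 1

open Classical in
/-- The Gram-Schmidt data: `1` if `j = min {h | ι_h = 1}`, and `0` otherwise. -/
def gsData (n : ℕ) : ConnectionData n where
  coeff j e := if e j = 1 ∧ ∀ h < j, e h = 0 then 1 else 0
  coeff_eq_zero j e h := by simp [h]
  sum_coeff e he := by
    have h2 : ∀ x : Fin 2, x ≠ 0 → x = 1 := by decide
    have hne : ∃ i, e i ≠ 0 := by
      by_contra hcon
      push Not at hcon
      exact he (funext hcon)
    obtain ⟨i, hi, hmin⟩ := WellFounded.has_min (wellFounded_lt (α := Fin n))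
      {i | e i ≠ 0} hne
    rw [Finset.sum_eq_single i]
    · rw [if_pos]
      exact ⟨h2 _ hi, fun h hh => by_contra fun hc => hmin h hc hh⟩
    · intro b _ hb
      rw [if_neg]
      rintro ⟨hb1, hb2⟩
      rcases lt_trichotomy b i with h | h | h
      · exact hmin b (by simp [hb1]) h
      · exact hb h
      · exact hi (hb2 i h)
    · simp

/-- The symmetric data `ι_j / (ι₁ + ⋯ + ιₙ)` (equal to `0` for `ι = 0`). -/
def syData (n : ℕ) : ConnectionData n where
  coeff j e := ((e j : ℕ) : ℝ) / ∑ i, ((e i : ℕ) : ℝ)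
  coeff_eq_zero j e h := by simp [h]
  sum_coeff e he := by
    rw [← Finset.sum_div, div_self]
    intro h
    rw [Finset.sum_eq_zero_iff_of_nonneg (fun i _ => Nat.cast_nonneg _)] at h
    refine he (funext fun i => Fin.ext ?_)
    have h1 : (e i : ℕ) = 0 := by exact_mod_cast h i (Finset.mem_univ i)
    simpa using h1

section Connection

variable {𝔄 : Type u} [Ring 𝔄] [Algebra ℝ 𝔄]

/-- The connection `Π_Q^ω R = (1/2) ∑ ω_j^ι (R_j Q_j⁻¹)_{Q₁}^{ι₁} ⋯ _{Qₙ}^{ιₙ}`. -/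
def connection {n : ℕ} (ω : ConnectionData n) (Q R : Fin n → 𝔄) : 𝔄 :=
  (1 / 2 : ℝ) • ∑ j, ∑ e, ω.coeff j e • component Q e (R j * Ring.inverse (Q j))

/-- The left part of the floating connection: `(1/2) ∑ ω_j^ι` times the component of
`R_j Q_j⁻¹` with indices `ι_s - ι_k` (mod 2) with respect to `Q_s Q_k⁻¹`, with `k = 1`. -/
def floatConnectionLeft {n : ℕ} (ω : ConnectionData (n + 1)) (Q R : Fin (n + 1) → 𝔄) : 𝔄 :=
  (1 / 2 : ℝ) • ∑ j, ∑ e, ω.coeff j e •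
    component (fun s => Q s * Ring.inverse (Q 0)) (fun s => e s - e 0) (R j * Ring.inverse (Q j))

/-- The right part of the floating connection: `(1/2) ∑ ω_j^ι` times the component of
`Q_j⁻¹ R_j` with indices `ι_s - ι_k` (mod 2) with respect to `Q_k⁻¹ Q_s`, with `k = 1`. -/
def floatConnectionRight {n : ℕ} (ω : ConnectionData (n + 1)) (Q R : Fin (n + 1) → 𝔄) : 𝔄 :=
  (1 / 2 : ℝ) • ∑ j, ∑ e, ω.coeff j e •
    component (fun s => Ring.inverse (Q 0) * Q s) (fun s => e s - e 0) (Ring.inverse (Q j) * R j)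

variable [ConvenientAlgebra 𝔄]

/-- `Step_A^ω Q = Ad (exp (Π_Q^ω (A - Q))) Q`. -/
def step {n : ℕ} (ω : ConnectionData n) (A Q : Fin n → 𝔄) : Fin n → 𝔄 :=
  fun i => expo (connection ω Q (A - Q)) * Q i * Ring.inverse (expo (connection ω Q (A - Q)))

/-- The floating step `Q ↦ exp X * Q * exp Y`, where `(X, Y)` is the floating connection
applied to `A - Q`. -/
def floatStep {n : ℕ} (ω : ConnectionData (n + 1)) (A Q : Fin (n + 1) → 𝔄) :
    Fin (n + 1) → 𝔄 :=
  fun i => expo (floatConnectionLeft ω Q (A - Q)) * Q i *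
    expo (floatConnectionRight ω Q (A - Q))

/-- `A - Q` lies in filtration degree `1`. -/
def FormallyClose {n : ℕ} (A Q : Fin n → 𝔄) : Prop :=
  ∀ i, A i - Q i ∈ (filt 1 : Submodule ℝ 𝔄)

/-- The formal domain: perturbations of Clifford systems in filtration degree `1`. -/
def FormalDomain {n : ℕ} (A : Fin n → 𝔄) : Prop :=
  ∃ Q : Fin n → 𝔄, IsClifford Q ∧ FormallyClose A Q

/-- The floating formal domain. -/
def FloatFormalDomain {n : ℕ} (A : Fin (n + 1) → 𝔄) : Prop :=
  ∃ Q : Fin (n + 1) → 𝔄, IsFloatingClifford Q ∧ FormallyClose A Q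

end Connection

/-- An operation on `n`-tuples: for every convenient algebra, a relation between `n`-tuples.
`Ψ 𝔄 A B` means that `Ψ` is defined on the tuple `A` and takes there the value `B`. -/
abbrev Operation (n : ℕ) : Type (u + 1) :=
  (𝔄 : Type u) → [Ring 𝔄] → [Algebra ℝ 𝔄] → [ConvenientAlgebra 𝔄] →
    (Fin n → 𝔄) → (Fin n → 𝔄) → Prop

/-- The formal `ω`-orthogonalization: `A` is a perturbation of some Clifford system, and for
every Clifford system `Q` which `A` is a perturbation of, the iterates `(Step_A^ω)ᵏ Q` converge
to `B`. -/
def orthogonalization {n : ℕ} (ω : ConnectionData n) : Operation.{u} n :=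
  fun 𝔄 _ _ _ A B => FormalDomain A ∧
    ∀ Q : Fin n → 𝔄, IsClifford Q → FormallyClose A Q →
      ∀ i, ConvergesTo (fun k => ((step ω A)^[k] Q) i) (B i)

/-- The formal `ω`-conform-orthogonalization. -/
def conformOrthogonalization {n : ℕ} (ω : ConnectionData (n + 1)) : Operation.{u} (n + 1) :=
  fun 𝔄 _ _ _ A B => FloatFormalDomain A ∧
    ∀ Q : Fin (n + 1) → 𝔄, IsFloatingClifford Q → FormallyClose A Q →
      ∀ i, ConvergesTo (fun k => ((floatStep ω A)^[k] Q) i) (B i)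

/-! ### The (non-formal) Gram-Schmidt procedures -/

section GramSchmidt

variable {𝔄 : Type u} [Ring 𝔄] [Algebra ℝ 𝔄] [ConvenientAlgebra 𝔄]

/-- `cos² t + S sin² t`. -/
def pencil (S : 𝔄) (t : ℝ) : 𝔄 := algebraMap ℝ 𝔄 (Real.cos t ^ 2) + (Real.sin t ^ 2) • S

/-- `X = S^{-1/2} = ∫_0^{2π} (cos² t + S sin² t)⁻¹ dt / 2π`, defined if all the inverses exist.
The integrand is then continuous, and the integral (taken in the filtration quotients) is
tested by linear functionals. -/
def IsInvSqrt (S X : 𝔄) : Prop :=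
  (∀ t : ℝ, IsUnit (pencil S t)) ∧
    ∀ f : 𝔄 →ₗ[ℝ] ℝ, IsContinuousFunctional f →
      f X = (∫ t in (0 : ℝ)..(2 * Real.pi), f (Ring.inverse (pencil S t))) / (2 * Real.pi)

/-- `P = pol H = H (-H²)^{-1/2}`. -/
def IsPolarization (H P : 𝔄) : Prop :=
  ∃ X, IsInvSqrt (-(H * H)) X ∧ P = H * X

/-- The recursion `B_k = pol (A_k)_{B₁}^1 ⋯ _{B_{k-1}}^1` of the Gram-Schmidt
orthogonalization. -/
def IsGramSchmidt {n : ℕ} (A B : Fin n → 𝔄) : Prop :=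
  ∀ k : Fin n, IsPolarization
    (((List.ofFn B).take k).foldl (fun X Q => symmetrization Q 1 X) (A k)) (B k)

/-- The Gram-Schmidt conform-orthogonalization of `A` is `(A₁, C₂ A₁, ..., Cₙ₊₁ A₁)`, where `C`
is the Gram-Schmidt orthogonalization of `(A₂ A₁⁻¹, ..., Aₙ₊₁ A₁⁻¹)`. -/
def IsConformGramSchmidt {n : ℕ} (A B : Fin (n + 1) → 𝔄) : Prop :=
  IsUnit (A 0) ∧ ∃ C : Fin n → 𝔄, IsGramSchmidt (tilde A) C ∧
    B = Fin.cons (A 0) fun i => C i * A 0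

end GramSchmidt

/-! ### Properties of operations -/

section Properties

variable {n : ℕ}

/-- An operation assigns at most one tuple to a tuple. -/
def SingleValued (Ψ : Operation.{u} n) : Prop :=
  ∀ (𝔄 : Type u) [Ring 𝔄] [Algebra ℝ 𝔄] [ConvenientAlgebra 𝔄] (A B B' : Fin n → 𝔄),
    Ψ 𝔄 A B → Ψ 𝔄 A B' → B = B'

/-- Compatibility with homomorphisms of filtered algebras and with direct sums. -/
def Natural (Ψ : Operation.{u} n) : Prop :=
  (∀ (𝔄 : Type u) [Ring 𝔄] [Algebra ℝ 𝔄] [ConvenientAlgebra 𝔄]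
      (𝔅 : Type u) [Ring 𝔅] [Algebra ℝ 𝔅] [ConvenientAlgebra 𝔅] (φ : 𝔄 →ₐ[ℝ] 𝔅),
      (∀ i, ∀ a ∈ (filt i : Submodule ℝ 𝔄), φ a ∈ (filt i : Submodule ℝ 𝔅)) →
      ∀ A B : Fin n → 𝔄, Ψ 𝔄 A B → Ψ 𝔅 (fun i => φ (A i)) (fun i => φ (B i))) ∧
  (∀ (𝔄 : Type u) [Ring 𝔄] [Algebra ℝ 𝔄] [ConvenientAlgebra 𝔄]
      (𝔅 : Type u) [Ring 𝔅] [Algebra ℝ 𝔅] [ConvenientAlgebra 𝔅]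
      (A B : Fin n → 𝔄) (A' B' : Fin n → 𝔅), Ψ 𝔄 A B → Ψ 𝔅 A' B' →
      ∃ D, Ψ (𝔄 × 𝔅) (fun i => (A i, A' i)) D)

/-- The domain consists exactly of the perturbations of Clifford systems. -/
def HasFormalDomain (Ψ : Operation.{u} n) : Prop :=
  ∀ (𝔄 : Type u) [Ring 𝔄] [Algebra ℝ 𝔄] [ConvenientAlgebra 𝔄] (A : Fin n → 𝔄),
    (∃ B, Ψ 𝔄 A B) ↔ FormalDomain A

/-- Formal analyticity: expansion into a power series with universal real coefficients around
every Clifford system. -/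
def FormallyAnalytic (Ψ : Operation.{u} n) : Prop :=
  ∃ ψ : SeriesData n n,
    ∀ (𝔄 : Type u) [Ring 𝔄] [Algebra ℝ 𝔄] [ConvenientAlgebra 𝔄] (Q R : Fin n → 𝔄),
      IsClifford Q → (∀ i, R i ∈ (filt 1 : Submodule ℝ 𝔄)) →
      ∃ B : Fin n → 𝔄, Ψ 𝔄 (fun i => Q i + R i) B ∧
        ∀ k, ConvergesTo (fun N => ∑ r ∈ Finset.range N, expansionTerm ψ Q R k r) (B k)

/-- The values are Clifford systems. -/
def CliffordProductive (Ψ : Operation.{u} n) : Prop :=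
  ∀ (𝔄 : Type u) [Ring 𝔄] [Algebra ℝ 𝔄] [ConvenientAlgebra 𝔄] (A B : Fin n → 𝔄),
    Ψ 𝔄 A B → IsClifford B

/-- Formal FQ orthogonalization procedures. -/
structure IsFormalOrthogonalization (Ψ : Operation.{u} n) : Prop where
  singleValued : SingleValued Ψ
  natural : Natural Ψ
  formalDomain : HasFormalDomain Ψ
  analytic : FormallyAnalytic Ψ
  productive : CliffordProductive Ψ

/-- Sign changes of the variables induce the same sign changes of the values. -/
def SignLinear (Ψ : Operation.{u} n) : Prop :=
  ∀ (𝔄 : Type u) [Ring 𝔄] [Algebra ℝ 𝔄] [ConvenientAlgebra 𝔄] (A B : Fin n → 𝔄)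
    (e : Fin n → Fin 2), Ψ 𝔄 A B →
      Ψ 𝔄 (fun i => (-1 : ℝ) ^ (e i : ℕ) • A i) (fun i => (-1 : ℝ) ^ (e i : ℕ) • B i)

/-- Clifford systems are left fixed. -/
def CliffordConservative (Ψ : Operation.{u} n) : Prop :=
  ∀ (𝔄 : Type u) [Ring 𝔄] [Algebra ℝ 𝔄] [ConvenientAlgebra 𝔄] (Q : Fin n → 𝔄),
    IsClifford Q → Ψ 𝔄 Q Q

/-- Formal scalar 0-homogeneity: `Ψ ((1 + t) A) = Ψ A` in `𝔄[[t]]`. -/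
def FormallyHomogeneous (Ψ : Operation.{u} n) : Prop :=
  ∀ (𝔄 : Type u) [Ring 𝔄] [Algebra ℝ 𝔄] [ConvenientAlgebra 𝔄] (A B : Fin n → 𝔄),
    Ψ 𝔄 A B → Ψ (PowerSeries 𝔄) (fun i => (1 + PowerSeries.X) * PowerSeries.C (A i))
      (fun i => PowerSeries.C (B i))

/-- The formal fiber-star property: `Ψ (t A + (1 - t) B) = B` for `B = Ψ A` and every real
`t`. -/
def FiberStar (Ψ : Operation.{u} n) : Prop :=
  ∀ (𝔄 : Type u) [Ring 𝔄] [Algebra ℝ 𝔄] [ConvenientAlgebra 𝔄] (A B : Fin n → 𝔄),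
    Ψ 𝔄 A B → ∀ t : ℝ, Ψ 𝔄 (fun i => t • A i + (1 - t) • B i) B

/-- Permutation symmetry. -/
def PermutationSymmetric (Ψ : Operation.{u} n) : Prop :=
  ∀ (𝔄 : Type u) [Ring 𝔄] [Algebra ℝ 𝔄] [ConvenientAlgebra 𝔄] (A B : Fin n → 𝔄)
    (σ : Equiv.Perm (Fin n)), Ψ 𝔄 A B → Ψ 𝔄 (fun i => A (σ i)) (fun i => B (σ i))

/-- Equivariance with respect to orthogonal changes of coordinates. -/
def OrthogonallyEquivariant (Ψ : Operation.{u} n) : Prop :=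
  ∀ (𝔄 : Type u) [Ring 𝔄] [Algebra ℝ 𝔄] [ConvenientAlgebra 𝔄] (A B : Fin n → 𝔄)
    (U : Matrix (Fin n) (Fin n) ℝ), U ∈ Matrix.orthogonalGroup (Fin n) ℝ → Ψ 𝔄 A B →
      Ψ 𝔄 (fun i => ∑ j, U i j • A j) (fun i => ∑ j, U i j • B j)

/-- Bivariance. -/
def Bivariant (Ψ : Operation.{u} n) : Prop :=
  ∀ (𝔄 : Type u) [Ring 𝔄] [Algebra ℝ 𝔄] [ConvenientAlgebra 𝔄] (A B : Fin n → 𝔄)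
    (θ₁ θ₂ : 𝔄), IsUnit θ₁ → IsUnit θ₂ → Ψ 𝔄 A B →
      Ψ 𝔄 (fun i => θ₁ * A i * θ₂) (fun i => θ₁ * B i * θ₂)

/-- The domain consists exactly of the perturbations of floating Clifford systems. -/
def HasFloatFormalDomain (Ψ : Operation.{u} (n + 1)) : Prop :=
  ∀ (𝔄 : Type u) [Ring 𝔄] [Algebra ℝ 𝔄] [ConvenientAlgebra 𝔄] (A : Fin (n + 1) → 𝔄),
    (∃ B, Ψ 𝔄 A B) ↔ FloatFormalDomain A

/-- Formal floating analyticity: expansion into a power series in terms of `Q_i Q₁⁻¹` and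
`R_j Q₁⁻¹`, multiplied from the right by `Q₁`. -/
def FloatFormallyAnalytic (Ψ : Operation.{u} (n + 1)) : Prop :=
  ∃ ψ : SeriesData n (n + 1),
    ∀ (𝔄 : Type u) [Ring 𝔄] [Algebra ℝ 𝔄] [ConvenientAlgebra 𝔄] (Q R : Fin (n + 1) → 𝔄),
      IsFloatingClifford Q → (∀ i, R i ∈ (filt 1 : Submodule ℝ 𝔄)) →
      ∃ B : Fin (n + 1) → 𝔄, Ψ 𝔄 (fun i => Q i + R i) B ∧
        ∀ k, ConvergesTo (fun N => ∑ r ∈ Finset.range N,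
          expansionTerm ψ (tilde Q) (fun j => R j * Ring.inverse (Q 0)) k r * Q 0) (B k)

/-- The values are floating Clifford systems. -/
def FloatCliffordProductive (Ψ : Operation.{u} (n + 1)) : Prop :=
  ∀ (𝔄 : Type u) [Ring 𝔄] [Algebra ℝ 𝔄] [ConvenientAlgebra 𝔄] (A B : Fin (n + 1) → 𝔄),
    Ψ 𝔄 A B → IsFloatingClifford B

/-- Formal FQ conform-orthogonalization procedures. -/
structure IsFormalConformOrthogonalization (Ψ : Operation.{u} (n + 1)) : Prop where
  singleValued : SingleValued Ψ
  natural : Natural Ψ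
  bivariant : Bivariant Ψ
  formalDomain : HasFloatFormalDomain Ψ
  analytic : FloatFormallyAnalytic Ψ
  productive : FloatCliffordProductive Ψ

/-- Floating Clifford systems are left fixed. -/
def FloatCliffordConservative (Ψ : Operation.{u} (n + 1)) : Prop :=
  ∀ (𝔄 : Type u) [Ring 𝔄] [Algebra ℝ 𝔄] [ConvenientAlgebra 𝔄] (Q : Fin (n + 1) → 𝔄),
    IsFloatingClifford Q → Ψ 𝔄 Q Q

end Properties

/-! ### Permanence with respect to the symmetric procedures -/

section Symmetric

variable {V : Type u} [AddCommGroup V] [Module ℝ V] {m n : ℕ}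

/-- Formal power series in `m` variables with coefficients in a vector space. -/
abbrev FormalVector (m : ℕ) (V : Type u) : Type u := (Fin m →₀ ℕ) → V

/-- The Gram matrix, with entries in `ℝ[[t₁, ..., tₘ]]`, of a tuple of formal vectors. -/
def gram (q : QuadraticForm ℝ V) (a : Fin n → FormalVector m V) :
    Matrix (Fin n) (Fin n) (MvPowerSeries (Fin m) ℝ) :=
  fun i j d => ∑ p ∈ Finset.HasAntidiagonal.antidiagonal d, QuadraticMap.associated q (a j p.1) (a i p.2)

/-- The tuple `[a₁, ..., aₙ] T` for a matrix `T` over `ℝ[[t₁, ..., tₘ]]`. -/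
def vecMul (a : Fin n → FormalVector m V) (T : Matrix (Fin n) (Fin n) (MvPowerSeries (Fin m) ℝ)) :
    Fin n → FormalVector m V :=
  fun i d => ∑ j, ∑ p ∈ Finset.HasAntidiagonal.antidiagonal d, MvPowerSeries.coeff p.1 (T j i) • a j p.2

/-- `W` is the square root of `S` with constant term `√c` (the expansion of the positive definite
square root, if `S` has constant term `c`). -/
def IsFormalSqrt (c : ℝ) (S W : Matrix (Fin n) (Fin n) (MvPowerSeries (Fin m) ℝ)) : Prop :=
  W * W = S ∧ W.map MvPowerSeries.constantCoeff = Real.sqrt c • (1 : Matrix (Fin n) (Fin n) ℝ)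

/-- The image of a formal vector under `cl : V → Cl(V, q)`, where `cl(v)² = - q(v)`. -/
def cl (q : QuadraticForm ℝ V) (a : FormalVector m V) :
    MvPowerSeries (Fin m) (CliffordAlgebra (-q)) :=
  fun d => CliffordAlgebra.ι (-q) (a d)

end Symmetric

/-- Formal permanence with respect to the symmetric orthogonalization: for every formal family
`a` of `n`-tuples of vectors with `n` orthonormal constant terms, with Gram matrix `S`,
`Ψ(cl(a)) = cl([a₁, ..., aₙ] S^{-1/2})`. -/
def SymmetricPermanent {n : ℕ} (Ψ : Operation.{u} n) : Prop :=
  ∀ (V : Type u) [AddCommGroup V] [Module ℝ V] [FiniteDimensional ℝ V] (q : QuadraticForm ℝ V),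
    q.PosDef → ∀ (m : ℕ) (a : Fin n → FormalVector m V),
    (∀ i j, QuadraticMap.associated q (a i 0) (a j 0) = if i = j then 1 else 0) →
    ∃ W, IsFormalSqrt 1 (gram q a) W ∧
      Ψ (MvPowerSeries (Fin m) (CliffordAlgebra (-q))) (fun i => cl q (a i))
        (fun i => cl q (vecMul a W⁻¹ i))

/-- Formal permanence with respect to the symmetric conform-orthogonalization: for every formal
family `a` of `n`-tuples of vectors whose constant terms are pairwise orthogonal and have equal
positive square lengths, with Gram matrix `S`,
`Ψ(cl(a)) = cl([a₁, ..., aₙ] S^{-1/2} · tr(S^{1/2}) / n)`. -/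
def ConformSymmetricPermanent {n : ℕ} (Ψ : Operation.{u} n) : Prop :=
  ∀ (V : Type u) [AddCommGroup V] [Module ℝ V] [FiniteDimensional ℝ V] (q : QuadraticForm ℝ V),
    q.PosDef → ∀ (m : ℕ) (a : Fin n → FormalVector m V) (c : ℝ), 0 < c →
    (∀ i j, QuadraticMap.associated q (a i 0) (a j 0) = if i = j then c else 0) →
    ∃ W, IsFormalSqrt c (gram q a) W ∧
      Ψ (MvPowerSeries (Fin m) (CliffordAlgebra (-q))) (fun i => cl q (a i))
        (fun i => cl q (vecMul a ((n : ℝ)⁻¹ • (W.trace • W⁻¹)) i))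

end FQ

end

noncomputable section

namespace FQ

set_option linter.unusedSectionVars false

open ConvenientAlgebra (filt)

/-! ### Filtration calculus: degree sums, power series, units, inverses and exponentials near 1. -/

section Filtration

variable {𝔄 : Type u} [Ring 𝔄] [Algebra ℝ 𝔄] [ConvenientAlgebra 𝔄]

/-! The iteration is a Newton scheme, and the theorem follows once its limit is identified as the
unique solution of a system of equations that no longer mentions the iteration.

Conjugations by the members of a Clifford system are commuting involutions, so the algebra splits
into joint eigenspaces, onto which `component` projects. At a floating Clifford system Q a
perturbation R has one part for each multiindex, `floatPart ω Q R e`. For a tangent vector XQ_j +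
Q_jY the projected terms entering one part agree for all j that carry weight, and the weights add up
to 1, so its parts do not depend on ω (`floatPart_tangent`). Hence the connection, applied to R,
yields a tangent vector with the same parts as R (`floatPart_connection`). Moving Q along it by
exponentials cancels the parts of A - Q to leading order: if they lie in filtration degree i, the
new ones lie in degree i + 1 (`floatPart_contract`). The iterates converge to a floating Clifford
system B near A such that all parts of A - B vanish (`FollowsConnection.exists_solution`).

Such a B is unique. To leading order the difference of two solutions satisfies the linearized
Clifford relations; these equate the components that enter one part, so vanishing parts kill every
component, and the difference moves up one degree (`IsFloatSolution.unique`). Therefore the limit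
does not depend on the start, and the operation is the relation `IsFloatSolution`
(`conformOrthogonalization_iff`).

The non-floating case is embedded by Q ↦ (1, Q), with ω extended so that slot zero takes all the
weight whenever it is active (`isSolution_iff_cons`, `followsConnection_step`).

Naturality, bivariance, signs, homogeneity and the fiber-star property are visible symmetries of the
equations. For analyticity the equations are solved once in a universal convenient algebra, a
Rees-type algebra over a Clifford system and free letters; its degree r elements are combinations of
words with r letters, and the solution is pushed forward (`exists_universalHom`). For Gram–Schmidt
data the equations make the reduced element H commute with B_k, and then B_k is the polarization of
H (`isPolarization_of_commute`). For symmetric data they become ∑ (A_jB_j - B_jA_j) = 0, and in the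
floating case, with R = A - B, ∑ R_jB_j⁻¹ = 0 = ∑ B_j⁻¹R_j. These are invariant under O(n), and they
hold in the vector case because A = CW with C a Clifford system and W symmetric (`sum_combine_mul`).
-/

theorem mem_filt_zero (a : 𝔄) : a ∈ (filt 0 : Submodule ℝ 𝔄) := by
  rw [ConvenientAlgebra.filt_zero]; trivial

theorem mem_filt_of_le {i j : ℕ} {a : 𝔄} (h : i ≤ j) (ha : a ∈ (filt j : Submodule ℝ 𝔄)) :
    a ∈ (filt i : Submodule ℝ 𝔄) :=
  ConvenientAlgebra.filt_antitone h ha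

theorem mul_mem_filt_of_le {i j k : ℕ} {a b : 𝔄} (ha : a ∈ (filt i : Submodule ℝ 𝔄))
    (hb : b ∈ (filt j : Submodule ℝ 𝔄)) (h : k ≤ i + j) : a * b ∈ (filt k : Submodule ℝ 𝔄) :=
  mem_filt_of_le h (ConvenientAlgebra.mul_mem_filt ha hb)

theorem mul_mem_filt_left (a : 𝔄) {b : 𝔄} {i : ℕ} (hb : b ∈ (filt i : Submodule ℝ 𝔄)) :
    a * b ∈ (filt i : Submodule ℝ 𝔄) :=
  mul_mem_filt_of_le (mem_filt_zero a) hb (by omega)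

theorem mul_mem_filt_right (a : 𝔄) {b : 𝔄} {i : ℕ} (hb : b ∈ (filt i : Submodule ℝ 𝔄)) :
    b * a ∈ (filt i : Submodule ℝ 𝔄) :=
  mul_mem_filt_of_le hb (mem_filt_zero a) (by omega)

theorem pow_mem_filt {x : 𝔄} {i : ℕ} (hx : x ∈ (filt i : Submodule ℝ 𝔄)) (r : ℕ) :
    x ^ r ∈ (filt (r * i) : Submodule ℝ 𝔄) := by
  induction r with
  | zero => simpa using mem_filt_zero _
  | succ r ih =>
    rw [pow_succ]
    exact mul_mem_filt_of_le ih hx (by rw [Nat.add_mul]; omega)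

theorem pow_mem_filt' {x : 𝔄} (hx : x ∈ (filt 1 : Submodule ℝ 𝔄)) (r : ℕ) :
    x ^ r ∈ (filt r : Submodule ℝ 𝔄) := by
  simpa using pow_mem_filt hx r

theorem eq_of_forall_sub_mem {a b : 𝔄} (h : ∀ i, a - b ∈ (filt i : Submodule ℝ 𝔄)) : a = b :=
  sub_eq_zero.mp (ConvenientAlgebra.hausdorff _ h)

theorem mul_sub_mul_mem {i : ℕ} {a a' b b' : 𝔄} (ha : a - a' ∈ (filt i : Submodule ℝ 𝔄))
    (hb : b - b' ∈ (filt i : Submodule ℝ 𝔄)) : a * b - a' * b' ∈ (filt i : Submodule ℝ 𝔄) := by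
  have : a * b - a' * b' = a * (b - b') + (a - a') * b' := by noncomm_ring
  rw [this]
  exact add_mem (mul_mem_filt_left _ hb) (mul_mem_filt_right _ ha)

/-- `a = ∑ f r` where `a` is approximated by the `N`-th partial sum in filtration degree `N`. -/
def HasDegreeSum (f : ℕ → 𝔄) (a : 𝔄) : Prop :=
  ∀ N, a - ∑ r ∈ Finset.range N, f r ∈ (filt N : Submodule ℝ 𝔄)

theorem exists_hasDegreeSum {f : ℕ → 𝔄} (hf : ∀ r, f r ∈ (filt r : Submodule ℝ 𝔄)) :
    ∃ a, HasDegreeSum f a := by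
  refine ConvenientAlgebra.complete (fun N => ∑ r ∈ Finset.range N, f r) fun N => ?_
  simpa [Finset.sum_range_succ] using hf N

theorem HasDegreeSum.unique {f : ℕ → 𝔄} {a b : 𝔄} (ha : HasDegreeSum f a)
    (hb : HasDegreeSum f b) : a = b :=
  eq_of_forall_sub_mem fun N => by simpa using sub_mem (ha N) (hb N)

theorem HasDegreeSum.add {f g : ℕ → 𝔄} {a b : 𝔄} (ha : HasDegreeSum f a)
    (hb : HasDegreeSum g b) : HasDegreeSum (fun r => f r + g r) (a + b) := fun N => by
  rw [Finset.sum_add_distrib, add_sub_add_comm]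
  exact add_mem (ha N) (hb N)

/-- The product of two partial sums differs from the partial Cauchy sum by terms of total index at
least N, which lie in degree N. -/
theorem HasDegreeSum.mul {f g : ℕ → 𝔄} {a b : 𝔄} (hf : ∀ r, f r ∈ (filt r : Submodule ℝ 𝔄))
    (hg : ∀ r, g r ∈ (filt r : Submodule ℝ 𝔄)) (ha : HasDegreeSum f a) (hb : HasDegreeSum g b) :
    HasDegreeSum (fun r => ∑ p ∈ Finset.HasAntidiagonal.antidiagonal r, f p.1 * g p.2) (a * b) := fun N => by
  have h1 := mul_sub_mul_mem (ha N) (hb N)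
  have h2 : (∑ r ∈ Finset.range N, f r) * (∑ r ∈ Finset.range N, g r) -
      ∑ r ∈ Finset.range N, ∑ p ∈ Finset.HasAntidiagonal.antidiagonal r, f p.1 * g p.2 ∈
        (filt N : Submodule ℝ 𝔄) := by
    have h3 : ∑ r ∈ Finset.range N, ∑ p ∈ Finset.HasAntidiagonal.antidiagonal r, f p.1 * g p.2 =
        ∑ p ∈ (Finset.range N ×ˢ Finset.range N).filter (fun p => p.1 + p.2 < N),
          f p.1 * g p.2 := by
      rw [Finset.sum_sigma']
      refine Finset.sum_bij (fun x _ => x.2) ?_ ?_ ?_ ?_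
      · rintro ⟨r, p⟩ h
        simp only [Finset.mem_sigma, Finset.mem_range, Finset.HasAntidiagonal.mem_antidiagonal] at h
        simp only [Finset.mem_filter, Finset.mem_product, Finset.mem_range]
        omega
      · rintro ⟨r, p⟩ h ⟨r', p'⟩ h' he
        simp only [Finset.mem_sigma, Finset.HasAntidiagonal.mem_antidiagonal] at h h'
        obtain ⟨-, rfl⟩ := h
        obtain ⟨-, rfl⟩ := h'
        dsimp only at he
        subst he
        rfl
      · rintro p h
        simp only [Finset.mem_filter, Finset.mem_product, Finset.mem_range] at h
        exact ⟨⟨p.1 + p.2, p⟩, by simp [h.2], rfl⟩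
      · rintro ⟨r, p⟩ h
        rfl
    rw [h3, Finset.sum_mul_sum, ← Finset.sum_product',
      ← Finset.sum_filter_add_sum_filter_not (Finset.range N ×ˢ Finset.range N)
        (fun p => p.1 + p.2 < N) (fun p => f p.1 * g p.2), add_sub_cancel_left]
    refine Submodule.sum_mem _ fun p hp => mul_mem_filt_of_le (hf _) (hg _) ?_
    simpa using (Finset.mem_filter.mp hp).2
  simpa using add_mem h1 h2

theorem HasDegreeSum.sub_zeroth_mem {f : ℕ → 𝔄} {a : 𝔄} (ha : HasDegreeSum f a) :
    a - f 0 ∈ (filt 1 : Submodule ℝ 𝔄) := by simpa using ha 1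

theorem HasDegreeSum.commute {f : ℕ → 𝔄} {a b : 𝔄} (ha : HasDegreeSum f a)
    (h : ∀ r, Commute (f r) b) : Commute a b := by
  refine eq_of_forall_sub_mem fun N => ?_
  have h1 : Commute (∑ r ∈ Finset.range N, f r) b := Commute.sum_left _ _ _ fun r _ => h r
  have h2 := sub_mem (mul_mem_filt_right b (ha N)) (mul_mem_filt_left b (ha N))
  rw [sub_mul, mul_sub, h1.eq] at h2
  simpa using h2

/-- `a` is the value `∑ F_r xʳ` of the power series `F` at `x`. -/
def IsSeriesValue (F : PowerSeries ℝ) (x a : 𝔄) : Prop :=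
  HasDegreeSum (fun r => PowerSeries.coeff r F • x ^ r) a

theorem smul_pow_mem_filt {x : 𝔄} (hx : x ∈ (filt 1 : Submodule ℝ 𝔄)) (c : ℝ) (r : ℕ) :
    c • x ^ r ∈ (filt r : Submodule ℝ 𝔄) :=
  Submodule.smul_mem _ _ (pow_mem_filt' hx r)

theorem exists_isSeriesValue (F : PowerSeries ℝ) {x : 𝔄} (hx : x ∈ (filt 1 : Submodule ℝ 𝔄)) :
    ∃ a, IsSeriesValue F x a :=
  exists_hasDegreeSum fun r => smul_pow_mem_filt hx _ r

theorem IsSeriesValue.mul {F G : PowerSeries ℝ} {x a b : 𝔄}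
    (hx : x ∈ (filt 1 : Submodule ℝ 𝔄)) (ha : IsSeriesValue F x a) (hb : IsSeriesValue G x b) :
    IsSeriesValue (F * G) x (a * b) := by
  have h := HasDegreeSum.mul (fun r => smul_pow_mem_filt hx _ r)
    (fun r => smul_pow_mem_filt hx _ r) ha hb
  unfold IsSeriesValue
  convert h using 2 with r
  rw [PowerSeries.coeff_mul, Finset.sum_smul]
  refine Finset.sum_congr rfl fun p hp => ?_
  rw [smul_mul_smul_comm, ← pow_add, Finset.HasAntidiagonal.mem_antidiagonal.mp hp]

theorem isSeriesValue_one_add_X {x : 𝔄} (hx : x ∈ (filt 1 : Submodule ℝ 𝔄)) :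
    IsSeriesValue (1 + PowerSeries.X) x (1 + x) := fun N => by
  rcases N with _ | _ | N
  · exact mem_filt_zero _
  · simpa using hx
  · rw [Finset.sum_range_succ', Finset.sum_range_succ', Finset.sum_eq_zero]
    · simp [PowerSeries.coeff_X, PowerSeries.coeff_one, add_comm]
    · intro r _
      simp [PowerSeries.coeff_X, PowerSeries.coeff_one]

theorem isSeriesValue_one (x : 𝔄) : IsSeriesValue 1 x 1 := fun N => by
  rcases N with _ | N
  · exact mem_filt_zero _
  · rw [Finset.sum_range_succ', Finset.sum_eq_zero]
    · simp
    · intro r _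
      simp [PowerSeries.coeff_one]

theorem IsSeriesValue.commute {F : PowerSeries ℝ} {x a b : 𝔄} (ha : IsSeriesValue F x a)
    (h : Commute x b) : Commute a b :=
  HasDegreeSum.commute ha fun r => (h.pow_left r).smul_left _

theorem IsSeriesValue.sub_mem {F : PowerSeries ℝ} {x a : 𝔄} (ha : IsSeriesValue F x a)
    (h : PowerSeries.constantCoeff F = 1) : a - 1 ∈ (filt 1 : Submodule ℝ 𝔄) := by
  simpa [h] using HasDegreeSum.sub_zeroth_mem ha

theorem IsSeriesValue.unique {F : PowerSeries ℝ} {x a b : 𝔄} (ha : IsSeriesValue F x a)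
    (hb : IsSeriesValue F x b) : a = b := HasDegreeSum.unique ha hb

/-- The geometric series `∑ (-c)ʳ xʳ`. -/
theorem exists_geometric (c : ℝ) {x : 𝔄} (hx : x ∈ (filt 1 : Submodule ℝ 𝔄)) :
    ∃ a, IsSeriesValue (PowerSeries.mk fun r => (-c) ^ r) x a ∧
      (1 + c • x) * a = 1 ∧ a * (1 + c • x) = 1 := by
  obtain ⟨a, ha⟩ := exists_isSeriesValue (PowerSeries.mk fun r => (-c) ^ r) hx
  refine ⟨a, ha, ?_⟩
  have hcomm : Commute a (1 + c • x) := ha.commute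
    ((Commute.one_right x).add_right ((Commute.refl x).smul_right c))
  have h1 : (1 + c • x) * a = 1 := by
    refine eq_of_forall_sub_mem fun N => ?_
    have h2 := mul_mem_filt_left (1 + c • x) (ha N)
    have h3 : ∑ r ∈ Finset.range N, PowerSeries.coeff r (PowerSeries.mk fun r => (-c) ^ r) • x ^ r
        = ∑ r ∈ Finset.range N, (-(c • x)) ^ r := by
      refine Finset.sum_congr rfl fun r _ => ?_
      rw [PowerSeries.coeff_mk, ← neg_smul, smul_pow]
    -- Multiplication by 1 + cx telescopes the partial sum, leaving the error (-cx)^N.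
    rw [h3, mul_sub, ← sub_neg_eq_add, mul_neg_geom_sum] at h2
    have h4 : (-(c • x)) ^ N ∈ (filt N : Submodule ℝ 𝔄) :=
      pow_mem_filt' (neg_mem (Submodule.smul_mem _ _ hx)) N
    have := sub_mem h2 h4
    rw [sub_neg_eq_add] at this
    convert this using 1
    abel
  exact ⟨h1, hcomm.eq.trans h1⟩

theorem isUnit_one_add_smul (c : ℝ) {x : 𝔄} (hx : x ∈ (filt 1 : Submodule ℝ 𝔄)) :
    IsUnit (1 + c • x) := by
  obtain ⟨a, -, h1, h2⟩ := exists_geometric c hx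
  exact ⟨⟨_, a, h1, h2⟩, rfl⟩

theorem isUnit_of_sub_one_mem {u : 𝔄} (h : u - 1 ∈ (filt 1 : Submodule ℝ 𝔄)) : IsUnit u := by
  simpa using isUnit_one_add_smul 1 h

theorem isUnit_of_sub_mem {u v : 𝔄} (hu : IsUnit u) (h : v - u ∈ (filt 1 : Submodule ℝ 𝔄)) :
    IsUnit v := by
  obtain ⟨u, rfl⟩ := hu
  have h1 : IsUnit (↑u⁻¹ * v) := isUnit_of_sub_one_mem (by
    have := mul_mem_filt_left (↑u⁻¹ : 𝔄) h
    rwa [mul_sub, Units.inv_mul] at this)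
  simpa using u.isUnit.mul h1

theorem inverse_sub_inverse_mem {i : ℕ} {a b : 𝔄} (ha : IsUnit a) (hb : IsUnit b)
    (h : a - b ∈ (filt i : Submodule ℝ 𝔄)) :
    Ring.inverse a - Ring.inverse b ∈ (filt i : Submodule ℝ 𝔄) := by
  obtain ⟨a, rfl⟩ := ha
  obtain ⟨b, rfl⟩ := hb
  have h1 := mul_mem_filt_right (↑b⁻¹ : 𝔄) (mul_mem_filt_left (↑a⁻¹ : 𝔄) h)
  rw [mul_sub, Units.inv_mul, sub_mul, mul_assoc, Units.mul_inv] at h1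
  rw [Ring.inverse_unit, Ring.inverse_unit, ← neg_mem_iff]
  simpa using h1

/-- The error beyond first order is (u⁻¹ - 1)(u - 1), of degree 2i; it is negligible because 1 ≤ i.
-/
theorem inverse_sub_sub_mem {i : ℕ} {u X : 𝔄} (hi : 1 ≤ i) (hX : X ∈ (filt i : Submodule ℝ 𝔄))
    (h : u - 1 - X ∈ (filt (i + 1) : Submodule ℝ 𝔄)) :
    Ring.inverse u - 1 + X ∈ (filt (i + 1) : Submodule ℝ 𝔄) := by
  have hu1 : u - 1 ∈ (filt i : Submodule ℝ 𝔄) := by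
    simpa using add_mem (mem_filt_of_le (Nat.le_succ i) h) hX
  have hu : IsUnit u := isUnit_of_sub_one_mem (mem_filt_of_le hi hu1)
  have h2 := inverse_sub_inverse_mem hu isUnit_one hu1
  rw [Ring.inverse_one] at h2
  have h3 : Ring.inverse u - 1 + X = -(u - 1 - X) - (Ring.inverse u - 1) * (u - 1) := by
    have := Ring.inverse_mul_cancel u hu
    rw [sub_mul, mul_sub, this]
    noncomm_ring
  rw [h3]
  exact sub_mem (neg_mem h) (mul_mem_filt_of_le h2 hu1 (by omega))

theorem exists_functional {i : ℕ} {a : 𝔄} (ha : a ∉ (filt i : Submodule ℝ 𝔄)) :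
    ∃ f : 𝔄 →ₗ[ℝ] ℝ, IsContinuousFunctional f ∧ f a ≠ 0 := by
  obtain ⟨f, hf, h⟩ := Submodule.exists_le_ker_of_notMem ha
  exact ⟨f, ⟨i, fun b hb => h hb⟩, hf⟩

theorem eq_of_forall_functional {a b : 𝔄}
    (h : ∀ f : 𝔄 →ₗ[ℝ] ℝ, IsContinuousFunctional f → f a = f b) : a = b := by
  refine eq_of_forall_sub_mem fun i => ?_
  by_contra hc
  obtain ⟨f, hf, h1⟩ := exists_functional hc
  exact h1 (by rw [map_sub, h f hf, sub_self])

theorem ConvergesTo.unique {x : ℕ → 𝔄} {a b : 𝔄} (ha : ConvergesTo x a) (hb : ConvergesTo x b) :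
    a = b :=
  eq_of_forall_functional fun f hf => tendsto_nhds_unique (ha f hf) (hb f hf)

/-- A continuous functional kills some filtration degree, so it is eventually constant along the
sequence. All limits below are of this kind; no analysis in the finite dimensional quotients is
needed for them. -/
theorem convergesTo_of_sub_mem {x : ℕ → 𝔄} {a : 𝔄}
    (h : ∀ k, a - x k ∈ (filt k : Submodule ℝ 𝔄)) : ConvergesTo x a := by
  rintro f ⟨i, hi⟩
  refine tendsto_const_nhds.congr' ?_
  filter_upwards [Filter.eventually_ge_atTop i] with k hk
  have := hi _ (mem_filt_of_le hk (h k))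
  rw [map_sub, sub_eq_zero] at this
  exact this

theorem ConvergesTo.limit_eq {x : ℕ → 𝔄} {a : 𝔄} (h : ConvergesTo x a) : limit x = a := by
  have h1 : ∃ a, ConvergesTo x a := ⟨a, h⟩
  rw [limit, dif_pos h1]
  exact h1.choose_spec.unique h

theorem HasDegreeSum.convergesTo {f : ℕ → 𝔄} {a : 𝔄} (h : HasDegreeSum f a) :
    ConvergesTo (fun N => ∑ r ∈ Finset.range N, f r) a :=
  convergesTo_of_sub_mem h

theorem hasDegreeSum_expo {X : 𝔄} (hX : X ∈ (filt 1 : Submodule ℝ 𝔄)) :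
    HasDegreeSum (fun r => ((r.factorial : ℝ)⁻¹) • X ^ r) (expo X) := by
  obtain ⟨a, ha⟩ := exists_hasDegreeSum (f := fun r => ((r.factorial : ℝ)⁻¹) • X ^ r)
    fun r => smul_pow_mem_filt hX _ r
  rw [expo, ha.convergesTo.limit_eq]
  exact ha

theorem expo_sub_sub_mem {i : ℕ} {X : 𝔄} (hi : 1 ≤ i) (hX : X ∈ (filt i : Submodule ℝ 𝔄)) :
    expo X - 1 - X ∈ (filt (i + 1) : Submodule ℝ 𝔄) := by
  -- Taking i + 2 terms guarantees that both 1 and X can be split off; the other terms contain X²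
  -- and have degree at least 2i ≥ i + 1.
  have h := hasDegreeSum_expo (mem_filt_of_le hi hX) (i + 2)
  rw [Finset.sum_range_succ', Finset.sum_range_succ'] at h
  have h1 : ∑ r ∈ Finset.range i, (((r + 1 + 1).factorial : ℝ)⁻¹) • X ^ (r + 1 + 1) ∈
      (filt (i + 1) : Submodule ℝ 𝔄) := by
    refine Submodule.sum_mem _ fun r _ => Submodule.smul_mem _ _ ?_
    refine mem_filt_of_le ?_ (pow_mem_filt hX _)
    nlinarith
  have h2 := add_mem (mem_filt_of_le (Nat.le_succ _) h) h1
  simp only [zero_add, Nat.factorial_one, Nat.cast_one, inv_one, pow_one, one_smul,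
    Nat.factorial_zero, pow_zero] at h2
  convert h2 using 1
  abel

end Filtration

theorem fin_two_eq (a : Fin 2) : a = 0 ∨ a = 1 := by omega

/-! ### Joint eigenspace projections of a Clifford system. -/

section Component

variable {𝔄 : Type*} [Ring 𝔄] [Algebra ℝ 𝔄]

theorem IsClifford.sq {n : ℕ} {Q : Fin n → 𝔄} (hQ : IsClifford Q) (i : Fin n) :
    Q i * Q i = -1 := by
  have h := hQ i i
  rw [if_pos rfl, ← two_smul ℝ] at h
  have h2 : (2 : ℝ) • (Q i * Q i) = (2 : ℝ) • (-1) := by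
    rw [h, smul_neg, two_smul, one_add_one_eq_two]
  exact smul_right_injective 𝔄 (two_ne_zero (α := ℝ)) h2

theorem IsClifford.anticomm {n : ℕ} {Q : Fin n → 𝔄} (hQ : IsClifford Q) {i j : Fin n}
    (h : i ≠ j) : Q i * Q j = -(Q j * Q i) := by
  have h := hQ i j
  rw [if_neg ‹_›] at h
  exact eq_neg_of_add_eq_zero_left h

theorem isClifford_iff {n : ℕ} {Q : Fin n → 𝔄} : IsClifford Q ↔
    (∀ i, Q i * Q i = -1) ∧ ∀ i j, i ≠ j → Q i * Q j = -(Q j * Q i) := by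
  refine ⟨fun h => ⟨h.sq, fun i j => h.anticomm⟩, fun ⟨h1, h2⟩ i j => ?_⟩
  by_cases hij : i = j
  · subst hij
    rw [if_pos rfl, h1, ← two_mul, mul_neg, mul_one]
  · rw [if_neg hij, h2 i j hij, neg_add_cancel]

theorem inverse_of_sq {a : 𝔄} (h : a * a = -1) : Ring.inverse a = -a := by
  let u : 𝔄ˣ := ⟨a, -a, by rw [mul_neg, h, neg_neg], by rw [neg_mul, h, neg_neg]⟩
  exact Ring.inverse_unit u

theorem isUnit_of_sq {a : 𝔄} (h : a * a = -1) : IsUnit a :=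
  ⟨⟨a, -a, by rw [mul_neg, h, neg_neg], by rw [neg_mul, h, neg_neg]⟩, rfl⟩

theorem IsClifford.inverse {n : ℕ} {Q : Fin n → 𝔄} (hQ : IsClifford Q) (i : Fin n) :
    Ring.inverse (Q i) = -Q i := inverse_of_sq (hQ.sq i)

theorem IsClifford.isUnit {n : ℕ} {Q : Fin n → 𝔄} (hQ : IsClifford Q) (i : Fin n) :
    IsUnit (Q i) := isUnit_of_sq (hQ.sq i)

theorem IsClifford.tail {n : ℕ} {Q : Fin (n + 1) → 𝔄} (hQ : IsClifford Q) :
    IsClifford (Fin.tail Q) := fun i j => by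
  simpa [Fin.tail] using hQ i.succ j.succ

theorem IsClifford.map {𝔅 : Type*} [Ring 𝔅] [Algebra ℝ 𝔅] (φ : 𝔄 →ₐ[ℝ] 𝔅) {n : ℕ}
    {Q : Fin n → 𝔄} (hQ : IsClifford Q) : IsClifford fun i => φ (Q i) := fun i j => by
  rw [← map_mul, ← map_mul, ← map_add, hQ i j]
  split_ifs
  · rw [map_neg, map_ofNat]
  · exact map_zero φ

/-- `symmetrization` as a linear map. -/
def symmetrizationₗ (Q : 𝔄) (e : Fin 2) : 𝔄 →ₗ[ℝ] 𝔄 :=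
  (1 / 2 : ℝ) • (LinearMap.id + (-1 : ℝ) ^ (e : ℕ) •
    (LinearMap.mulRight ℝ Q ∘ₗ LinearMap.mulLeft ℝ (Ring.inverse Q)))

theorem symmetrizationₗ_apply (Q : 𝔄) (e : Fin 2) (R : 𝔄) :
    symmetrizationₗ Q e R = symmetrization Q e R := rfl

theorem component_fin_zero (Q : Fin 0 → 𝔄) (e : Fin 0 → Fin 2) (R : 𝔄) : component Q e R = R := rfl

theorem component_succ {n : ℕ} (Q : Fin (n + 1) → 𝔄) (e : Fin (n + 1) → Fin 2) (R : 𝔄) :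
    component Q e R =
      component (Fin.tail Q) (Fin.tail e) (symmetrization (Q 0) (e 0) R) := by
  rw [component, List.finRange_succ, List.foldl_cons, List.foldl_map]
  rfl

/-- `component` as a linear map. -/
def componentₗ : {n : ℕ} → (Fin n → 𝔄) → (Fin n → Fin 2) → 𝔄 →ₗ[ℝ] 𝔄
  | 0, _, _ => LinearMap.id
  | _ + 1, Q, e => componentₗ (Fin.tail Q) (Fin.tail e) ∘ₗ symmetrizationₗ (Q 0) (e 0)

theorem componentₗ_apply {n : ℕ} (Q : Fin n → 𝔄) (e : Fin n → Fin 2) (R : 𝔄) :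
    componentₗ Q e R = component Q e R := by
  induction n generalizing R with
  | zero => rfl
  | succ n ih =>
    rw [component_succ, componentₗ, LinearMap.comp_apply, ih, symmetrizationₗ_apply]

theorem component_add {n : ℕ} (Q : Fin n → 𝔄) (e : Fin n → Fin 2) (R S : 𝔄) :
    component Q e (R + S) = component Q e R + component Q e S := by
  simp only [← componentₗ_apply, map_add]

theorem component_sub {n : ℕ} (Q : Fin n → 𝔄) (e : Fin n → Fin 2) (R S : 𝔄) :
    component Q e (R - S) = component Q e R - component Q e S := by
  simp only [← componentₗ_apply, map_sub]

theorem component_neg {n : ℕ} (Q : Fin n → 𝔄) (e : Fin n → Fin 2) (R : 𝔄) :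
    component Q e (-R) = -component Q e R := by
  simp only [← componentₗ_apply, map_neg]

theorem component_smul {n : ℕ} (Q : Fin n → 𝔄) (e : Fin n → Fin 2) (c : ℝ) (R : 𝔄) :
    component Q e (c • R) = c • component Q e R := by
  simp only [← componentₗ_apply, map_smul]

theorem component_map_zero {n : ℕ} (Q : Fin n → 𝔄) (e : Fin n → Fin 2) :
    component Q e 0 = 0 := by
  simp only [← componentₗ_apply, map_zero]

theorem component_sum {n : ℕ} (Q : Fin n → 𝔄) (e : Fin n → Fin 2) {ι : Type*} (s : Finset ι)
    (R : ι → 𝔄) : component Q e (∑ i ∈ s, R i) = ∑ i ∈ s, component Q e (R i) := by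
  simp only [← componentₗ_apply, map_sum]

theorem map_inverse {𝔅 : Type*} [Ring 𝔅] [Algebra ℝ 𝔅] (φ : 𝔄 →ₐ[ℝ] 𝔅) {a : 𝔄}
    (ha : IsUnit a) : φ (Ring.inverse a) = Ring.inverse (φ a) := by
  obtain ⟨u, rfl⟩ := ha
  rw [Ring.inverse_unit]
  exact (Ring.inverse_unit (Units.map (φ : 𝔄 →* 𝔅) u)).symm

theorem map_component {𝔅 : Type*} [Ring 𝔅] [Algebra ℝ 𝔅] (φ : 𝔄 →ₐ[ℝ] 𝔅) {n : ℕ}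
    {Q : Fin n → 𝔄} (hQ : ∀ i, IsUnit (Q i)) (e : Fin n → Fin 2) (R : 𝔄) :
    φ (component Q e R) = component (fun i => φ (Q i)) e (φ R) := by
  induction n generalizing R with
  | zero => rfl
  | succ n ih =>
    rw [component_succ, component_succ, ih (Q := Fin.tail Q) (fun i => hQ i.succ)]
    simp only [symmetrization, map_smul, map_add, map_mul, map_inverse φ (hQ 0)]
    rfl

/-- Inner automorphisms. -/
def inner (u : 𝔄ˣ) : 𝔄 →ₐ[ℝ] 𝔄 where
  toFun a := u * a * ↑u⁻¹
  map_one' := by simp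
  map_mul' a b := by
    have : (u : 𝔄) * a * ↑u⁻¹ * (u * b * ↑u⁻¹) = u * a * (↑u⁻¹ * u) * b * ↑u⁻¹ := by noncomm_ring
    rw [this, Units.inv_mul]; noncomm_ring
  map_zero' := by simp
  map_add' a b := by noncomm_ring
  commutes' r := by
    rw [← Algebra.commutes, mul_assoc, Units.mul_inv, mul_one]

theorem inner_apply (u : 𝔄ˣ) (a : 𝔄) : inner u a = u * a * ↑u⁻¹ := rfl

theorem symmetrization_clifford {P : 𝔄} (hP : P * P = -1) (e : Fin 2) (R : 𝔄) :
    symmetrization P e R = (1 / 2 : ℝ) • (R + (-1 : ℝ) ^ (e : ℕ) • -(P * R * P)) := by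
  rw [symmetrization, inverse_of_sq hP]
  simp

/-- As P⁻¹ = -P, conjugation is R ↦ -PRP, an involution, and `symmetrization` projects onto its
eigenspace of sign (-1)^e. -/
theorem symmetrization_conj_self {P : 𝔄} (hP : P * P = -1) (e : Fin 2) (R : 𝔄) :
    symmetrization P e (-(P * R * P)) = (-1 : ℝ) ^ (e : ℕ) • symmetrization P e R := by
  have h : P * (P * R * P) * P = R := by
    have : P * (P * R * P) * P = (P * P) * R * (P * P) := by noncomm_ring
    rw [this, hP]; noncomm_ring
  rw [symmetrization_clifford hP, symmetrization_clifford hP]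
  rcases fin_two_eq e with rfl | rfl
  · simp [h, add_comm]
  · simp [h, add_comm]

/-- Conjugations by anticommuting elements commute: the sign appears on both sides and cancels. -/
theorem symmetrization_conj {P S : 𝔄} (hP : P * P = -1) (hPS : P * S = -(S * P)) (e : Fin 2)
    (R : 𝔄) : symmetrization P e (-(S * R * S)) = -(S * symmetrization P e R * S) := by
  rw [symmetrization_clifford hP, symmetrization_clifford hP]
  have h : P * (S * R * S) * P = S * (P * R * P) * S := by
    have h1 : P * (S * R * S) * P = (P * S) * R * (S * P) := by noncomm_ring
    have h2 : S * (P * R * P) * S = (S * P) * R * (P * S) := by noncomm_ring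
    rw [h1, h2, hPS]; noncomm_ring
  simp only [mul_neg, neg_mul, neg_neg, mul_add, add_mul, smul_add, mul_smul_comm, smul_mul_assoc,
    smul_neg, h]
  abel

theorem component_conj_left {n : ℕ} {P : Fin n → 𝔄} (hP : IsClifford P) {S : 𝔄}
    (h : ∀ i, P i * S = -(S * P i)) (e : Fin n → Fin 2) (Z : 𝔄) :
    component P e (-(S * Z * S)) = -(S * component P e Z * S) := by
  induction n generalizing Z with
  | zero => rfl
  | succ n ih =>
    rw [component_succ, component_succ, symmetrization_conj (hP.sq 0) (h 0),
      ih hP.tail (fun i => h i.succ)]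

/-- The projection absorbs a conjugation at the cost of its eigenvalue. Together with
`conj_component`, which says that the image consists of eigenvectors, this characterizes the joint
eigenspaces. -/
theorem component_conj {n : ℕ} {P : Fin n → 𝔄} (hP : IsClifford P) (e : Fin n → Fin 2)
    (i : Fin n) (Z : 𝔄) :
    component P e (-(P i * Z * P i)) = (-1 : ℝ) ^ (e i : ℕ) • component P e Z := by
  induction n generalizing Z with
  | zero => exact i.elim0
  | succ n ih =>
    rw [component_succ, component_succ]
    refine Fin.cases ?_ (fun j => ?_) i
    · rw [symmetrization_conj_self (hP.sq 0), component_smul]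
    · rw [symmetrization_conj (hP.sq 0) (hP.anticomm (Fin.succ_ne_zero j).symm)]
      exact ih hP.tail (Fin.tail e) j _

theorem conj_component {n : ℕ} {P : Fin n → 𝔄} (hP : IsClifford P) (e : Fin n → Fin 2)
    (i : Fin n) (Z : 𝔄) :
    -(P i * component P e Z * P i) = (-1 : ℝ) ^ (e i : ℕ) • component P e Z := by
  induction n generalizing Z with
  | zero => exact i.elim0
  | succ n ih =>
    rw [component_succ]
    refine Fin.cases ?_ (fun j => ?_) i
    · rw [← component_conj_left hP.tail (S := P 0)
        (fun i => hP.anticomm (Fin.succ_ne_zero i)), ← component_smul,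
        ← symmetrization_conj_self (hP.sq 0)]
      have := hP.sq 0
      rw [symmetrization_clifford this, symmetrization_clifford this]
      congr 1
      rcases fin_two_eq (e 0) with h | h
      · simp [h, mul_add, add_mul, add_comm]
      · simp [h, mul_add, add_mul, add_comm]
    · exact ih hP.tail (Fin.tail e) j _

/-- In each slot the two symmetrizations add up to the identity; no Clifford relation enters. -/
theorem sum_component {n : ℕ} (P : Fin n → 𝔄) (Z : 𝔄) :
    ∑ e, component P e Z = Z := by
  induction n generalizing Z with
  | zero => simp [component_fin_zero]
  | succ n ih =>
    rw [← (Fin.consEquiv fun _ : Fin (n + 1) => Fin 2).sum_comp, Fintype.sum_prod_type]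
    have h : ∀ a : Fin 2, ∑ e : Fin n → Fin 2,
        component P (Fin.consEquiv (fun _ : Fin (n + 1) => Fin 2) (a, e)) Z =
          symmetrization (P 0) a Z := fun a => by
      rw [← ih (Fin.tail P) (symmetrization (P 0) a Z)]
      exact Finset.sum_congr rfl fun e _ => component_succ _ _ _
    rw [Fin.sum_univ_two, h, h, symmetrization, symmetrization]
    simp only [Fin.val_zero, pow_zero, one_smul, Fin.val_one, pow_one, neg_smul]
    rw [← smul_add, add_add_add_comm, add_neg_cancel, add_zero, ← two_smul ℝ Z, smul_smul]
    norm_num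

theorem neg_one_pow_ne {a b : Fin 2} (h : a ≠ b) : ((-1 : ℝ) ^ (a : ℕ)) ≠ (-1) ^ (b : ℕ) := by
  rcases fin_two_eq a with rfl | rfl <;> rcases fin_two_eq b with rfl | rfl <;>
    first | exact absurd rfl h | norm_num

/-- In a slot where the multiindices differ, the two eigenvalues of the same conjugation are 1 and
-1. -/
theorem component_component_of_ne {n : ℕ} {P : Fin n → 𝔄} (hP : IsClifford P)
    {e e' : Fin n → Fin 2} (h : e ≠ e') (Z : 𝔄) : component P e (component P e' Z) = 0 := by
  obtain ⟨i, hi⟩ := Function.ne_iff.mp h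
  have h1 := component_conj hP e i (component P e' Z)
  rw [conj_component hP, component_smul, ← sub_eq_zero, ← sub_smul] at h1
  exact (smul_eq_zero.mp h1).resolve_left (sub_ne_zero.mpr (neg_one_pow_ne hi).symm)

theorem component_component_self {n : ℕ} {P : Fin n → 𝔄} (hP : IsClifford P)
    (e : Fin n → Fin 2) (Z : 𝔄) : component P e (component P e Z) = component P e Z := by
  conv_rhs => rw [← sum_component P Z, component_sum]
  exact (Finset.sum_eq_single e (fun e' _ h => component_component_of_ne hP h.symm Z)
    (fun h => absurd (Finset.mem_univ _) h)).symm

theorem component_component {n : ℕ} {P : Fin n → 𝔄} (hP : IsClifford P)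
    (e e' : Fin n → Fin 2) (Z : 𝔄) :
    component P e (component P e' Z) = if e = e' then component P e Z else 0 := by
  split_ifs with h
  · rw [← h, component_component_self hP]
  · exact component_component_of_ne hP h Z

theorem component_one {n : ℕ} {P : Fin n → 𝔄} (hP : IsClifford P) {e : Fin n → Fin 2}
    (he : e ≠ 0) : component P e 1 = 0 := by
  obtain ⟨i, hi⟩ := Function.ne_iff.mp he
  have h1 := component_conj hP e i 1
  rw [mul_one, hP.sq, neg_neg, ← sub_eq_zero, ← one_smul ℝ (component P e 1), smul_smul,
    ← sub_smul, mul_one] at h1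
  have h2 := neg_one_pow_ne hi
  simp only [Pi.zero_apply, Fin.val_zero, pow_zero] at h2
  exact (smul_eq_zero.mp h1).resolve_left (sub_ne_zero.mpr h2.symm)

theorem eq_zero_of_component {n : ℕ} {P : Fin n → 𝔄} {Z : 𝔄} (h : ∀ e, component P e Z = 0) :
    Z = 0 := by
  rw [← sum_component P Z, Finset.sum_eq_zero fun e _ => h e]

end Component

/-! ### Components and the filtration. -/

section Filtered

variable {𝔄 : Type u} [Ring 𝔄] [Algebra ℝ 𝔄] [ConvenientAlgebra 𝔄]

theorem symmetrization_mem {i : ℕ} (Q : 𝔄) (e : Fin 2) {Z : 𝔄}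
    (hZ : Z ∈ (filt i : Submodule ℝ 𝔄)) : symmetrization Q e Z ∈ (filt i : Submodule ℝ 𝔄) :=
  Submodule.smul_mem _ _ (add_mem hZ (Submodule.smul_mem _ _
    (mul_mem_filt_right _ (mul_mem_filt_left _ hZ))))

theorem component_mem {n i : ℕ} (Q : Fin n → 𝔄) (e : Fin n → Fin 2) {Z : 𝔄}
    (hZ : Z ∈ (filt i : Submodule ℝ 𝔄)) : component Q e Z ∈ (filt i : Submodule ℝ 𝔄) := by
  induction n generalizing Z with
  | zero => exact hZ
  | succ n ih => rw [component_succ]; exact ih _ _ (symmetrization_mem _ _ hZ)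

theorem mem_of_component_mem {n i : ℕ} {P : Fin n → 𝔄} {Z : 𝔄}
    (h : ∀ e, component P e Z ∈ (filt i : Submodule ℝ 𝔄)) : Z ∈ (filt i : Submodule ℝ 𝔄) := by
  rw [← sum_component P Z]
  exact Submodule.sum_mem _ fun e _ => h e

theorem symmetrization_sub_mem {i k : ℕ} {P P' : 𝔄} (hP : IsUnit P) (hP' : IsUnit P')
    (h : P - P' ∈ (filt i : Submodule ℝ 𝔄)) (e : Fin 2) {Z : 𝔄}
    (hZ : Z ∈ (filt k : Submodule ℝ 𝔄)) :
    symmetrization P e Z - symmetrization P' e Z ∈ (filt (i + k) : Submodule ℝ 𝔄) := by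
  have h1 := inverse_sub_inverse_mem hP hP' h
  have h2 : symmetrization P e Z - symmetrization P' e Z = (1 / 2 : ℝ) • (-1 : ℝ) ^ (e : ℕ) •
      ((Ring.inverse P - Ring.inverse P') * Z * P + Ring.inverse P' * (Z * (P - P'))) := by
    have : (Ring.inverse P - Ring.inverse P') * Z * P + Ring.inverse P' * (Z * (P - P')) =
      Ring.inverse P * Z * P - Ring.inverse P' * Z * P' := by noncomm_ring
    rw [this, symmetrization, symmetrization, ← smul_sub, add_sub_add_left_eq_sub, ← smul_sub]
  rw [h2]
  refine Submodule.smul_mem _ _ (Submodule.smul_mem _ _ (add_mem ?_ ?_))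
  · exact mul_mem_filt_right _ (mul_mem_filt_of_le h1 hZ le_rfl)
  · exact mul_mem_filt_left _ (mul_mem_filt_of_le hZ h (by omega))

/-- Perturbing the base point by degree i changes a projection only by i degrees above its argument.
This allows parts to be compared at neighbouring base points, both in the limit and in the
uniqueness proof. -/
theorem component_sub_mem {n i k : ℕ} {P P' : Fin n → 𝔄} (hP : ∀ j, IsUnit (P j))
    (hP' : ∀ j, IsUnit (P' j)) (h : ∀ j, P j - P' j ∈ (filt i : Submodule ℝ 𝔄))
    (e : Fin n → Fin 2) {Z : 𝔄} (hZ : Z ∈ (filt k : Submodule ℝ 𝔄)) :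
    component P e Z - component P' e Z ∈ (filt (i + k) : Submodule ℝ 𝔄) := by
  induction n generalizing Z with
  | zero => simp [component_fin_zero]
  | succ n ih =>
    rw [component_succ, component_succ]
    have h1 := ih (P := Fin.tail P) (P' := Fin.tail P') (fun j => hP j.succ) (fun j => hP' j.succ) (fun j => h j.succ) (Fin.tail e)
      (symmetrization_mem (P 0) (e 0) hZ)
    have h2 := component_mem (Fin.tail P') (Fin.tail e)
      (symmetrization_sub_mem (hP 0) (hP' 0) (h 0) (e 0) hZ)
    rw [component_sub] at h2
    simpa using add_mem h1 h2

end Filtered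

/-! ### The floating connection and its parts. -/

section Floating

variable {𝔄 : Type*} [Ring 𝔄] [Algebra ℝ 𝔄] {n : ℕ}

/-- The multiindex relative to its zeroth entry. -/
def relIndex (e : Fin (n + 1) → Fin 2) : Fin n → Fin 2 := fun s => e s.succ - e 0

theorem eq_of_relIndex_eq {e e' : Fin (n + 1) → Fin 2} (h0 : e 0 = e' 0)
    (h : relIndex e = relIndex e') : e = e' := by
  funext s
  refine Fin.cases h0 (fun s => ?_) s
  have := congrFun h s
  simp only [relIndex, h0] at this
  simpa using this

theorem IsFloatingClifford.succ_eq {Q : Fin (n + 1) → 𝔄} (hQ : IsFloatingClifford Q) (s : Fin n) :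
    Q s.succ = tilde Q s * Q 0 := by
  rw [tilde, mul_assoc, Ring.inverse_mul_cancel _ hQ.1, mul_one]

theorem IsFloatingClifford.isUnit {Q : Fin (n + 1) → 𝔄} (hQ : IsFloatingClifford Q)
    (j : Fin (n + 1)) : IsUnit (Q j) := by
  refine Fin.cases hQ.1 (fun s => ?_) j
  rw [hQ.succ_eq]
  exact (hQ.2.isUnit s).mul hQ.1

theorem inverse_eq_of_mul {a b : 𝔄} (h1 : a * b = 1) (h2 : b * a = 1) : Ring.inverse a = b :=
  Ring.inverse_unit ⟨a, b, h1, h2⟩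

theorem inverse_mul_of_isUnit {a b : 𝔄} (ha : IsUnit a) (hb : IsUnit b) :
    Ring.inverse (a * b) = Ring.inverse b * Ring.inverse a := by
  obtain ⟨a, rfl⟩ := ha
  obtain ⟨b, rfl⟩ := hb
  rw [← Units.val_mul, Ring.inverse_unit, Ring.inverse_unit, Ring.inverse_unit, mul_inv_rev,
    Units.val_mul]

theorem IsFloatingClifford.inverse_succ {Q : Fin (n + 1) → 𝔄} (hQ : IsFloatingClifford Q)
    (s : Fin n) : Ring.inverse (Q s.succ) = -(Ring.inverse (Q 0) * tilde Q s) := by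
  rw [hQ.succ_eq, inverse_mul_of_isUnit (hQ.2.isUnit s) hQ.1, hQ.2.inverse, mul_neg]

/-- The contribution of the multiindex `e` to the floating connection. -/
def floatPart (ω : ConnectionData (n + 1)) (Q R : Fin (n + 1) → 𝔄) (e : Fin (n + 1) → Fin 2) : 𝔄 :=
  ∑ j, ω.coeff j e • component (tilde Q) (relIndex e) (R j * Ring.inverse (Q j))

/-- The left part of the floating connection in terms of the multiindex contributions. -/
def floatLeft (ω : ConnectionData (n + 1)) (Q R : Fin (n + 1) → 𝔄) : 𝔄 :=
  (1 / 2 : ℝ) • ∑ e, floatPart ω Q R e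

/-- The right part of the floating connection, conjugated to the left side. -/
def floatTwisted (ω : ConnectionData (n + 1)) (Q R : Fin (n + 1) → 𝔄) : 𝔄 :=
  (1 / 2 : ℝ) • ∑ e, (-(-1 : ℝ) ^ (e 0 : ℕ)) • floatPart ω Q R e

/-- Slot zero holds 1 with relative index 0, so its symmetrization is the identity and only n slots
remain. -/
theorem component_relative {Q : Fin (n + 1) → 𝔄} (h0 : Q 0 = 1) (e : Fin (n + 1) → Fin 2)
    (Z : 𝔄) :
    component Q (fun s => e s - e 0) Z = component (Fin.tail Q) (relIndex e) Z := by
  rw [component_succ, h0, sub_self, symmetrization, Ring.inverse_one]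
  have : (1 / 2 : ℝ) • (Z + (-1 : ℝ) ^ ((0 : Fin 2) : ℕ) • (1 * Z * 1)) = Z := by
    simp [← two_smul ℝ Z, smul_smul]
  rw [this]
  rfl

theorem floatConnectionLeft_eq (ω : ConnectionData (n + 1)) {Q : Fin (n + 1) → 𝔄}
    (hQ : IsFloatingClifford Q) (R : Fin (n + 1) → 𝔄) :
    floatConnectionLeft ω Q R = floatLeft ω Q R := by
  rw [floatConnectionLeft, floatLeft, Finset.sum_comm]
  congr 1
  refine Finset.sum_congr rfl fun e _ => Finset.sum_congr rfl fun j _ => ?_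
  rw [component_relative (Q := fun s => Q s * Ring.inverse (Q 0))
    (Ring.mul_inverse_cancel _ hQ.1)]
  rfl

theorem neg_one_pow_relIndex {e : Fin (n + 1) → Fin 2} {s : Fin n} (h : e s.succ = 1) :
    (-1 : ℝ) ^ (relIndex e s : ℕ) = -(-1 : ℝ) ^ (e 0 : ℕ) := by
  rw [relIndex, h]
  rcases fin_two_eq (e 0) with h0 | h0 <;> simp [h0]

/-- If e j = 0 the weight vanishes. If e j = 1, conjugation by the j-th relative element has sign
-(-1)^{e 0} on this component, and for j = 0 that sign is 1, matching the absence of a conjugation.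
So the sign is the same for every j that carries weight. -/
theorem component_twist (ω : ConnectionData (n + 1)) {Q : Fin (n + 1) → 𝔄}
    (hQ : IsFloatingClifford Q) (e : Fin (n + 1) → Fin 2) (j : Fin (n + 1)) {Z Z' : 𝔄}
    (h0 : j = 0 → Z' = Z) (h : ∀ s : Fin n, j = s.succ → Z' = -(tilde Q s * Z * tilde Q s)) :
    ω.coeff j e • component (tilde Q) (relIndex e) Z' =
      ω.coeff j e • (-(-1 : ℝ) ^ (e 0 : ℕ)) • component (tilde Q) (relIndex e) Z := by
  rcases fin_two_eq (e j) with hj | hj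
  · rw [ω.coeff_eq_zero j e hj, zero_smul, zero_smul]
  · congr 1
    induction j using Fin.cases with
    | zero => rw [h0 rfl, hj]; simp
    | succ s => rw [h s rfl, component_conj hQ.2, neg_one_pow_relIndex hj]

theorem floatConnectionRight_eq (ω : ConnectionData (n + 1)) {Q : Fin (n + 1) → 𝔄}
    (hQ : IsFloatingClifford Q) (R : Fin (n + 1) → 𝔄) :
    floatConnectionRight ω Q R = Ring.inverse (Q 0) * floatTwisted ω Q R * Q 0 := by
  obtain ⟨u, hu⟩ := hQ.1
  have hinv : Ring.inverse (Q 0) = ↑u⁻¹ := by rw [← hu, Ring.inverse_unit]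
  have hin : ∀ a, Ring.inverse (Q 0) * a * Q 0 = inner u⁻¹ a := fun a => by
    rw [inner_apply, hinv, ← hu, inv_inv]
  rw [hin, floatConnectionRight, floatTwisted, Finset.sum_comm, map_smul, map_sum]
  congr 1
  refine Finset.sum_congr rfl fun e _ => ?_
  rw [map_smul, floatPart, map_sum, Finset.smul_sum]
  refine Finset.sum_congr rfl fun j _ => ?_
  -- Conjugation by Q₀ turns Q₀⁻¹Q_s into Q_sQ₀⁻¹, and Q_j⁻¹R_j into the conjugate of R_jQ_j⁻¹ by
  -- the j-th relative element (R₀Q₀⁻¹ itself for j = 0), so `component_twist` supplies the sign.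
  rw [component_relative (Q := fun s => Ring.inverse (Q 0) * Q s)
    (Ring.inverse_mul_cancel _ hQ.1), map_smul, smul_comm, ← map_smul, ← map_smul,
    ← component_twist ω hQ e j (Z' := inner u (Ring.inverse (Q j) * R j)), map_smul,
    map_component _ hQ.2.isUnit]
  · congr 2
    · funext s
      rw [← hin, tilde, Fin.tail]
      rw [mul_assoc, mul_assoc, Ring.inverse_mul_cancel _ hQ.1, mul_one]
    · rw [inner_apply, inner_apply, inv_inv]
      simp [mul_assoc]
  · rintro rfl
    rw [inner_apply, hinv, Units.mul_inv_cancel_left]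
  · rintro s rfl
    rw [hQ.inverse_succ, inner_apply, hinv]
    have h1 := hQ.2.sq s
    simp only [mul_neg, neg_mul, neg_neg, mul_assoc, Units.mul_inv_cancel_left, h1, mul_one]

theorem floatPart_sub (ω : ConnectionData (n + 1)) (Q R S : Fin (n + 1) → 𝔄)
    (e : Fin (n + 1) → Fin 2) :
    floatPart ω Q (R - S) e = floatPart ω Q R e - floatPart ω Q S e := by
  simp only [floatPart, Pi.sub_apply, sub_mul, component_sub, smul_sub, Finset.sum_sub_distrib]

theorem floatPart_smul (ω : ConnectionData (n + 1)) (Q R : Fin (n + 1) → 𝔄) (c : ℝ)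
    (e : Fin (n + 1) → Fin 2) : floatPart ω Q (c • R) e = c • floatPart ω Q R e := by
  simp only [floatPart, Pi.smul_apply, smul_mul_assoc, component_smul, Finset.smul_sum]
  exact Finset.sum_congr rfl fun j _ => smul_comm _ _ _

theorem floatPart_zero (ω : ConnectionData (n + 1)) (Q R : Fin (n + 1) → 𝔄) :
    floatPart ω Q R 0 = 0 :=
  Finset.sum_eq_zero fun j _ => by rw [ω.coeff_eq_zero j 0 rfl, zero_smul]

theorem map_floatPart {𝔅 : Type*} [Ring 𝔅] [Algebra ℝ 𝔅] (φ : 𝔄 →ₐ[ℝ] 𝔅)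
    (ω : ConnectionData (n + 1)) {Q : Fin (n + 1) → 𝔄} (hQ : IsFloatingClifford Q)
    (R : Fin (n + 1) → 𝔄) (e : Fin (n + 1) → Fin 2) :
    φ (floatPart ω Q R e) = floatPart ω (fun j => φ (Q j)) (fun j => φ (R j)) e := by
  rw [floatPart, map_sum]
  refine Finset.sum_congr rfl fun j _ => ?_
  rw [map_smul, map_component φ hQ.2.isUnit, map_mul, map_inverse φ (hQ.isUnit j)]
  congr 2
  funext s
  rw [tilde, map_mul, map_inverse φ hQ.1]
  rfl

theorem IsFloatingClifford.map {𝔅 : Type*} [Ring 𝔅] [Algebra ℝ 𝔅] (φ : 𝔄 →ₐ[ℝ] 𝔅)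
    {Q : Fin (n + 1) → 𝔄} (hQ : IsFloatingClifford Q) :
    IsFloatingClifford fun j => φ (Q j) := by
  refine ⟨hQ.1.map φ, ?_⟩
  convert hQ.2.map φ using 2 with s
  rw [tilde, tilde, map_mul, map_inverse φ hQ.1]

theorem tilde_bivariant (u : 𝔄ˣ) {v : 𝔄} (hv : IsUnit v) {Q : Fin (n + 1) → 𝔄}
    (hQ : IsUnit (Q 0)) : tilde (fun j => u * Q j * v) = fun s => inner u (tilde Q s) := by
  funext s
  rw [tilde, inverse_mul_of_isUnit (u.isUnit.mul hQ) hv, inverse_mul_of_isUnit u.isUnit hQ,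
    Ring.inverse_unit, inner_apply, tilde]
  have : (u : 𝔄) * Q s.succ * v * (Ring.inverse v * (Ring.inverse (Q 0) * ↑u⁻¹)) =
    u * Q s.succ * (v * Ring.inverse v) * (Ring.inverse (Q 0) * ↑u⁻¹) := by noncomm_ring
  rw [this, Ring.mul_inverse_cancel _ hv]
  noncomm_ring

theorem IsFloatingClifford.bivariant {Q : Fin (n + 1) → 𝔄} (hQ : IsFloatingClifford Q)
    {u v : 𝔄} (hu : IsUnit u) (hv : IsUnit v) : IsFloatingClifford fun j => u * Q j * v := by
  obtain ⟨u, rfl⟩ := hu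
  refine ⟨(u.isUnit.mul hQ.1).mul hv, ?_⟩
  rw [tilde_bivariant u hv hQ.1]
  exact hQ.2.map _

/-- The right factor cancels in R_jQ_j⁻¹ and in the relative tuple, and the left factor acts by
conjugation. Besides giving (Biv′), this computes parts at a moved base point from those at the old
one. -/
theorem floatPart_bivariant (ω : ConnectionData (n + 1)) {Q : Fin (n + 1) → 𝔄}
    (hQ : IsFloatingClifford Q) (R : Fin (n + 1) → 𝔄) {u v : 𝔄} (hu : IsUnit u) (hv : IsUnit v)
    (e : Fin (n + 1) → Fin 2) :
    floatPart ω (fun j => u * Q j * v) (fun j => u * R j * v) e =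
      u * floatPart ω Q R e * Ring.inverse u := by
  obtain ⟨u, rfl⟩ := hu
  rw [Ring.inverse_unit, ← inner_apply, floatPart, floatPart, map_sum, tilde_bivariant u hv hQ.1]
  refine Finset.sum_congr rfl fun j _ => ?_
  rw [map_smul, map_component _ hQ.2.isUnit, inner_apply _ (R j * _),
    inverse_mul_of_isUnit (u.isUnit.mul (hQ.isUnit j)) hv,
    inverse_mul_of_isUnit u.isUnit (hQ.isUnit j), Ring.inverse_unit]
  congr 2
  have : (u : 𝔄) * R j * v * (Ring.inverse v * (Ring.inverse (Q j) * ↑u⁻¹)) =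
    u * R j * (v * Ring.inverse v) * (Ring.inverse (Q j) * ↑u⁻¹) := by noncomm_ring
  rw [this, Ring.mul_inverse_cancel _ hv]
  noncomm_ring

/-- By `component_twist` each weighted term equals ω_j^e times one expression free of j, and the
weights add up to 1. -/
theorem floatPart_tangent (ω : ConnectionData (n + 1)) {Q : Fin (n + 1) → 𝔄}
    (hQ : IsFloatingClifford Q) (X Y : 𝔄) {e : Fin (n + 1) → Fin 2} (he : e ≠ 0) :
    floatPart ω Q (fun j => X * Q j + Q j * (Ring.inverse (Q 0) * Y * Q 0)) e =
      component (tilde Q) (relIndex e) X +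
        (-(-1 : ℝ) ^ (e 0 : ℕ)) • component (tilde Q) (relIndex e) Y := by
  have h : ∀ j, ω.coeff j e • component (tilde Q) (relIndex e)
      ((X * Q j + Q j * (Ring.inverse (Q 0) * Y * Q 0)) * Ring.inverse (Q j)) =
      ω.coeff j e • (component (tilde Q) (relIndex e) X +
        (-(-1 : ℝ) ^ (e 0 : ℕ)) • component (tilde Q) (relIndex e) Y) := fun j => by
    rw [add_mul, mul_assoc X, Ring.mul_inverse_cancel _ (hQ.isUnit j), mul_one, component_add,
      smul_add, smul_add, component_twist ω hQ e j (Z := Y)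
      (Z' := Q j * (Ring.inverse (Q 0) * Y * Q 0) * Ring.inverse (Q j))]
    · rintro rfl
      have : Q 0 * (Ring.inverse (Q 0) * Y * Q 0) * Ring.inverse (Q 0) =
        Q 0 * Ring.inverse (Q 0) * Y * (Q 0 * Ring.inverse (Q 0)) := by noncomm_ring
      rw [this, Ring.mul_inverse_cancel _ hQ.1, one_mul, mul_one]
    · rintro s rfl
      rw [hQ.inverse_succ, mul_neg]
      congr 1
      have : Q s.succ * (Ring.inverse (Q 0) * Y * Q 0) * (Ring.inverse (Q 0) * tilde Q s) =
        Q s.succ * Ring.inverse (Q 0) * Y * (Q 0 * Ring.inverse (Q 0)) * tilde Q s := by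
        noncomm_ring
      rw [this, Ring.mul_inverse_cancel _ hQ.1, mul_one]
      rfl
  rw [floatPart, Finset.sum_congr rfl fun j _ => h j, ← Finset.sum_smul, ω.sum_coeff e he,
    one_smul]

theorem component_floatPart (ω : ConnectionData (n + 1)) {Q : Fin (n + 1) → 𝔄}
    (hQ : IsFloatingClifford Q) (R : Fin (n + 1) → 𝔄) (e e' : Fin (n + 1) → Fin 2) :
    component (tilde Q) (relIndex e) (floatPart ω Q R e') =
      if relIndex e = relIndex e' then floatPart ω Q R e' else 0 := by
  rw [floatPart, component_sum]
  simp only [component_smul, component_component hQ.2]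
  split_ifs with h
  · rw [h]
  · simp

/-- The connection followed by the passage to parts is the identity on parts, which is what makes
the step a Newton step. The left and right contributions of e itself coincide and compensate the
factor 1/2. -/
theorem floatPart_connection (ω : ConnectionData (n + 1)) {Q : Fin (n + 1) → 𝔄}
    (hQ : IsFloatingClifford Q) (R : Fin (n + 1) → 𝔄) (e : Fin (n + 1) → Fin 2) :
    floatPart ω Q (fun j => floatLeft ω Q R * Q j +
      Q j * (Ring.inverse (Q 0) * floatTwisted ω Q R * Q 0)) e = floatPart ω Q R e := by
  by_cases he : e = 0
  · rw [he, floatPart_zero, floatPart_zero]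
  rw [floatPart_tangent ω hQ _ _ he, floatLeft, floatTwisted]
  simp only [component_smul, component_sum, component_floatPart ω hQ]
  rw [smul_comm, ← smul_add, Finset.smul_sum, ← Finset.sum_add_distrib, Finset.sum_eq_single e]
  · rw [if_pos rfl, smul_smul, ← pow_two, neg_sq, ← pow_mul, mul_comm, pow_mul, neg_one_sq,
      one_pow, one_smul, ← two_smul ℝ, smul_smul]
    norm_num
  · intro e' _ hne
    split_ifs with h
    -- A different multiindex with the same relative index differs in slot zero, so its left and
    -- right contributions have opposite signs.
    · have h0 : e 0 ≠ e' 0 := fun h0 => hne (eq_of_relIndex_eq h0 h).symm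
      rw [smul_smul]
      nth_rw 1 [← one_smul ℝ (floatPart ω Q R e')]
      rw [← add_smul]
      convert zero_smul ℝ _
      rcases fin_two_eq (e 0) with h1 | h1 <;> rcases fin_two_eq (e' 0) with h2 | h2 <;>
        simp_all
    · simp
  · simp

end Floating

/-! ### Contraction and convergence of the iteration. -/

section Contraction

variable {𝔄 : Type u} [Ring 𝔄] [Algebra ℝ 𝔄] [ConvenientAlgebra 𝔄] {n : ℕ}

theorem floatPart_mem (ω : ConnectionData (n + 1)) (Q : Fin (n + 1) → 𝔄) {R : Fin (n + 1) → 𝔄}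
    {i : ℕ} (hR : ∀ j, R j ∈ (filt i : Submodule ℝ 𝔄)) (e : Fin (n + 1) → Fin 2) :
    floatPart ω Q R e ∈ (filt i : Submodule ℝ 𝔄) :=
  Submodule.sum_mem _ fun j _ => Submodule.smul_mem _ _
    (component_mem _ _ (mul_mem_filt_right _ (hR j)))

theorem floatLeft_mem {ω : ConnectionData (n + 1)} {Q R : Fin (n + 1) → 𝔄} {i : ℕ}
    (h : ∀ e, floatPart ω Q R e ∈ (filt i : Submodule ℝ 𝔄)) :
    floatLeft ω Q R ∈ (filt i : Submodule ℝ 𝔄) :=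
  Submodule.smul_mem _ _ (Submodule.sum_mem _ fun e _ => h e)

theorem floatTwisted_mem {ω : ConnectionData (n + 1)} {Q R : Fin (n + 1) → 𝔄} {i : ℕ}
    (h : ∀ e, floatPart ω Q R e ∈ (filt i : Submodule ℝ 𝔄)) :
    floatTwisted ω Q R ∈ (filt i : Submodule ℝ 𝔄) :=
  Submodule.smul_mem _ _ (Submodule.sum_mem _ fun e _ => Submodule.smul_mem _ _ (h e))

theorem tilde_sub_mem {Q Q' : Fin (n + 1) → 𝔄} (hQ : IsUnit (Q 0)) (hQ' : IsUnit (Q' 0)) {i : ℕ}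
    (h : ∀ j, Q j - Q' j ∈ (filt i : Submodule ℝ 𝔄)) (s : Fin n) :
    tilde Q s - tilde Q' s ∈ (filt i : Submodule ℝ 𝔄) :=
  mul_sub_mul_mem (h _) (inverse_sub_inverse_mem hQ hQ' (h 0))

theorem floatPart_sub_mem (ω : ConnectionData (n + 1)) {Q Q' R : Fin (n + 1) → 𝔄}
    (hQ : IsFloatingClifford Q) (hQ' : IsFloatingClifford Q') {i k : ℕ}
    (h : ∀ j, Q j - Q' j ∈ (filt i : Submodule ℝ 𝔄)) (hR : ∀ j, R j ∈ (filt k : Submodule ℝ 𝔄))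
    (e : Fin (n + 1) → Fin 2) :
    floatPart ω Q R e - floatPart ω Q' R e ∈ (filt (i + k) : Submodule ℝ 𝔄) := by
  rw [floatPart, floatPart, ← Finset.sum_sub_distrib]
  refine Submodule.sum_mem _ fun j _ => ?_
  rw [← smul_sub]
  refine Submodule.smul_mem _ _ ?_
  have h1 := component_sub_mem hQ.2.isUnit hQ'.2.isUnit (tilde_sub_mem hQ.1 hQ'.1 h)
    (relIndex e) (mul_mem_filt_right (Ring.inverse (Q j)) (hR j))
  have h2 := component_mem (tilde Q') (relIndex e) (mul_mem_filt_of_le (k := i + k) (hR j)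
    (inverse_sub_inverse_mem (hQ.isUnit j) (hQ'.isUnit j) (h j)) (by omega))
  rw [mul_sub, component_sub] at h2
  simpa using add_mem h1 h2

/-- Here u and v stand for the inverse factors, 1 - X and 1 - Y to leading order. The products of X
or Y with A - Q gain a degree because A - Q has degree 1, and XAY has degree 2i. -/
theorem tangent_sub_mem {A Q X Y u v : 𝔄} {i : ℕ} (hi : 1 ≤ i)
    (hA : A - Q ∈ (filt 1 : Submodule ℝ 𝔄)) (hX : X ∈ (filt i : Submodule ℝ 𝔄))
    (hY : Y ∈ (filt i : Submodule ℝ 𝔄)) (hu : u - 1 + X ∈ (filt (i + 1) : Submodule ℝ 𝔄))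
    (hv : v - 1 + Y ∈ (filt (i + 1) : Submodule ℝ 𝔄)) :
    u * A * v - Q - ((A - Q) - (X * Q + Q * Y)) ∈ (filt (i + 1) : Submodule ℝ 𝔄) := by
  have : u * A * v - Q - ((A - Q) - (X * Q + Q * Y)) =
      (u - 1 + X) * (A * v) + (1 - X) * A * (v - 1 + Y) - X * (A - Q) - (A - Q) * Y +
        X * (A * Y) := by noncomm_ring
  rw [this]
  refine add_mem (sub_mem (sub_mem (add_mem (mul_mem_filt_right _ hu) (mul_mem_filt_left _ hv))
    ?_) ?_) ?_
  · exact mul_mem_filt_of_le hX hA le_rfl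
  · exact mul_mem_filt_of_le hA hY (by omega)
  · exact mul_mem_filt_of_le hX (mul_mem_filt_left _ hY) (by omega)

/-- One step of the iteration increases the filtration degree of the floating connection. -/
theorem floatPart_contract (ω : ConnectionData (n + 1)) {A Q : Fin (n + 1) → 𝔄}
    (hQ : IsFloatingClifford Q) (hA : FormallyClose A Q) {i : ℕ} (hi : 1 ≤ i)
    (h : ∀ e, floatPart ω Q (A - Q) e ∈ (filt i : Submodule ℝ 𝔄)) {u v : 𝔄}
    (hu : u - 1 - floatLeft ω Q (A - Q) ∈ (filt (i + 1) : Submodule ℝ 𝔄))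
    (hv : v - 1 - Ring.inverse (Q 0) * floatTwisted ω Q (A - Q) * Q 0 ∈
      (filt (i + 1) : Submodule ℝ 𝔄)) :
    IsFloatingClifford (fun j => u * Q j * v) ∧
    (∀ j, u * Q j * v - Q j ∈ (filt i : Submodule ℝ 𝔄)) ∧
    ∀ e, floatPart ω (fun j => u * Q j * v) (A - fun j => u * Q j * v) e ∈
      (filt (i + 1) : Submodule ℝ 𝔄) := by
  set X := floatLeft ω Q (A - Q) with hXdef
  set Y := Ring.inverse (Q 0) * floatTwisted ω Q (A - Q) * Q 0 with hYdef
  have hX : X ∈ (filt i : Submodule ℝ 𝔄) := floatLeft_mem h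
  have hY : Y ∈ (filt i : Submodule ℝ 𝔄) :=
    mul_mem_filt_right _ (mul_mem_filt_left _ (floatTwisted_mem h))
  have hu1 : u - 1 ∈ (filt i : Submodule ℝ 𝔄) := by
    simpa using add_mem (mem_filt_of_le (Nat.le_succ i) hu) hX
  have hv1 : v - 1 ∈ (filt i : Submodule ℝ 𝔄) := by
    simpa using add_mem (mem_filt_of_le (Nat.le_succ i) hv) hY
  have hU : IsUnit u := isUnit_of_sub_one_mem (mem_filt_of_le hi hu1)
  have hV : IsUnit v := isUnit_of_sub_one_mem (mem_filt_of_le hi hv1)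
  refine ⟨hQ.bivariant hU hV, fun j => ?_, fun e => ?_⟩
  · have := mul_sub_mul_mem (mul_sub_mul_mem hu1 (b := Q j) (b' := Q j) (by simp)) hv1
    simpa using this
  -- Instead of evaluating the parts at the moved system, A is pulled back to Q by the inverse
  -- factors.
  · have h1 : (A - fun j => u * Q j * v) =
        fun j => u * (Ring.inverse u * A j * Ring.inverse v - Q j) * v := by
      funext j
      have : u * (Ring.inverse u * A j * Ring.inverse v - Q j) * v =
        (u * Ring.inverse u) * A j * (Ring.inverse v * v) - u * Q j * v := by noncomm_ring
      rw [this, Ring.mul_inverse_cancel _ hU, Ring.inverse_mul_cancel _ hV, one_mul, mul_one]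
      rfl
    rw [h1, floatPart_bivariant ω hQ _ hU hV]
    refine mul_mem_filt_right _ (mul_mem_filt_left _ ?_)
    -- The pulled back difference is A - Q minus the tangent vector of the connection, up to degree
    -- i + 1; by `floatPart_connection` the parts of these two cancel.
    have h2 := floatPart_mem ω Q (e := e) (i := i + 1)
      (R := (fun j => Ring.inverse u * A j * Ring.inverse v - Q j) -
        ((A - Q) - fun j => X * Q j + Q j * Y)) fun j =>
        tangent_sub_mem hi (hA j) hX hY (inverse_sub_sub_mem hi hX hu)
          (inverse_sub_sub_mem hi hY hv)
    rwa [floatPart_sub, floatPart_sub, floatPart_connection ω hQ, sub_self, sub_zero] at h2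

/-- The fixed points of the conform-orthogonalization iteration for `A`. -/
structure IsFloatSolution (ω : ConnectionData (n + 1)) (A B : Fin (n + 1) → 𝔄) : Prop where
  floating : IsFloatingClifford B
  close : FormallyClose A B
  part_eq_zero : ∀ e, floatPart ω B (A - B) e = 0

/-- The Clifford relations are a closed condition: they hold modulo every filtration degree. -/
theorem isClifford_of_sub_mem {m : ℕ} {L : Fin m → 𝔄}
    (h : ∀ k, ∃ Q : Fin m → 𝔄, IsClifford Q ∧ ∀ j, L j - Q j ∈ (filt k : Submodule ℝ 𝔄)) :
    IsClifford L := fun i j => by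
  refine eq_of_forall_sub_mem fun k => ?_
  obtain ⟨Q, hQ, hk⟩ := h k
  rw [← hQ i j, add_sub_add_comm]
  exact add_mem (mul_sub_mul_mem (hk i) (hk j)) (mul_sub_mul_mem (hk j) (hk i))

theorem isFloatingClifford_of_sub_mem {L : Fin (n + 1) → 𝔄}
    (h : ∀ k, ∃ Q : Fin (n + 1) → 𝔄, IsFloatingClifford Q ∧
      ∀ j, L j - Q j ∈ (filt k : Submodule ℝ 𝔄)) : IsFloatingClifford L := by
  have h0 : IsUnit (L 0) := by
    obtain ⟨Q, hQ, h1⟩ := h 1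
    exact isUnit_of_sub_mem hQ.1 (h1 0)
  refine ⟨h0, isClifford_of_sub_mem fun k => ?_⟩
  obtain ⟨Q, hQ, h1⟩ := h k
  exact ⟨tilde Q, hQ.2, tilde_sub_mem h0 hQ.1 h1⟩

/-- Sequences which follow the floating connection up to terms of higher order. -/
def FollowsConnection (ω : ConnectionData (n + 1)) (A : Fin (n + 1) → 𝔄)
    (q : ℕ → Fin (n + 1) → 𝔄) : Prop :=
  ∀ k, IsFloatingClifford (q k) → FormallyClose A (q k) → ∃ u v : 𝔄,
    (q (k + 1) = fun j => u * q k j * v) ∧ ∀ i, 1 ≤ i →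
    (∀ e, floatPart ω (q k) (A - q k) e ∈ (filt i : Submodule ℝ 𝔄)) →
    u - 1 - floatLeft ω (q k) (A - q k) ∈ (filt (i + 1) : Submodule ℝ 𝔄) ∧
    v - 1 - Ring.inverse (q k 0) * floatTwisted ω (q k) (A - q k) * q k 0 ∈
      (filt (i + 1) : Submodule ℝ 𝔄)

/-- By contraction the k-th increment has degree k + 1, so completeness gives a limit. Only the
first order behaviour of the factors matters, so the argument serves both the floating step and the
conjugation step of the non-floating iteration. -/
theorem FollowsConnection.exists_solution {ω : ConnectionData (n + 1)} {A : Fin (n + 1) → 𝔄}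
    {q : ℕ → Fin (n + 1) → 𝔄} (hq : FollowsConnection ω A q) (h0 : IsFloatingClifford (q 0))
    (hA : FormallyClose A (q 0)) :
    ∃ L, IsFloatSolution ω A L ∧ ∀ j k, L j - q k j ∈ (filt k : Submodule ℝ 𝔄) := by
  have key : ∀ k, (IsFloatingClifford (q k) ∧ FormallyClose A (q k) ∧
      ∀ e, floatPart ω (q k) (A - q k) e ∈ (filt (k + 1) : Submodule ℝ 𝔄)) ∧
      (∀ j, q (k + 1) j - q k j ∈ (filt (k + 1) : Submodule ℝ 𝔄)) := by
    intro k
    have aux : ∀ k, IsFloatingClifford (q k) → FormallyClose A (q k) →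
        (∀ e, floatPart ω (q k) (A - q k) e ∈ (filt (k + 1) : Submodule ℝ 𝔄)) →
        IsFloatingClifford (q (k + 1)) ∧
        (∀ j, q (k + 1) j - q k j ∈ (filt (k + 1) : Submodule ℝ 𝔄)) ∧
        ∀ e, floatPart ω (q (k + 1)) (A - q (k + 1)) e ∈ (filt (k + 2) : Submodule ℝ 𝔄) := by
      intro k h1 h2 h3
      obtain ⟨u, v, h4, h5⟩ := hq k h1 h2
      obtain ⟨h6, h7⟩ := h5 (k + 1) (by omega) h3
      rw [h4]
      exact floatPart_contract ω h1 h2 (by omega) h3 h6 h7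
    induction k with
    | zero =>
      have h3 : ∀ e, floatPart ω (q 0) (A - q 0) e ∈ (filt (0 + 1) : Submodule ℝ 𝔄) :=
        floatPart_mem ω _ hA
      exact ⟨⟨h0, hA, h3⟩, (aux 0 h0 hA h3).2.1⟩
    | succ k ih =>
      obtain ⟨⟨h1, h2, h3⟩, -⟩ := ih
      obtain ⟨h4, h5, h6⟩ := aux k h1 h2 h3
      have h7 : FormallyClose A (q (k + 1)) := fun j => by
        simpa using sub_mem (h2 j) (mem_filt_of_le (by omega) (h5 j))
      exact ⟨⟨h4, h7, h6⟩, (aux (k + 1) h4 h7 h6).2.1⟩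
  have hL : ∀ j, ∃ a, ∀ k, a - q k j ∈ (filt k : Submodule ℝ 𝔄) := fun j =>
    ConvenientAlgebra.complete (fun k => q k j) fun k =>
      mem_filt_of_le (Nat.le_succ k) ((key k).2 j)
  choose L hL using hL
  have hfl : IsFloatingClifford L :=
    isFloatingClifford_of_sub_mem fun k => ⟨q k, (key k).1.1, fun j => hL j k⟩
  refine ⟨L, ⟨hfl, fun j => ?_, fun e => ?_⟩, hL⟩
  · simpa using sub_mem ((key 1).1.2.1 j) (hL j 1)
  · refine ConvenientAlgebra.hausdorff _ fun k => ?_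
    -- The parts at L are compared with those at q k in two moves, first of the base point and then
    -- of the perturbation; each costs an error of degree k.
    have h1 := floatPart_sub_mem ω hfl (key k).1.1 (fun j => hL j k) (R := A - L) (k := 0)
      (fun j => mem_filt_zero _) e
    have h2 := floatPart_mem ω (q k) (R := (A - L) - (A - q k)) (i := k) (e := e) fun j => by
      have := neg_mem (hL j k)
      simpa using this
    rw [floatPart_sub] at h2
    have h3 := mem_filt_of_le (Nat.le_succ k) ((key k).1.2.2 e)
    simpa using add_mem (add_mem h1 h2) h3

end Contraction

/-! ### Linearized Clifford relations and uniqueness of the fixed point. -/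

section Uniqueness

variable {𝔄 : Type u} [Ring 𝔄] [Algebra ℝ 𝔄] [ConvenientAlgebra 𝔄] {n : ℕ}

theorem mem_filt_of_smul_mem {i : ℕ} {c : ℝ} (hc : c ≠ 0) {a : 𝔄}
    (h : c • a ∈ (filt i : Submodule ℝ 𝔄)) : a ∈ (filt i : Submodule ℝ 𝔄) :=
  ((filt i : Submodule ℝ 𝔄).smul_mem_iff hc).mp h

/-- The factor ba turns the linearized anticommutation relation into a combination of x, y, z and
their conjugates by a and b, on which projections can be evaluated. -/
theorem linearized_clifford_mul {R : Type*} [Ring R] {a b : R} (ha : a * a = -1) (hb : b * b = -1)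
    (hab : a * b = -(b * a)) (x y z : R) :
    (a * (y * b - b * z) + (x * a - a * z) * b + (b * (x * a - a * z) + (y * b - b * z) * a)) *
      (b * a) = -(a * y * a) - y + x - -(b * x * b) - -(a * z * a) + -(b * z * b) := by
  have hb' : ∀ w, b * (b * w) = -w := fun w => by rw [← mul_assoc, hb, neg_one_mul]
  have hab' : ∀ w, a * (b * w) = -(b * (a * w)) := fun w => by
    rw [← mul_assoc, hab, neg_mul, mul_assoc]
  simp only [add_mul, mul_sub, sub_mul, mul_assoc, ha, hb, hab, hb', hab', mul_neg,
    neg_neg, mul_one, neg_mul]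
  abel

/-- A tangent vector to the Clifford systems, up to terms of higher filtration degree. -/
theorem linearized_clifford_mem {P P' : Fin n → 𝔄} (hP : IsClifford P) (hP' : IsClifford P')
    {i : ℕ} (hi : 1 ≤ i) (hE : ∀ s, P' s - P s ∈ (filt i : Submodule ℝ 𝔄)) {Z : Fin n → 𝔄}
    {Z₀ : 𝔄} (hZ : ∀ s, P' s - P s - (Z s * P s - P s * Z₀) ∈ (filt (i + 1) : Submodule ℝ 𝔄))
    (s t : Fin n) :
    P s * (Z t * P t - P t * Z₀) + (Z s * P s - P s * Z₀) * P t +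
      (P t * (Z s * P s - P s * Z₀) + (Z t * P t - P t * Z₀) * P s) ∈
        (filt (i + 1) : Submodule ℝ 𝔄) := by
  have h1 : ∀ s t, (P' s - P s) * (P' t - P t) ∈ (filt (i + 1) : Submodule ℝ 𝔄) := fun s t =>
    mul_mem_filt_of_le (hE s) (hE t) (by omega)
  have h2 : P s * (Z t * P t - P t * Z₀) + (Z s * P s - P s * Z₀) * P t +
      (P t * (Z s * P s - P s * Z₀) + (Z t * P t - P t * Z₀) * P s) =
      (P' s * P' t + P' t * P' s) - (P s * P t + P t * P s) - ((P' s - P s) * (P' t - P t) +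
        (P' t - P t) * (P' s - P s)) - (P s * (P' t - P t - (Z t * P t - P t * Z₀)) +
        (P' s - P s - (Z s * P s - P s * Z₀)) * P t +
        (P t * (P' s - P s - (Z s * P s - P s * Z₀)) +
        (P' t - P t - (Z t * P t - P t * Z₀)) * P s)) := by noncomm_ring
  rw [h2, hP s t, hP' s t, sub_self, zero_sub]
  refine sub_mem (neg_mem (add_mem (h1 s t) (h1 t s))) (add_mem (add_mem ?_ ?_) (add_mem ?_ ?_))
  exacts [mul_mem_filt_left _ (hZ t), mul_mem_filt_right _ (hZ s), mul_mem_filt_left _ (hZ s),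
    mul_mem_filt_right _ (hZ t)]

/-- The linearization of P_s² = -1 says that Z_s - Z₀ plus its conjugate by P_s vanishes; on a
component with f s = 0 this sum is 2(Z_s - Z₀). -/
theorem component_tangent_zero {P P' : Fin n → 𝔄} (hP : IsClifford P) (hP' : IsClifford P')
    {i : ℕ} (hi : 1 ≤ i) (hE : ∀ s, P' s - P s ∈ (filt i : Submodule ℝ 𝔄)) {Z : Fin n → 𝔄}
    {Z₀ : 𝔄} (hZ : ∀ s, P' s - P s - (Z s * P s - P s * Z₀) ∈ (filt (i + 1) : Submodule ℝ 𝔄))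
    {f : Fin n → Fin 2} {s : Fin n} (hf : f s = 0) :
    component P f (Z s) - component P f Z₀ ∈ (filt (i + 1) : Submodule ℝ 𝔄) := by
  have h1 := component_mem P f (linearized_clifford_mem hP hP' hi hE hZ s s)
  have h2 : P s * (Z s * P s - P s * Z₀) + (Z s * P s - P s * Z₀) * P s +
      (P s * (Z s * P s - P s * Z₀) + (Z s * P s - P s * Z₀) * P s) =
      (-2 : ℝ) • (-(P s * (Z s - Z₀) * P s) + (Z s - Z₀)) := by
    have h3 : P s * (Z s * P s - P s * Z₀) + (Z s * P s - P s * Z₀) * P s =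
      P s * (Z s - Z₀) * P s + (Z s * (P s * P s) - (P s * P s) * Z₀) := by noncomm_ring
    rw [h3, hP.sq, ← two_smul ℝ, neg_smul, ← smul_neg]
    congr 1
    noncomm_ring
  rw [h2, component_smul, component_add, component_conj hP, hf, Fin.val_zero, pow_zero, one_smul,
    ← two_smul ℝ, smul_smul] at h1
  have := mem_filt_of_smul_mem (by norm_num) h1
  rwa [component_sub] at this

/-- On a component negated by both conjugations, the linearized anticommutation of P_s and P_t loses
its Z₀ terms and reduces to 2(Z_s - Z_t). -/
theorem component_tangent_one {P P' : Fin n → 𝔄} (hP : IsClifford P) (hP' : IsClifford P')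
    {i : ℕ} (hi : 1 ≤ i) (hE : ∀ s, P' s - P s ∈ (filt i : Submodule ℝ 𝔄)) {Z : Fin n → 𝔄}
    {Z₀ : 𝔄} (hZ : ∀ s, P' s - P s - (Z s * P s - P s * Z₀) ∈ (filt (i + 1) : Submodule ℝ 𝔄))
    {f : Fin n → Fin 2} {s t : Fin n} (hs : f s = 1) (ht : f t = 1) :
    component P f (Z s) - component P f (Z t) ∈ (filt (i + 1) : Submodule ℝ 𝔄) := by
  by_cases hst : s = t
  · rw [hst, sub_self]; exact zero_mem _
  have h1 := component_mem P f
    (mul_mem_filt_right (P t * P s) (linearized_clifford_mem hP hP' hi hE hZ s t))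
  rw [linearized_clifford_mul (hP.sq s) (hP.sq t) (hP.anticomm hst)] at h1
  simp only [component_sub, component_add, component_conj hP, hs, ht, Fin.val_one, pow_one,
    neg_smul, one_smul] at h1
  refine mem_filt_of_smul_mem (c := 2) two_ne_zero ?_
  convert h1 using 1
  rw [two_smul]
  abel

/-- Induction on the degree of B' - B. The tangent relations equate the components of (B'_j -
B_j)B_j⁻¹ that enter one part, so each small part is a small component, and every component is
reached this way. -/
theorem IsFloatSolution.unique {ω : ConnectionData (n + 1)} {A B B' : Fin (n + 1) → 𝔄}
    (hB : IsFloatSolution ω A B) (hB' : IsFloatSolution ω A B') : B = B' := by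
  have key : ∀ i, ∀ j, B' j - B j ∈ (filt (i + 1) : Submodule ℝ 𝔄) := by
    intro i
    induction i with
    | zero => exact fun j => by simpa using sub_mem (hB.close j) (hB'.close j)
    | succ i ih =>
      -- The parts of A - B at B and of A - B' at B' vanish. Moving the latter base point to B costs
      -- i + 1 degrees above the degree 1 of A - B'.
      have hT : ∀ e, floatPart ω B (B' - B) e ∈ (filt (i + 1 + 1) : Submodule ℝ 𝔄) := fun e => by
        have h1 := floatPart_sub_mem ω hB'.floating hB.floating ih hB'.close e
        have h2 : B' - B = (A - B) - (A - B') := by abel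
        rw [h2, floatPart_sub, hB.part_eq_zero e, zero_sub]
        have h3 := hB'.part_eq_zero e
        change floatPart ω B' (fun j => A j - B' j) e = 0 at h3
        rw [h3, zero_sub] at h1
        exact h1
      set Z : Fin (n + 1) → 𝔄 := fun j => (B' j - B j) * Ring.inverse (B j) with hZdef
      have hE := tilde_sub_mem hB'.floating.1 hB.floating.1 ih
      -- This is the derivative of B_sB₀⁻¹; the exact error is a product of two differences.
      have hZ : ∀ s : Fin n, tilde B' s - tilde B s - (Z s.succ * tilde B s - tilde B s * Z 0) ∈
          (filt (i + 1 + 1) : Submodule ℝ 𝔄) := fun s => by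
        have h1 : tilde B' s - tilde B s - (Z s.succ * tilde B s - tilde B s * Z 0) =
            -((tilde B' s - tilde B s) * ((B' 0 - B 0) * Ring.inverse (B 0))) := by
          have h2 : Z s.succ * tilde B s = (B' s.succ - B s.succ) * Ring.inverse (B 0) := by
            rw [hZdef, tilde]
            dsimp only
            rw [← mul_assoc, mul_assoc (_ - _), Ring.inverse_mul_cancel _ (hB.floating.isUnit _),
              mul_one]
          rw [h2, hB.floating.succ_eq, hB'.floating.succ_eq, hZdef]
          have h3 := Ring.mul_inverse_cancel _ hB.floating.1
          simp only [mul_sub, sub_mul, mul_assoc, h3, mul_one]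
          abel
        rw [h1]
        exact neg_mem (mul_mem_filt_of_le (hE s) (mul_mem_filt_right _ (ih 0)) (by omega))
      have hP := hB.floating.2
      have hP' := hB'.floating.2
      -- If all components entering the part agree with z, the part agrees with z, because the
      -- weights add up to 1.
      have hsum : ∀ e : Fin (n + 1) → Fin 2, e ≠ 0 → ∀ z,
          (∀ j, e j = 1 → component (tilde B) (relIndex e) (Z j) - z ∈
            (filt (i + 1 + 1) : Submodule ℝ 𝔄)) → z ∈ (filt (i + 1 + 1) : Submodule ℝ 𝔄) := by
        intro e he z hz
        have h1 : ∑ j, ω.coeff j e • (component (tilde B) (relIndex e) (Z j) - z) ∈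
            (filt (i + 1 + 1) : Submodule ℝ 𝔄) := by
          refine Submodule.sum_mem _ fun j _ => ?_
          rcases fin_two_eq (e j) with h | h
          · rw [ω.coeff_eq_zero j e h, zero_smul]; exact zero_mem _
          · exact Submodule.smul_mem _ _ (hz j h)
        simp only [smul_sub, Finset.sum_sub_distrib, ← Finset.sum_smul] at h1
        rw [ω.sum_coeff e he, one_smul] at h1
        have h2 := sub_mem (hT e) h1
        rw [floatPart] at h2
        simpa [hZdef] using h2
      have hZ0 : ∀ f, component (tilde B) f (Z 0) ∈ (filt (i + 1 + 1) : Submodule ℝ 𝔄) := by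
        intro f
        -- Of the two multiindices with relative index f, this one is active in slot zero and
        -- exactly where f s = 0, which is where `component_tangent_zero` applies.
        have hf : relIndex (Fin.cons 1 fun s => f s + 1 : Fin (n + 1) → Fin 2) = f := by
          funext s
          simp [relIndex]
        refine hsum (Fin.cons 1 fun s => f s + 1) (fun h => ?_) _ fun j hj => ?_
        · simpa using congrFun h 0
        · rw [hf]
          induction j using Fin.cases with
          | zero => rw [sub_self]; exact zero_mem _
          | succ s =>
            refine component_tangent_zero hP hP' (by omega) hE hZ ?_
            simpa using hj
      refine fun j => ?_
      have hj : ∀ f, component (tilde B) f (Z j) ∈ (filt (i + 1 + 1) : Submodule ℝ 𝔄) := by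
        induction j using Fin.cases with
        | zero => exact hZ0
        | succ s =>
          intro f
          rcases fin_two_eq (f s) with hs | hs
          · simpa using add_mem (component_tangent_zero hP hP' (by omega) hE hZ hs) (hZ0 f)
          -- The other multiindex over f is active exactly where f is 1, the case of
          -- `component_tangent_one`.
          · have hf : relIndex (Fin.cons 0 f : Fin (n + 1) → Fin 2) = f := by
              funext s
              simp [relIndex]
            refine hsum (Fin.cons 0 f) (fun h => ?_) _ fun j hj => ?_
            · have := congrFun h s.succ
              simp [hs] at this
            · rw [hf]
              induction j using Fin.cases with
              | zero => simp at hj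
              | succ t =>
                exact component_tangent_one hP hP' (by omega) hE hZ (by simpa using hj) hs
      have := mul_mem_filt_right (B j) (mem_of_component_mem hj)
      rwa [hZdef, mul_assoc, Ring.inverse_mul_cancel _ (hB.floating.isUnit j), mul_one] at this
  funext j
  exact (eq_of_forall_sub_mem fun i => mem_filt_of_le (Nat.le_succ i) (key i j)).symm

theorem followsConnection_floatStep (ω : ConnectionData (n + 1)) (A Q : Fin (n + 1) → 𝔄) :
    FollowsConnection ω A fun k => (floatStep ω A)^[k] Q := fun k hQ hA => by
  refine ⟨_, _, ?_, fun i hi h => ⟨expo_sub_sub_mem hi (floatLeft_mem h), expo_sub_sub_mem hi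
    (mul_mem_filt_right _ (mul_mem_filt_left _ (floatTwisted_mem h)))⟩⟩
  dsimp only at hQ ⊢
  rw [Function.iterate_succ_apply']
  funext j
  rw [floatStep, floatConnectionLeft_eq ω hQ, floatConnectionRight_eq ω hQ]

/-- From every admissible start the iterates converge to a solution, and there is only one.
Henceforth the iteration is replaced by its fixed point equations. -/
theorem conformOrthogonalization_iff (ω : ConnectionData (n + 1)) (A B : Fin (n + 1) → 𝔄) :
    conformOrthogonalization ω 𝔄 A B ↔ IsFloatSolution ω A B := by
  have key : ∀ Q, IsFloatingClifford Q → FormallyClose A Q → ∃ L, IsFloatSolution ω A L ∧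
      ∀ j, ConvergesTo (fun k => ((floatStep ω A)^[k] Q) j) (L j) := fun Q hQ hA => by
    obtain ⟨L, hL, h⟩ := (followsConnection_floatStep ω A Q).exists_solution hQ hA
    exact ⟨L, hL, fun j => convergesTo_of_sub_mem (h j)⟩
  constructor
  · rintro ⟨⟨Q, hQ, hA⟩, h⟩
    obtain ⟨L, hL, h1⟩ := key Q hQ hA
    convert hL
    funext j
    exact (h Q hQ hA j).unique (h1 j)
  · refine fun hB => ⟨⟨B, hB.floating, hB.close⟩, fun Q hQ hA => ?_⟩
    obtain ⟨L, hL, h1⟩ := key Q hQ hA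
    rwa [hB.unique hL]

theorem exists_floatSolution (ω : ConnectionData (n + 1)) {A : Fin (n + 1) → 𝔄}
    (hA : FloatFormalDomain A) : ∃ B, IsFloatSolution ω A B := by
  obtain ⟨Q, hQ, hA⟩ := hA
  obtain ⟨L, hL, -⟩ := (followsConnection_floatStep ω A Q).exists_solution hQ hA
  exact ⟨L, hL⟩

end Uniqueness

/-! ### Embedding the non-floating connection into the floating one. -/

section Extension

variable {n : ℕ}

/-- The connection data which keep the zeroth element and act on the others as `ω`. -/
def ConnectionData.extend (ω : ConnectionData n) : ConnectionData (n + 1) where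
  coeff j e := Fin.cases (motive := fun _ => ℝ) (if e 0 = 1 then 1 else 0)
    (fun j => if e 0 = 1 then 0 else ω.coeff j (Fin.tail e)) j
  coeff_eq_zero j e h := by
    induction j using Fin.cases with
    | zero => simp [h]
    | succ j =>
      have : ω.coeff j (Fin.tail e) = 0 := ω.coeff_eq_zero j _ h
      simp [this]
  sum_coeff e he := by
    rw [Fin.sum_univ_succ]
    rcases fin_two_eq (e 0) with h | h
    · simp only [Fin.cases_zero, Fin.cases_succ, h, zero_ne_one, if_false, zero_add]
      refine ω.sum_coeff _ fun h1 => he ?_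
      funext s
      refine Fin.cases h (fun s => congrFun h1 s) s
    · simp [h]

theorem extend_coeff_zero (ω : ConnectionData n) (e : Fin (n + 1) → Fin 2) :
    ω.extend.coeff 0 e = if e 0 = 1 then 1 else 0 := rfl

theorem extend_coeff_succ (ω : ConnectionData n) (j : Fin n) (e : Fin (n + 1) → Fin 2) :
    ω.extend.coeff j.succ e = if e 0 = 1 then 0 else ω.coeff j (Fin.tail e) := rfl

variable {𝔄 : Type*} [Ring 𝔄] [Algebra ℝ 𝔄]

/-- The contribution of the multiindex `e` to the connection. -/
def orthPart (ω : ConnectionData n) (Q R : Fin n → 𝔄) (e : Fin n → Fin 2) : 𝔄 :=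
  ∑ j, ω.coeff j e • component Q e (R j * Ring.inverse (Q j))

theorem connection_eq (ω : ConnectionData n) (Q R : Fin n → 𝔄) :
    connection ω Q R = (1 / 2 : ℝ) • ∑ e, orthPart ω Q R e := by
  rw [connection, Finset.sum_comm]
  rfl

theorem relIndex_of_zero {e : Fin (n + 1) → Fin 2} (h : e 0 = 0) : relIndex e = Fin.tail e := by
  funext s
  simp [relIndex, h, Fin.tail]

theorem floatPart_extend_of_zero (ω : ConnectionData n) {Q : Fin (n + 1) → 𝔄}
    (hQ : IsFloatingClifford Q) (R : Fin (n + 1) → 𝔄) {e : Fin (n + 1) → Fin 2} (he : e 0 = 0) :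
    floatPart ω.extend Q R e =
      orthPart ω (tilde Q) (fun s => R s.succ * Ring.inverse (Q 0)) (Fin.tail e) := by
  rw [floatPart, Fin.sum_univ_succ, extend_coeff_zero, if_neg (by simp [he]), zero_smul, zero_add,
    orthPart]
  refine Finset.sum_congr rfl fun s _ => ?_
  rw [extend_coeff_succ, if_neg (by simp [he]), relIndex_of_zero he, hQ.inverse_succ,
    hQ.2.inverse, ← mul_neg, mul_assoc]

theorem floatPart_extend_of_one (ω : ConnectionData n) (Q R : Fin (n + 1) → 𝔄)
    {e : Fin (n + 1) → Fin 2} (he : e 0 = 1) :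
    floatPart ω.extend Q R e =
      component (tilde Q) (relIndex e) (R 0 * Ring.inverse (Q 0)) := by
  rw [floatPart, Fin.sum_univ_succ, extend_coeff_zero, if_pos he, one_smul, Finset.sum_eq_zero,
    add_zero]
  intro s _
  rw [extend_coeff_succ, if_pos he, zero_smul]

theorem tilde_cons_one (Q : Fin n → 𝔄) : tilde (Fin.cons 1 Q : Fin (n + 1) → 𝔄) = Q := by
  funext s
  simp [tilde]

theorem IsClifford.cons_one {Q : Fin n → 𝔄} (hQ : IsClifford Q) :
    IsFloatingClifford (Fin.cons 1 Q : Fin (n + 1) → 𝔄) :=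
  ⟨by simp, by rwa [tilde_cons_one]⟩

theorem sum_cons {M : Type*} [AddCommMonoid M] (F : (Fin (n + 1) → Fin 2) → M) :
    ∑ e, F e = ∑ e : Fin n → Fin 2, F (Fin.cons 0 e) + ∑ e : Fin n → Fin 2, F (Fin.cons 1 e) := by
  rw [← (Fin.consEquiv fun _ : Fin (n + 1) => Fin 2).sum_comp, Fintype.sum_prod_type,
    Fin.sum_univ_two]
  rfl

theorem floatPart_extend_cons (ω : ConnectionData n) {Q : Fin n → 𝔄} (hQ : IsClifford Q)
    (R : Fin n → 𝔄) (e : Fin (n + 1) → Fin 2) :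
    floatPart ω.extend (Fin.cons 1 Q) (Fin.cons 0 R) e =
      if e 0 = 0 then orthPart ω Q R (Fin.tail e) else 0 := by
  split_ifs with h
  · rw [floatPart_extend_of_zero ω hQ.cons_one _ h, tilde_cons_one]
    simp
  · rw [floatPart_extend_of_one ω _ _ ((fin_two_eq (e 0)).resolve_left h), Fin.cons_zero, zero_mul,
      component_map_zero]

theorem floatLeft_extend (ω : ConnectionData n) {Q : Fin n → 𝔄} (hQ : IsClifford Q)
    (R : Fin n → 𝔄) :
    floatLeft ω.extend (Fin.cons 1 Q) (Fin.cons 0 R) = connection ω Q R := by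
  rw [floatLeft, connection_eq, sum_cons]
  simp [floatPart_extend_cons ω hQ]

/-- Only multiindices with e 0 = 0 contribute, and they carry the sign -1. So left and right
connection are opposite, as required for a conjugation. -/
theorem floatTwisted_extend (ω : ConnectionData n) {Q : Fin n → 𝔄} (hQ : IsClifford Q)
    (R : Fin n → 𝔄) :
    floatTwisted ω.extend (Fin.cons 1 Q) (Fin.cons 0 R) = -connection ω Q R := by
  rw [floatTwisted, connection_eq, sum_cons]
  simp [floatPart_extend_cons ω hQ]

end Extension

/-! ### Fixed points of the non-floating iteration. -/

section Orthogonalization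

variable {𝔄 : Type u} [Ring 𝔄] [Algebra ℝ 𝔄] [ConvenientAlgebra 𝔄] {n : ℕ}

/-- The fixed points of the orthogonalization iteration for `A`. -/
structure IsSolution (ω : ConnectionData n) (A B : Fin n → 𝔄) : Prop where
  clifford : IsClifford B
  close : FormallyClose A B
  part_eq_zero : ∀ e, orthPart ω B (A - B) e = 0

/-- The parts with e 0 = 1 are all the components of (A₀ - B₀)B₀⁻¹, hence B₀ = A₀; those with e 0 =
0 are the non-floating parts for the relative tuples. -/
theorem isFloatSolution_extend_iff (ω : ConnectionData n) (A B : Fin (n + 1) → 𝔄) :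
    IsFloatSolution ω.extend A B ↔
      IsUnit (A 0) ∧ B 0 = A 0 ∧ IsSolution ω (tilde A) (tilde B) := by
  constructor
  · intro h
    have h0 : B 0 = A 0 := by
      have h1 : (A 0 - B 0) * Ring.inverse (B 0) = 0 := by
        refine eq_zero_of_component (P := tilde B) fun f => ?_
        have hf : relIndex (Fin.cons 1 fun s => f s + 1 : Fin (n + 1) → Fin 2) = f := by
          funext s
          simp [relIndex]
        have := h.part_eq_zero (Fin.cons 1 fun s => f s + 1)
        rwa [floatPart_extend_of_one _ _ _ (by simp), hf] at this
      have h2 := congrArg (· * B 0) h1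
      simp only [mul_assoc, Ring.inverse_mul_cancel _ h.floating.1, mul_one, zero_mul] at h2
      exact (sub_eq_zero.mp h2).symm
    have hR : (fun s : Fin n => (A - B) s.succ * Ring.inverse (B 0)) = tilde A - tilde B := by
      funext s
      simp [tilde, h0, sub_mul]
    refine ⟨h0 ▸ h.floating.1, h0, h.floating.2, fun s => ?_, fun e => ?_⟩
    · rw [tilde, tilde, h0, ← sub_mul]
      exact mul_mem_filt_right _ (h.close _)
    · have := h.part_eq_zero (Fin.cons 0 e)
      rwa [floatPart_extend_of_zero _ h.floating _ (by simp), hR, Fin.tail_cons] at this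
  · rintro ⟨hu, h0, h⟩
    have hB : IsFloatingClifford B := ⟨h0 ▸ hu, h.clifford⟩
    have hR : (fun s : Fin n => (A - B) s.succ * Ring.inverse (B 0)) = tilde A - tilde B := by
      funext s
      simp [tilde, h0, sub_mul]
    refine ⟨hB, fun j => ?_, fun e => ?_⟩
    · induction j using Fin.cases with
      | zero => rw [h0, sub_self]; exact zero_mem _
      | succ s =>
        have := mul_mem_filt_right (A 0) (h.close s)
        rwa [tilde, tilde, h0, ← sub_mul, mul_assoc, Ring.inverse_mul_cancel _ hu, mul_one] at this
    · rcases fin_two_eq (e 0) with he | he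
      · rw [floatPart_extend_of_zero _ hB _ he, hR]
        exact h.part_eq_zero _
      · rw [floatPart_extend_of_one _ _ _ he, Pi.sub_apply, h0, sub_self, zero_mul,
          component_map_zero]

theorem isSolution_iff_cons (ω : ConnectionData n) (A B : Fin n → 𝔄) :
    IsSolution ω A B ↔
      IsFloatSolution ω.extend (Fin.cons 1 A : Fin (n + 1) → 𝔄) (Fin.cons 1 B) := by
  rw [isFloatSolution_extend_iff, tilde_cons_one, tilde_cons_one]
  simp

theorem IsSolution.unique {ω : ConnectionData n} {A B B' : Fin n → 𝔄}
    (hB : IsSolution ω A B) (hB' : IsSolution ω A B') : B = B' := by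
  rw [isSolution_iff_cons] at hB hB'
  exact (Fin.cons_injective2 (hB.unique hB')).2

/-- The step multiplies by u = exp X and u⁻¹, which fixes the 1 in slot zero and has first order
terms X and -X, as the extended connection prescribes. -/
theorem followsConnection_step (ω : ConnectionData n) (A Q : Fin n → 𝔄) :
    FollowsConnection ω.extend (Fin.cons 1 A : Fin (n + 1) → 𝔄)
      fun k => Fin.cons 1 ((step ω A)^[k] Q) := fun k hQ hA => by
  dsimp only at hQ hA ⊢
  set q := (step ω A)^[k] Q with hq
  have hQ' : IsClifford q := by simpa [tilde_cons_one] using hQ.2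
  have hsub : (Fin.cons 1 A - Fin.cons 1 q : Fin (n + 1) → 𝔄) = Fin.cons 0 (A - q) := by
    funext j
    induction j using Fin.cases <;> simp
  have hL := floatLeft_extend ω hQ' (A - q)
  have hT := floatTwisted_extend ω hQ' (A - q)
  have hX : ∀ i, (∀ e, floatPart ω.extend (Fin.cons 1 q : Fin (n + 1) → 𝔄)
      (Fin.cons 1 A - Fin.cons 1 q) e ∈ (filt i : Submodule ℝ 𝔄)) →
      connection ω q (A - q) ∈ (filt i : Submodule ℝ 𝔄) := fun i h => by
    rw [← hL, ← hsub]
    exact floatLeft_mem h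
  have hX1 := expo_sub_sub_mem le_rfl (hX 1 (floatPart_mem _ _ hA))
  have hu : IsUnit (expo (connection ω q (A - q))) := isUnit_of_sub_one_mem (by
    have := add_mem (mem_filt_of_le (Nat.le_succ 1) hX1) (hX 1 (floatPart_mem _ _ hA))
    simpa using this)
  refine ⟨expo (connection ω q (A - q)), Ring.inverse (expo (connection ω q (A - q))), ?_,
    fun i hi h => ?_⟩
  · rw [Function.iterate_succ_apply', ← hq]
    funext j
    induction j using Fin.cases with
    | zero => simp [Ring.mul_inverse_cancel _ hu]
    | succ j => simp [step]
  · have h1 := expo_sub_sub_mem hi (hX i h)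
    rw [hsub, hL, hT]
    refine ⟨h1, ?_⟩
    have := inverse_sub_sub_mem hi (hX i h) h1
    simpa using this

theorem exists_solution_of_close (ω : ConnectionData n) {A Q : Fin n → 𝔄} (hQ : IsClifford Q)
    (hA : FormallyClose A Q) : ∃ L, IsSolution ω A L ∧
      ∀ j, ConvergesTo (fun k => ((step ω A)^[k] Q) j) (L j) := by
  obtain ⟨L, hL, h⟩ := (followsConnection_step ω A Q).exists_solution hQ.cons_one fun j => by
    induction j using Fin.cases with
    | zero => simp
    | succ j => simpa using hA j
  have h0 : L = Fin.cons 1 (Fin.tail L) := by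
    rw [← Fin.cons_self_tail L, ((isFloatSolution_extend_iff _ _ _).mp hL).2.1]
    simp
  refine ⟨Fin.tail L, (isSolution_iff_cons _ _ _).mpr (h0 ▸ hL), fun j =>
    convergesTo_of_sub_mem fun k => ?_⟩
  simpa [Fin.tail] using h j.succ k

theorem orthogonalization_iff (ω : ConnectionData n) (A B : Fin n → 𝔄) :
    orthogonalization ω 𝔄 A B ↔ IsSolution ω A B := by
  constructor
  · rintro ⟨⟨Q, hQ, hA⟩, h⟩
    obtain ⟨L, hL, h1⟩ := exists_solution_of_close ω hQ hA
    convert hL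
    funext j
    exact (h Q hQ hA j).unique (h1 j)
  · refine fun hB => ⟨⟨B, hB.clifford, hB.close⟩, fun Q hQ hA => ?_⟩
    obtain ⟨L, hL, h1⟩ := exists_solution_of_close ω hQ hA
    rwa [hB.unique hL]

theorem exists_solution (ω : ConnectionData n) {A : Fin n → 𝔄} (hA : FormalDomain A) :
    ∃ B, IsSolution ω A B := by
  obtain ⟨Q, hQ, hA⟩ := hA
  obtain ⟨L, hL, -⟩ := exists_solution_of_close ω hQ hA
  exact ⟨L, hL⟩

end Orthogonalization

/-! ### Behaviour of components and parts under scalars and products. -/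

section Scaling

variable {𝔄 : Type*} [Ring 𝔄] [Algebra ℝ 𝔄] {n : ℕ}

theorem inverse_smul {c : ℝ} (hc : c ≠ 0) {a : 𝔄} (ha : IsUnit a) :
    Ring.inverse (c • a) = c⁻¹ • Ring.inverse a := by
  refine inverse_eq_of_mul ?_ ?_
  · rw [smul_mul_smul_comm, mul_inv_cancel₀ hc, one_smul, Ring.mul_inverse_cancel _ ha]
  · rw [smul_mul_smul_comm, inv_mul_cancel₀ hc, one_smul, Ring.inverse_mul_cancel _ ha]

theorem component_smul_tuple {c : Fin n → ℝ} (hc : ∀ i, c i ≠ 0) {P : Fin n → 𝔄}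
    (hP : ∀ i, IsUnit (P i)) (e : Fin n → Fin 2) (Z : 𝔄) :
    component (fun i => c i • P i) e Z = component P e Z := by
  induction n generalizing Z with
  | zero => rfl
  | succ n ih =>
    rw [component_succ, component_succ]
    have h : symmetrization (c 0 • P 0) (e 0) Z = symmetrization (P 0) (e 0) Z := by
      rw [symmetrization, inverse_smul (hc 0) (hP 0), smul_mul_assoc, smul_mul_smul_comm,
        inv_mul_cancel₀ (hc 0), one_smul, symmetrization]
    rw [h]
    exact ih (fun i => hc i.succ) (fun i => hP i.succ) _ _

theorem component_central {z : 𝔄} (hz : ∀ a, Commute z a) (P : Fin n → 𝔄) (e : Fin n → Fin 2)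
    (R : 𝔄) : component P e (z * R) = z * component P e R := by
  induction n generalizing R with
  | zero => rfl
  | succ n ih =>
    rw [component_succ, component_succ]
    have h : symmetrization (P 0) (e 0) (z * R) = z * symmetrization (P 0) (e 0) R := by
      have h1 : Ring.inverse (P 0) * (z * R) * P 0 = z * (Ring.inverse (P 0) * R * P 0) := by
        rw [← mul_assoc, ← (hz _).eq]
        simp only [mul_assoc]
      rw [symmetrization, symmetrization, h1, mul_smul_comm, mul_add, mul_smul_comm]
    rw [h, ih]

theorem orthPart_sub (ω : ConnectionData n) (Q R S : Fin n → 𝔄) (e : Fin n → Fin 2) :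
    orthPart ω Q (R - S) e = orthPart ω Q R e - orthPart ω Q S e := by
  simp only [orthPart, Pi.sub_apply, sub_mul, component_sub, smul_sub, Finset.sum_sub_distrib]

/-- Each Q_jQ_j⁻¹ = 1 is fixed by all conjugations, so it only has the component of index 0, where
the weights vanish. Hence the condition on A - B is a linear condition on A alone. -/
theorem orthPart_self (ω : ConnectionData n) {Q : Fin n → 𝔄} (hQ : IsClifford Q)
    (e : Fin n → Fin 2) : orthPart ω Q Q e = 0 := by
  refine Finset.sum_eq_zero fun j _ => ?_
  rw [Ring.mul_inverse_cancel _ (hQ.isUnit j)]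
  by_cases he : e = 0
  · rw [ω.coeff_eq_zero j e (by rw [he]; rfl), zero_smul]
  · rw [component_one hQ he, smul_zero]

theorem map_orthPart {𝔅 : Type*} [Ring 𝔅] [Algebra ℝ 𝔅] (φ : 𝔄 →ₐ[ℝ] 𝔅)
    (ω : ConnectionData n) {Q : Fin n → 𝔄} (hQ : IsClifford Q)
    (R : Fin n → 𝔄) (e : Fin n → Fin 2) :
    φ (orthPart ω Q R e) = orthPart ω (fun j => φ (Q j)) (fun j => φ (R j)) e := by
  rw [orthPart, map_sum]
  refine Finset.sum_congr rfl fun j _ => ?_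
  rw [map_smul, map_component φ hQ.isUnit, map_mul, map_inverse φ (hQ.isUnit j)]

theorem inverse_prod {𝔅 : Type*} [Ring 𝔅] {a : 𝔄} {b : 𝔅} (ha : IsUnit a) (hb : IsUnit b) :
    Ring.inverse (a, b) = (Ring.inverse a, Ring.inverse b) := by
  obtain ⟨a, rfl⟩ := ha
  obtain ⟨b, rfl⟩ := hb
  rw [Ring.inverse_unit, Ring.inverse_unit]
  exact Ring.inverse_unit (MulEquiv.prodUnits.symm (a, b))

theorem IsClifford.prod {𝔅 : Type*} [Ring 𝔅] [Algebra ℝ 𝔅] {Q : Fin n → 𝔄} {Q' : Fin n → 𝔅}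
    (hQ : IsClifford Q) (hQ' : IsClifford Q') : IsClifford fun j => (Q j, Q' j) := fun i j => by
  have h1 := hQ i j
  have h2 := hQ' i j
  split_ifs at * with h <;> exact Prod.ext h1 h2

theorem IsFloatingClifford.prod {𝔅 : Type*} [Ring 𝔅] [Algebra ℝ 𝔅] {Q : Fin (n + 1) → 𝔄}
    {Q' : Fin (n + 1) → 𝔅} (hQ : IsFloatingClifford Q) (hQ' : IsFloatingClifford Q') :
    IsFloatingClifford fun j => (Q j, Q' j) := by
  refine ⟨Prod.isUnit_iff.mpr ⟨hQ.1, hQ'.1⟩, ?_⟩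
  convert hQ.2.prod hQ'.2 using 2 with s
  rw [tilde, inverse_prod hQ.1 hQ'.1]
  rfl

theorem tilde_smul {c : Fin (n + 1) → ℝ} (hc : ∀ i, c i ≠ 0) {Q : Fin (n + 1) → 𝔄}
    (hQ : IsUnit (Q 0)) :
    tilde (fun j => c j • Q j) = fun s => (c s.succ * (c 0)⁻¹) • tilde Q s := by
  funext s
  rw [tilde, inverse_smul (hc 0) hQ, smul_mul_smul_comm, tilde]

theorem floatPart_smul_tuple (ω : ConnectionData (n + 1)) {Q : Fin (n + 1) → 𝔄}
    (hQ : IsFloatingClifford Q) (R : Fin (n + 1) → 𝔄) {c : Fin (n + 1) → ℝ} (hc : ∀ i, c i ≠ 0)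
    (e : Fin (n + 1) → Fin 2) :
    floatPart ω (fun j => c j • Q j) (fun j => c j • R j) e = floatPart ω Q R e := by
  rw [floatPart, tilde_smul hc hQ.1]
  refine Finset.sum_congr rfl fun j _ => ?_
  rw [component_smul_tuple (fun s => mul_ne_zero (hc _) (inv_ne_zero (hc 0))) hQ.2.isUnit,
    inverse_smul (hc j) (hQ.isUnit j), smul_mul_smul_comm, mul_inv_cancel₀ (hc j), one_smul]

theorem IsClifford.smul {Q : Fin n → 𝔄} (hQ : IsClifford Q) {c : Fin n → ℝ}
    (hc : ∀ i, c i * c i = 1) : IsClifford fun j => c j • Q j := by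
  rw [isClifford_iff]
  refine ⟨fun i => ?_, fun i j h => ?_⟩
  · rw [smul_mul_smul_comm, hc, one_smul, hQ.sq]
  · rw [smul_mul_smul_comm, smul_mul_smul_comm, hQ.anticomm h, smul_neg, mul_comm]

theorem IsFloatingClifford.smul {Q : Fin (n + 1) → 𝔄} (hQ : IsFloatingClifford Q)
    {c : Fin (n + 1) → ℝ} (hc : ∀ i, c i * c i = 1) : IsFloatingClifford fun j => c j • Q j := by
  have h0 : ∀ i, c i ≠ 0 := fun i h => by simpa [h] using hc i
  refine ⟨?_, ?_⟩
  · have := hQ.1.smul (Units.mk0 _ (h0 0))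
    exact this
  · rw [tilde_smul h0 hQ.1]
    refine hQ.2.smul fun s => ?_
    rw [mul_mul_mul_comm, hc, ← mul_inv, hc, inv_one, one_mul]

end Scaling

/-! ### Symmetries of the fixed point equations. -/

section Solutions

variable {𝔄 : Type*} [Ring 𝔄] [Algebra ℝ 𝔄] [ConvenientAlgebra 𝔄]
  {𝔅 : Type*} [Ring 𝔅] [Algebra ℝ 𝔅] [ConvenientAlgebra 𝔅] {n : ℕ}

theorem FormallyClose.map {A B : Fin n → 𝔄} (h : FormallyClose A B) (φ : 𝔄 →ₐ[ℝ] 𝔅)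
    (hφ : ∀ i, ∀ a ∈ (filt i : Submodule ℝ 𝔄), φ a ∈ (filt i : Submodule ℝ 𝔅)) :
    FormallyClose (fun j => φ (A j)) fun j => φ (B j) := fun j => by
  rw [← map_sub]
  exact hφ 1 _ (h j)

theorem IsSolution.map {ω : ConnectionData n} {A B : Fin n → 𝔄} (h : IsSolution ω A B)
    (φ : 𝔄 →ₐ[ℝ] 𝔅)
    (hφ : ∀ i, ∀ a ∈ (filt i : Submodule ℝ 𝔄), φ a ∈ (filt i : Submodule ℝ 𝔅)) :
    IsSolution ω (fun j => φ (A j)) fun j => φ (B j) := by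
  refine ⟨h.clifford.map φ, h.close.map φ hφ, fun e => ?_⟩
  have := map_orthPart φ ω h.clifford (A - B) e
  rw [h.part_eq_zero, map_zero] at this
  rw [this]
  congr
  funext j
  simp

theorem IsFloatSolution.map {ω : ConnectionData (n + 1)} {A B : Fin (n + 1) → 𝔄}
    (h : IsFloatSolution ω A B) (φ : 𝔄 →ₐ[ℝ] 𝔅)
    (hφ : ∀ i, ∀ a ∈ (filt i : Submodule ℝ 𝔄), φ a ∈ (filt i : Submodule ℝ 𝔅)) :
    IsFloatSolution ω (fun j => φ (A j)) fun j => φ (B j) := by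
  refine ⟨h.floating.map φ, h.close.map φ hφ, fun e => ?_⟩
  have := map_floatPart φ ω h.floating (A - B) e
  rw [h.part_eq_zero, map_zero] at this
  rw [this]
  congr
  funext j
  simp

theorem IsFloatSolution.bivariant {ω : ConnectionData (n + 1)} {A B : Fin (n + 1) → 𝔄}
    (h : IsFloatSolution ω A B) {u v : 𝔄} (hu : IsUnit u) (hv : IsUnit v) :
    IsFloatSolution ω (fun j => u * A j * v) fun j => u * B j * v := by
  have hR : ((fun j => u * A j * v) - fun j => u * B j * v) = fun j => u * (A - B) j * v := by
    funext j
    simp [mul_sub, sub_mul]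
  refine ⟨h.floating.bivariant hu hv, fun j => ?_, fun e => ?_⟩
  · rw [← sub_mul, ← mul_sub]
    exact mul_mem_filt_right _ (mul_mem_filt_left _ (h.close j))
  · rw [hR, floatPart_bivariant ω h.floating _ hu hv, h.part_eq_zero, mul_zero, zero_mul]

theorem IsFloatSolution.smul {ω : ConnectionData (n + 1)} {A B : Fin (n + 1) → 𝔄}
    (h : IsFloatSolution ω A B) {c : Fin (n + 1) → ℝ} (hc : ∀ i, c i * c i = 1) :
    IsFloatSolution ω (fun j => c j • A j) fun j => c j • B j := by
  have h0 : ∀ i, c i ≠ 0 := fun i h => by simpa [h] using hc i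
  have hR : ((fun j => c j • A j) - fun j => c j • B j) = fun j => c j • (A - B) j := by
    funext j
    simp [smul_sub]
  refine ⟨h.floating.smul hc, fun j => ?_, fun e => ?_⟩
  · rw [← smul_sub]
    exact Submodule.smul_mem _ _ (h.close j)
  · rw [hR, floatPart_smul_tuple ω h.floating _ h0, h.part_eq_zero]

theorem IsSolution.smul {ω : ConnectionData n} {A B : Fin n → 𝔄}
    (h : IsSolution ω A B) {c : Fin n → ℝ} (hc : ∀ i, c i * c i = 1) :
    IsSolution ω (fun j => c j • A j) fun j => c j • B j := by
  rw [isSolution_iff_cons] at h ⊢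
  convert h.smul (c := Fin.cons 1 c)
    (fun i => by induction i using Fin.cases <;> simp [hc]) using 1 <;>
  · funext j
    induction j using Fin.cases <;> simp

theorem IsFloatSolution.fiberStar {ω : ConnectionData (n + 1)} {A B : Fin (n + 1) → 𝔄}
    (h : IsFloatSolution ω A B) (t : ℝ) :
    IsFloatSolution ω (fun j => t • A j + (1 - t) • B j) B := by
  have hR : (fun j => t • A j + (1 - t) • B j) - B = t • (A - B) := by
    funext j
    simp only [Pi.sub_apply, Pi.smul_apply, sub_smul, one_smul, smul_sub]
    abel
  refine ⟨h.floating, fun j => ?_, fun e => ?_⟩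
  · have := congrFun hR j
    rw [Pi.sub_apply] at this
    rw [this]
    exact Submodule.smul_mem _ _ (h.close j)
  · rw [hR, floatPart_smul, h.part_eq_zero, smul_zero]

theorem IsSolution.fiberStar {ω : ConnectionData n} {A B : Fin n → 𝔄}
    (h : IsSolution ω A B) (t : ℝ) : IsSolution ω (fun j => t • A j + (1 - t) • B j) B := by
  rw [isSolution_iff_cons] at h ⊢
  convert h.fiberStar t using 1
  funext j
  induction j using Fin.cases with
  | zero => simp [sub_smul]
  | succ j => simp

theorem IsFloatingClifford.isFloatSolution_self {Q : Fin (n + 1) → 𝔄} (hQ : IsFloatingClifford Q)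
    (ω : ConnectionData (n + 1)) : IsFloatSolution ω Q Q := by
  refine ⟨hQ, fun j => by simp, fun e => ?_⟩
  rw [floatPart_sub, sub_self]

theorem IsClifford.isSolution_self {Q : Fin n → 𝔄} (hQ : IsClifford Q) (ω : ConnectionData n) :
    IsSolution ω Q Q :=
  ⟨hQ, fun j => by simp, fun e => by rw [orthPart_sub, sub_self]⟩

/-- Vanishing of the parts is tested by the two projections; of the filtration on the product only
degree one matters. -/
theorem IsFloatSolution.prod {ω : ConnectionData (n + 1)} {A B : Fin (n + 1) → 𝔄}
    {A' B' : Fin (n + 1) → 𝔅} (h : IsFloatSolution ω A B) (h' : IsFloatSolution ω A' B')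
    [ConvenientAlgebra (𝔄 × 𝔅)]
    (hfilt : ∀ a ∈ (filt 1 : Submodule ℝ 𝔄), ∀ b ∈ (filt 1 : Submodule ℝ 𝔅),
      (a, b) ∈ (filt 1 : Submodule ℝ (𝔄 × 𝔅))) :
    IsFloatSolution ω (fun j => (A j, A' j)) fun j => (B j, B' j) := by
  have hfl := h.floating.prod h'.floating
  refine ⟨hfl, fun j => hfilt _ (h.close j) _ (h'.close j), fun e => ?_⟩
  refine Prod.ext ?_ ?_
  · have := map_floatPart (AlgHom.fst ℝ 𝔄 𝔅) ω hfl
      ((fun j => (A j, A' j)) - fun j => (B j, B' j)) e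
    exact this.trans (h.part_eq_zero e)
  · have := map_floatPart (AlgHom.snd ℝ 𝔄 𝔅) ω hfl
      ((fun j => (A j, A' j)) - fun j => (B j, B' j)) e
    exact this.trans (h'.part_eq_zero e)

theorem IsSolution.prod {ω : ConnectionData n} {A B : Fin n → 𝔄}
    {A' B' : Fin n → 𝔅} (h : IsSolution ω A B) (h' : IsSolution ω A' B')
    [ConvenientAlgebra (𝔄 × 𝔅)]
    (hfilt : ∀ a ∈ (filt 1 : Submodule ℝ 𝔄), ∀ b ∈ (filt 1 : Submodule ℝ 𝔅),
      (a, b) ∈ (filt 1 : Submodule ℝ (𝔄 × 𝔅))) :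
    IsSolution ω (fun j => (A j, A' j)) fun j => (B j, B' j) := by
  rw [isSolution_iff_cons] at h h' ⊢
  convert h.prod h' hfilt using 1 <;>
  · funext j
    induction j using Fin.cases <;> simp [Prod.one_eq_mk]

end Solutions

/-! ### Formal scalar homogeneity. -/

section Homogeneity

variable {𝔄 : Type u} [Ring 𝔄] [Algebra ℝ 𝔄] [ConvenientAlgebra 𝔄] {n : ℕ}

/-- The constant power series, as a homomorphism of algebras. -/
def constHom (𝔄 : Type*) [Ring 𝔄] [Algebra ℝ 𝔄] : 𝔄 →ₐ[ℝ] PowerSeries 𝔄 :=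
  { PowerSeries.C (R := 𝔄) with commutes' := fun _ => (PowerSeries.algebraMap_apply).symm }

theorem constHom_apply (a : 𝔄) : constHom 𝔄 a = PowerSeries.C a := rfl

theorem C_mem_filt {i : ℕ} {a : 𝔄} (ha : a ∈ (filt i : Submodule ℝ 𝔄)) :
    PowerSeries.C a ∈ (filt i : Submodule ℝ (PowerSeries 𝔄)) := fun d => by
  change MvPowerSeries.coeff d (MvPowerSeries.C a) ∈ _
  classical
  rw [MvPowerSeries.coeff_C]
  split_ifs with h
  · exact mem_filt_of_le (Nat.sub_le _ _) ha
  · exact zero_mem _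

theorem X_mem_filt : (PowerSeries.X : PowerSeries 𝔄) ∈
    (filt 1 : Submodule ℝ (PowerSeries 𝔄)) := fun d => by
  change MvPowerSeries.coeff d (MvPowerSeries.X ()) ∈ _
  classical
  rw [MvPowerSeries.coeff_X]
  split_ifs with h
  · rw [h]; simpa using mem_filt_zero _
  · exact zero_mem _

/-- By `orthPart_self` the equations are homogeneous linear in A, and the central factor 1 + t can
be pulled out of every component. -/
theorem IsSolution.homogeneous {ω : ConnectionData n} {A B : Fin n → 𝔄} (h : IsSolution ω A B) :
    IsSolution (𝔄 := PowerSeries 𝔄) ω (fun j => (1 + PowerSeries.X) * PowerSeries.C (A j))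
      fun j => PowerSeries.C (B j) := by
  have h1 := h.map (constHom 𝔄) fun i a ha => C_mem_filt ha
  simp only [constHom_apply] at h1
  have hz : ∀ a : PowerSeries 𝔄, Commute (1 + PowerSeries.X) a := fun a =>
    (Commute.one_left a).add_left (PowerSeries.commute_X a).symm
  refine ⟨h1.clifford, fun j => ?_, fun e => ?_⟩
  · have h2 := add_mem (h1.close j) (mul_mem_filt_right (PowerSeries.C (A j)) X_mem_filt)
    convert h2 using 1
    noncomm_ring
  · have h2 := h1.part_eq_zero e
    rw [orthPart_sub, orthPart_self ω h1.clifford, sub_zero] at h2 ⊢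
    have h3 : orthPart ω (fun j => PowerSeries.C (B j))
        (fun j => (1 + PowerSeries.X) * PowerSeries.C (A j)) e =
        (1 + PowerSeries.X) * orthPart ω (fun j => PowerSeries.C (B j))
          (fun j => PowerSeries.C (A j)) e := by
      rw [orthPart, orthPart, Finset.mul_sum]
      refine Finset.sum_congr rfl fun j _ => ?_
      rw [mul_assoc, component_central hz, mul_smul_comm]
    rw [h3, h2, mul_zero]

end Homogeneity

/-! ### Words in a Clifford system and further letters. -/

section Words

variable {𝔄 : Type*} [Ring 𝔄] [Algebra ℝ 𝔄] {n m : ℕ}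

theorem multipower_succ (Q : Fin (n + 1) → 𝔄) (e : Fin (n + 1) → Fin 2) :
    multipower Q e = Q 0 ^ (e 0 : ℕ) * multipower (Fin.tail Q) (Fin.tail e) := by
  rw [multipower, List.ofFn_succ, List.prod_cons]
  rfl

theorem multipower_zero (Q : Fin n → 𝔄) : multipower Q 0 = 1 := by
  induction n with
  | zero => rfl
  | succ n ih =>
    rw [multipower_succ]
    have : Fin.tail (0 : Fin (n + 1) → Fin 2) = 0 := rfl
    rw [this, ih]
    simp

theorem exists_multipower_comm {Q : Fin n → 𝔄} {S : 𝔄} (h : ∀ i, Q i * S = -(S * Q i))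
    (e : Fin n → Fin 2) : ∃ c : ℝ, multipower Q e * S = c • (S * multipower Q e) := by
  induction n with
  | zero => exact ⟨1, by simp [multipower]⟩
  | succ n ih =>
    obtain ⟨c, hc⟩ := ih (Q := Fin.tail Q) (fun i => h i.succ) (Fin.tail e)
    rw [multipower_succ, mul_assoc, hc]
    rcases fin_two_eq (e 0) with he | he
    · exact ⟨c, by simp [he]⟩
    · refine ⟨-c, ?_⟩
      rw [he, Fin.val_one, pow_one, mul_smul_comm, ← mul_assoc, h, neg_mul, smul_neg, neg_smul,
        mul_assoc]

/-- Sorting the factors only produces signs, and squares are -1. The value of the sign is never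
needed. -/
theorem exists_multipower_mul {Q : Fin n → 𝔄} (hQ : IsClifford Q) (e e' : Fin n → Fin 2) :
    ∃ (c : ℝ) (f : Fin n → Fin 2), multipower Q e * multipower Q e' = c • multipower Q f := by
  induction n with
  | zero => exact ⟨1, e, by simp [multipower]⟩
  | succ n ih =>
    obtain ⟨c, f, hc⟩ := ih hQ.tail (Fin.tail e) (Fin.tail e')
    have h1 : ∃ d : ℝ, multipower (Fin.tail Q) (Fin.tail e) * Q 0 ^ (e' 0 : ℕ) =
        d • (Q 0 ^ (e' 0 : ℕ) * multipower (Fin.tail Q) (Fin.tail e)) := by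
      rcases fin_two_eq (e' 0) with he | he
      · exact ⟨1, by simp [he]⟩
      · rw [he, Fin.val_one, pow_one]
        exact exists_multipower_comm (fun i => hQ.anticomm (Fin.succ_ne_zero i)) _
    have h2 : ∃ (b : ℝ) (a : Fin 2), Q 0 ^ (e 0 : ℕ) * Q 0 ^ (e' 0 : ℕ) = b • Q 0 ^ (a : ℕ) := by
      rcases fin_two_eq (e 0) with he | he
      · exact ⟨1, e' 0, by simp [he]⟩
      · rcases fin_two_eq (e' 0) with he' | he'
        · exact ⟨1, 1, by simp [he, he']⟩
        · exact ⟨-1, 0, by simp [he, he', hQ.sq]⟩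
    obtain ⟨d, hd⟩ := h1
    obtain ⟨b, a, hb⟩ := h2
    refine ⟨d * (b * c), Fin.cons a f, ?_⟩
    rw [multipower_succ, multipower_succ, multipower_succ, Fin.cons_zero, Fin.tail_cons, mul_assoc,
      ← mul_assoc (multipower _ _), hd, smul_mul_assoc, mul_smul_comm, mul_assoc, hc, ← mul_assoc,
      hb, smul_mul_smul_comm, smul_smul]

theorem word_zero (Q : Fin n → 𝔄) (R : Fin m → 𝔄) (e : Fin (0 + 1) → Fin n → Fin 2)
    (j : Fin 0 → Fin m) : word Q R e j = multipower Q (e 0) := by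
  simp [word]

theorem word_succ {r : ℕ} (Q : Fin n → 𝔄) (R : Fin m → 𝔄) (e : Fin (r + 1 + 1) → Fin n → Fin 2)
    (j : Fin (r + 1) → Fin m) :
    word Q R e j = multipower Q (e 0) * R (j 0) * word Q R (Fin.tail e) (Fin.tail j) := by
  rw [word, List.ofFn_succ, List.prod_cons, word]
  simp only [mul_assoc]
  rfl

/-- The span of the words with `r` letters `R`. -/
def wordSpan (Q : Fin n → 𝔄) (R : Fin m → 𝔄) (r : ℕ) : Submodule ℝ 𝔄 :=
  Submodule.span ℝ (Set.range fun p : (Fin (r + 1) → Fin n → Fin 2) × (Fin r → Fin m) =>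
    word Q R p.1 p.2)

theorem word_mem_wordSpan {r : ℕ} (Q : Fin n → 𝔄) (R : Fin m → 𝔄)
    (e : Fin (r + 1) → Fin n → Fin 2) (j : Fin r → Fin m) : word Q R e j ∈ wordSpan Q R r :=
  Submodule.subset_span ⟨(e, j), rfl⟩

theorem multipower_mul_word_mem {r : ℕ} {Q : Fin n → 𝔄} (hQ : IsClifford Q) (R : Fin m → 𝔄)
    (f : Fin n → Fin 2) (e : Fin (r + 1) → Fin n → Fin 2) (j : Fin r → Fin m) :
    multipower Q f * word Q R e j ∈ wordSpan Q R r := by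
  obtain ⟨c, f', hc⟩ := exists_multipower_mul hQ f (e 0)
  have h : multipower Q f * word Q R e j = c • word Q R (Fin.cons f' (Fin.tail e)) j := by
    rw [word, ← mul_assoc, hc, smul_mul_assoc, word]
    rfl
  rw [h]
  exact Submodule.smul_mem _ _ (word_mem_wordSpan _ _ _ _)

theorem letter_mul_mem {r : ℕ} (Q : Fin n → 𝔄) (R : Fin m → 𝔄) (f : Fin n → Fin 2) (i : Fin m)
    {w : 𝔄} (hw : w ∈ wordSpan Q R r) : multipower Q f * R i * w ∈ wordSpan Q R (r + 1) := by
  induction hw using Submodule.span_induction with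
  | mem x hx =>
    obtain ⟨p, rfl⟩ := hx
    have := word_mem_wordSpan Q R (Fin.cons f p.1 : Fin (r + 1 + 1) → Fin n → Fin 2)
      (Fin.cons i p.2)
    rwa [word_succ, Fin.cons_zero, Fin.cons_zero, Fin.tail_cons, Fin.tail_cons] at this
  | zero => rw [mul_zero]; exact zero_mem _
  | add x y _ _ hx hy => rw [mul_add]; exact add_mem hx hy
  | smul c x _ hx => rw [mul_smul_comm]; exact Submodule.smul_mem _ _ hx

theorem word_mul_word_mem {r s : ℕ} {Q : Fin n → 𝔄} (hQ : IsClifford Q) (R : Fin m → 𝔄)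
    (e : Fin (r + 1) → Fin n → Fin 2) (j : Fin r → Fin m) (e' : Fin (s + 1) → Fin n → Fin 2)
    (j' : Fin s → Fin m) : word Q R e j * word Q R e' j' ∈ wordSpan Q R (r + s) := by
  induction r with
  | zero =>
    rw [word_zero, zero_add]
    exact multipower_mul_word_mem hQ R _ _ _
  | succ r ih =>
    rw [word_succ, mul_assoc, Nat.succ_add]
    exact letter_mul_mem Q R _ _ (ih _ _)

/-- The word spans are multiplicative in the number of letters, which is what the Rees construction
requires. -/
theorem mul_mem_wordSpan {Q : Fin n → 𝔄} (hQ : IsClifford Q) (R : Fin m → 𝔄) (r s : ℕ) (a b : 𝔄)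
    (ha : a ∈ wordSpan Q R r) (hb : b ∈ wordSpan Q R s) : a * b ∈ wordSpan Q R (r + s) := by
  have h := Submodule.mul_mem_mul ha hb
  rw [wordSpan, wordSpan, Submodule.span_mul_span] at h
  refine Submodule.span_le.mpr ?_ h
  rintro _ ⟨_, ⟨p, rfl⟩, _, ⟨p', rfl⟩, rfl⟩
  exact word_mul_word_mem hQ R _ _ _ _

theorem multipower_mem_wordSpan (Q : Fin n → 𝔄) (R : Fin m → 𝔄) (f : Fin n → Fin 2) :
    multipower Q f ∈ wordSpan Q R 0 := by
  have := word_mem_wordSpan Q R (r := 0) (fun _ => f) Fin.elim0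
  rwa [word_zero] at this

theorem one_mem_wordSpan (Q : Fin n → 𝔄) (R : Fin m → 𝔄) : 1 ∈ wordSpan Q R 0 := by
  rw [← multipower_zero Q]
  exact multipower_mem_wordSpan Q R 0

theorem multipower_single (Q : Fin n → 𝔄) (i : Fin n) : multipower Q (Pi.single i 1) = Q i := by
  induction n with
  | zero => exact i.elim0
  | succ n ih =>
    rw [multipower_succ]
    induction i using Fin.cases with
    | zero =>
      have : Fin.tail (Pi.single 0 1 : Fin (n + 1) → Fin 2) = 0 := by
        funext s; simp [Fin.tail]
      rw [this, multipower_zero]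
      simp
    | succ i =>
      have : Fin.tail (Pi.single i.succ 1 : Fin (n + 1) → Fin 2) = Pi.single i 1 := by
        funext s; simp [Fin.tail, Pi.single_apply]
      rw [this, ih]
      simp [Fin.tail]

theorem clifford_mem_wordSpan (Q : Fin n → 𝔄) (R : Fin m → 𝔄) (i : Fin n) :
    Q i ∈ wordSpan Q R 0 := by
  have := multipower_mem_wordSpan Q R (Pi.single i 1)
  rwa [multipower_single] at this

theorem letter_mem_wordSpan (Q : Fin n → 𝔄) (R : Fin m → 𝔄) (i : Fin m) :
    R i ∈ wordSpan Q R 1 := by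
  have := letter_mul_mem Q R 0 i (one_mem_wordSpan Q R)
  rwa [multipower_zero, one_mul, mul_one] at this

instance finite_wordSpan (Q : Fin n → 𝔄) (R : Fin m → 𝔄) (r : ℕ) :
    Module.Finite ℝ (wordSpan Q R r) :=
  Module.Finite.span_of_finite ℝ (Set.finite_range _)

theorem map_multipower {𝔅 : Type*} [Ring 𝔅] [Algebra ℝ 𝔅] (φ : 𝔄 →ₐ[ℝ] 𝔅) (Q : Fin n → 𝔄)
    (e : Fin n → Fin 2) : φ (multipower Q e) = multipower (fun i => φ (Q i)) e := by
  rw [multipower, map_list_prod, List.map_ofFn, multipower]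
  congr 2
  funext i
  simp

theorem map_word {𝔅 : Type*} [Ring 𝔅] [Algebra ℝ 𝔅] (φ : 𝔄 →ₐ[ℝ] 𝔅) {r : ℕ} (Q : Fin n → 𝔄)
    (R : Fin m → 𝔄) (e : Fin (r + 1) → Fin n → Fin 2) (j : Fin r → Fin m) :
    φ (word Q R e j) = word (fun i => φ (Q i)) (fun i => φ (R i)) e j := by
  rw [word, map_mul, map_multipower, map_list_prod, List.map_ofFn, word]
  congr 3
  funext i
  simp [map_multipower]

theorem exists_expansion {Q : Fin n → 𝔄} {R : Fin m → 𝔄} {B : Fin m → ℕ → 𝔄}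
    (h : ∀ k r, B k r ∈ wordSpan Q R r) :
    ∃ ψ : SeriesData n m, ∀ k r, B k r = expansionTerm ψ Q R k r := by
  have h1 : ∀ k r, ∃ c : (Fin (r + 1) → Fin n → Fin 2) × (Fin r → Fin m) → ℝ,
      ∑ p, c p • word Q R p.1 p.2 = B k r := fun k r =>
    (Submodule.mem_span_range_iff_exists_fun ℝ).mp (h k r)
  choose c hc using h1
  refine ⟨fun k r e j => c k r (e, j), fun k r => ?_⟩
  rw [← hc, Fintype.sum_prod_type]
  rfl

theorem map_expansionTerm {𝔅 : Type*} [Ring 𝔅] [Algebra ℝ 𝔅] (φ : 𝔄 →ₐ[ℝ] 𝔅) (ψ : SeriesData n m)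
    (Q : Fin n → 𝔄) (R : Fin m → 𝔄) (k : Fin m) (r : ℕ) :
    φ (expansionTerm ψ Q R k r) =
      expansionTerm ψ (fun i => φ (Q i)) (fun i => φ (R i)) k r := by
  simp only [expansionTerm, map_sum, map_smul, map_word]

end Words

/-! ### The algebra generated by a Clifford system and free letters. -/

section Generic

/-- The Clifford relations for the first `n` of `n + m` free generators. -/
inductive CliffordRel (n m : ℕ) :
    FreeAlgebra ℝ (Fin n ⊕ Fin m) → FreeAlgebra ℝ (Fin n ⊕ Fin m) → Prop
  | mk (i j : Fin n) : CliffordRel n m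
      (FreeAlgebra.ι ℝ (Sum.inl i) * FreeAlgebra.ι ℝ (Sum.inl j) +
        FreeAlgebra.ι ℝ (Sum.inl j) * FreeAlgebra.ι ℝ (Sum.inl i)) (if i = j then -2 else 0)

/-- The algebra freely generated by a Clifford system of `n` elements and `m` further elements. -/
abbrev GenericAlgebra (n m : ℕ) : Type := RingQuot (CliffordRel n m)

variable {n m : ℕ}

/-- The generic Clifford system. -/
def genericClifford (n m : ℕ) (i : Fin n) : GenericAlgebra n m :=
  RingQuot.mkAlgHom ℝ (CliffordRel n m) (FreeAlgebra.ι ℝ (Sum.inl i))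

/-- The free generators. -/
def genericLetter (n m : ℕ) (j : Fin m) : GenericAlgebra n m :=
  RingQuot.mkAlgHom ℝ (CliffordRel n m) (FreeAlgebra.ι ℝ (Sum.inr j))

theorem isClifford_genericClifford : IsClifford (genericClifford n m) := fun i j => by
  have := RingQuot.mkAlgHom_rel ℝ (CliffordRel.mk (m := m) i j)
  rw [map_add, map_mul, map_mul] at this
  refine this.trans ?_
  split_ifs
  · rw [map_neg, map_ofNat]
  · exact map_zero _

variable {𝔄 : Type*} [Ring 𝔄] [Algebra ℝ 𝔄]

/-- The homomorphism from the generic algebra given by a Clifford system and further elements. -/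
def genericLift {Q : Fin n → 𝔄} (hQ : IsClifford Q) (R : Fin m → 𝔄) :
    GenericAlgebra n m →ₐ[ℝ] 𝔄 :=
  RingQuot.liftAlgHom ℝ ⟨FreeAlgebra.lift ℝ (Sum.elim Q R), by
    rintro _ _ ⟨i, j⟩
    simp only [map_add, map_mul, FreeAlgebra.lift_ι_apply, Sum.elim_inl]
    rw [hQ i j]
    split_ifs
    · rw [map_neg, map_ofNat]
    · exact (map_zero _).symm⟩

theorem genericLift_clifford {Q : Fin n → 𝔄} (hQ : IsClifford Q) (R : Fin m → 𝔄) (i : Fin n) :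
    genericLift hQ R (genericClifford n m i) = Q i := by
  simp [genericLift, genericClifford]

theorem genericLift_letter {Q : Fin n → 𝔄} (hQ : IsClifford Q) (R : Fin m → 𝔄) (j : Fin m) :
    genericLift hQ R (genericLetter n m j) = R j := by
  simp [genericLift, genericLetter]

end Generic

/-! ### Rees-type algebras of power series with graded coefficients. -/

section Rees

variable {F : Type u} [Ring F] [Algebra ℝ F]

/-- The power series whose `r`-th coefficients lie in the `r`-th term of a multiplicative sequence
of subspaces. -/
def rees (G : ℕ → Submodule ℝ F) (h1 : 1 ∈ G 0)
    (hmul : ∀ r s a b, a ∈ G r → b ∈ G s → a * b ∈ G (r + s)) : Subalgebra ℝ (PowerSeries F) where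
  carrier := {f | ∀ r, PowerSeries.coeff r f ∈ G r}
  mul_mem' {a b} ha hb r := by
    rw [PowerSeries.coeff_mul]
    refine Submodule.sum_mem _ fun p hp => ?_
    rw [← Finset.HasAntidiagonal.mem_antidiagonal.mp hp]
    exact hmul _ _ _ _ (ha _) (hb _)
  add_mem' {a b} ha hb r := by
    rw [map_add]
    exact add_mem (ha r) (hb r)
  algebraMap_mem' c r := by
    rw [PowerSeries.algebraMap_apply, PowerSeries.coeff_C]
    split_ifs with h
    · rw [h, Algebra.algebraMap_eq_smul_one]
      exact Submodule.smul_mem _ _ h1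
    · exact zero_mem _

variable (G : ℕ → Submodule ℝ F) (h1 : 1 ∈ G 0)
    (hmul : ∀ r s a b, a ∈ G r → b ∈ G s → a * b ∈ G (r + s))

theorem coeff_smul_real (c : ℝ) (f : PowerSeries F) (r : ℕ) :
    PowerSeries.coeff r (c • f) = c • PowerSeries.coeff r f := rfl

/-- Coefficients as linear maps on the Rees algebra. -/
def reesCoeff (r : ℕ) : rees G h1 hmul →ₗ[ℝ] G r where
  toFun f := ⟨PowerSeries.coeff r f.1, f.2 r⟩
  map_add' _ _ := Subtype.ext (map_add _ _ _)
  map_smul' c f := Subtype.ext (coeff_smul_real c f.1 r)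

/-- Restricting the r-th coefficient to a finite dimensional subspace makes the filtration quotients
finite dimensional, even if the coefficient algebra is not. -/
instance instRees [∀ r, Module.Finite ℝ (G r)] : ConvenientAlgebra (rees G h1 hmul) where
  filt i :=
    { carrier := {f | ∀ r < i, PowerSeries.coeff r f.1 = 0}
      add_mem' := fun {a b} ha hb r hr => by
        rw [Subalgebra.coe_add, map_add, ha r hr, hb r hr, add_zero]
      zero_mem' := fun r _ => map_zero _
      smul_mem' := fun c f hf r hr => by
        rw [Subalgebra.coe_smul, coeff_smul_real, hf r hr, smul_zero] }
  filt_zero := by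
    ext f
    simp
  filt_antitone i j hij f hf r hr := hf r (lt_of_lt_of_le hr hij)
  mul_mem_filt {i j a b} ha hb r hr := by
    rw [Subalgebra.coe_mul, PowerSeries.coeff_mul]
    refine Finset.sum_eq_zero fun p hp => ?_
    have := Finset.HasAntidiagonal.mem_antidiagonal.mp hp
    by_cases h : p.1 < i
    · rw [ha _ h, zero_mul]
    · rw [hb _ (by omega), mul_zero]
  hausdorff f hf := Subtype.ext (PowerSeries.ext fun r => by
    rw [hf (r + 1) r (Nat.lt_succ_self r)]; rfl)
  complete x hx := by
    -- The hypothesis at i controls coefficients below i, so the r-th coefficient is stable from x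
    -- (r + 1) on.
    refine ⟨⟨PowerSeries.mk fun r => PowerSeries.coeff r (x (r + 1)).1, fun r => ?_⟩,
      fun i r hr => ?_⟩
    · rw [PowerSeries.coeff_mk]
      exact (x (r + 1)).2 r
    · rw [Subalgebra.coe_sub, map_sub, PowerSeries.coeff_mk, sub_eq_zero]
      induction i with
      | zero => omega
      | succ i ih =>
        rcases Nat.lt_succ_iff_lt_or_eq.mp hr with h | rfl
        · rw [ih h, eq_comm, ← sub_eq_zero, ← map_sub, ← Subalgebra.coe_sub]
          exact hx i r h
        · rfl
  finite_quotient i := by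
    refine finite_quotient_of_ker_le
      (LinearMap.pi fun r : Fin i => reesCoeff G h1 hmul r) _ fun f hf r hr => ?_
    have := congrFun (LinearMap.mem_ker.mp hf) ⟨r, hr⟩
    exact congrArg Subtype.val this

variable {G h1 hmul} {𝔄 : Type*} [Ring 𝔄] [Algebra ℝ 𝔄] [ConvenientAlgebra 𝔄]

theorem hasDegreeSum_single {f : ℕ → 𝔄} (k : ℕ) (hf : ∀ r, r ≠ k → f r = 0)
    (hk : f k ∈ (filt k : Submodule ℝ 𝔄)) : HasDegreeSum f (f k) := fun N => by
  by_cases h : k < N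
  · rw [Finset.sum_eq_single k (fun r _ hr => hf r hr) (fun h1 => absurd (Finset.mem_range.mpr h) h1),
      sub_self]
    exact zero_mem _
  · rw [Finset.sum_eq_zero fun r hr => hf r (by rw [Finset.mem_range] at hr; omega), sub_zero]
    exact mem_filt_of_le (not_lt.mp h) hk

variable {φ : F →ₐ[ℝ] 𝔄}

theorem exists_reesValue (hφ : ∀ r, ∀ a ∈ G r, φ a ∈ (filt r : Submodule ℝ 𝔄))
    (f : rees G h1 hmul) :
    ∃ a, HasDegreeSum (fun r => φ (PowerSeries.coeff r f.1)) a :=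
  exists_hasDegreeSum fun r => hφ r _ (f.2 r)

/-- The homomorphism on the Rees algebra induced by a homomorphism respecting degrees. -/
def reesHom (hφ : ∀ r, ∀ a ∈ G r, φ a ∈ (filt r : Submodule ℝ 𝔄)) :
    rees G h1 hmul →ₐ[ℝ] 𝔄 where
  toFun f := (exists_reesValue hφ f).choose
  map_zero' := by
    refine (exists_reesValue hφ _).choose_spec.unique fun N => ?_
    simp
  map_one' := by
    refine (exists_reesValue hφ _).choose_spec.unique ?_
    have h := hasDegreeSum_single (f := fun r => φ (PowerSeries.coeff r (1 : PowerSeries F))) 0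
      (fun r hr => by simp [PowerSeries.coeff_one, hr]) (mem_filt_zero _)
    have h2 : φ (PowerSeries.coeff 0 (1 : PowerSeries F)) = 1 := by simp
    rwa [h2] at h
  map_add' f g := by
    refine (exists_reesValue hφ _).choose_spec.unique ?_
    convert (exists_reesValue hφ f).choose_spec.add (exists_reesValue hφ g).choose_spec using 2 with r
    rw [Subalgebra.coe_add, map_add, map_add]
  map_mul' f g := by
    refine (exists_reesValue hφ _).choose_spec.unique ?_
    convert HasDegreeSum.mul (fun r => hφ r _ (f.2 r)) (fun r => hφ r _ (g.2 r))
      (exists_reesValue hφ f).choose_spec (exists_reesValue hφ g).choose_spec using 2 with r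
    rw [Subalgebra.coe_mul, PowerSeries.coeff_mul, map_sum]
    simp only [map_mul]
  commutes' c := by
    refine (exists_reesValue hφ _).choose_spec.unique ?_
    have h := hasDegreeSum_single (f := fun r => φ (PowerSeries.coeff r
      (algebraMap ℝ (PowerSeries F) c))) 0
      (fun r hr => by simp [PowerSeries.algebraMap_apply, PowerSeries.coeff_C, hr])
      (mem_filt_zero _)
    have h2 : φ (PowerSeries.coeff 0 (algebraMap ℝ (PowerSeries F) c)) = algebraMap ℝ 𝔄 c := by
      simp [PowerSeries.algebraMap_apply]
    rwa [h2] at h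

theorem hasDegreeSum_reesHom (hφ : ∀ r, ∀ a ∈ G r, φ a ∈ (filt r : Submodule ℝ 𝔄))
    (f : rees G h1 hmul) :
    HasDegreeSum (fun r => φ (PowerSeries.coeff r f.1)) (reesHom hφ f) :=
  (exists_reesValue hφ f).choose_spec

theorem reesHom_mem (hφ : ∀ r, ∀ a ∈ G r, φ a ∈ (filt r : Submodule ℝ 𝔄))
    [∀ r, Module.Finite ℝ (G r)] (i : ℕ) (f : rees G h1 hmul)
    (hf : f ∈ filt (𝔄 := rees G h1 hmul) i) :
    reesHom hφ f ∈ (filt i : Submodule ℝ 𝔄) := by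
  have h := hasDegreeSum_reesHom hφ f i
  rw [Finset.sum_eq_zero fun r hr => ?_, sub_zero] at h
  · exact h
  · have : PowerSeries.coeff r f.1 = 0 := hf r (Finset.mem_range.mp hr)
    rw [this, map_zero]

end Rees

/-! ### The universal convenient algebra. -/

section Analytic

/-- The universal convenient algebra with a Clifford system and elements of degree one. -/
abbrev UniversalAlgebra (n m : ℕ) : Type :=
  rees (wordSpan (genericClifford n m) (genericLetter n m)) (one_mem_wordSpan _ _)
    (mul_mem_wordSpan isClifford_genericClifford _)

/-- The filtration of the universal algebra. -/
abbrev universalFilt (n m i : ℕ) : Submodule ℝ (UniversalAlgebra n m) :=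
  (instRees (wordSpan (genericClifford n m) (genericLetter n m)) (one_mem_wordSpan _ _)
    (mul_mem_wordSpan isClifford_genericClifford _)).filt i

variable {n m : ℕ}

/-- The Clifford system of the universal algebra. -/
def universalClifford (n m : ℕ) (i : Fin n) : UniversalAlgebra n m :=
  ⟨PowerSeries.C (genericClifford n m i), fun r => by
    rw [PowerSeries.coeff_C]
    split_ifs with h
    · rw [h]; exact clifford_mem_wordSpan _ _ i
    · exact zero_mem _⟩

/-- The elements of degree one of the universal algebra. -/
def universalLetter (n m : ℕ) (j : Fin m) : UniversalAlgebra n m :=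
  ⟨PowerSeries.monomial 1 (genericLetter n m j), fun r => by
    rw [PowerSeries.coeff_monomial]
    split_ifs with h
    · rw [h]; exact letter_mem_wordSpan _ _ j
    · exact zero_mem _⟩

theorem isClifford_universalClifford : IsClifford (universalClifford n m) := fun i j => by
  have := isClifford_genericClifford.map (constHom (GenericAlgebra n m)) i j
  refine Subtype.ext (this.trans ?_)
  split_ifs <;> rfl

theorem universalLetter_mem (j : Fin m) :
    universalLetter n m j ∈ universalFilt n m 1 := fun r hr => by
  rw [universalLetter]
  simp only [PowerSeries.coeff_monomial]
  rw [if_neg (by omega)]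

variable {𝔄 : Type*} [Ring 𝔄] [Algebra ℝ 𝔄] [ConvenientAlgebra 𝔄]

theorem wordSpan_mem_filt (Q : Fin n → 𝔄) {R : Fin m → 𝔄}
    (hR : ∀ j, R j ∈ (filt 1 : Submodule ℝ 𝔄)) (r : ℕ) : wordSpan Q R r ≤ filt r := by
  refine Submodule.span_le.mpr ?_
  rintro _ ⟨⟨e, j⟩, rfl⟩
  induction r with
  | zero => exact mem_filt_zero _
  | succ r ih =>
    simp only [word_succ]
    exact mul_mem_filt_of_le (mul_mem_filt_left _ (hR _)) (ih _ _) (by omega)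

theorem genericLift_mem {Q : Fin n → 𝔄} (hQ : IsClifford Q) {R : Fin m → 𝔄}
    (hR : ∀ j, R j ∈ (filt 1 : Submodule ℝ 𝔄)) (r : ℕ) :
    ∀ a ∈ wordSpan (genericClifford n m) (genericLetter n m) r,
      genericLift hQ R a ∈ (filt r : Submodule ℝ 𝔄) := by
  intro a ha
  have h : (wordSpan (genericClifford n m) (genericLetter n m) r).map
      (genericLift hQ R).toLinearMap ≤ filt r := by
    refine le_trans ?_ (wordSpan_mem_filt Q hR r)
    rw [wordSpan, Submodule.map_span, wordSpan]
    refine Submodule.span_mono ?_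
    rintro _ ⟨_, ⟨p, rfl⟩, rfl⟩
    refine ⟨p, ?_⟩
    simp only [AlgHom.toLinearMap_apply, map_word, genericLift_clifford, genericLift_letter]
  exact h ⟨a, ha, rfl⟩

/-- The universal property. -/
theorem exists_universalHom {Q : Fin n → 𝔄} (hQ : IsClifford Q) {R : Fin m → 𝔄}
    (hR : ∀ j, R j ∈ (filt 1 : Submodule ℝ 𝔄)) :
    ∃ Φ : UniversalAlgebra n m →ₐ[ℝ] 𝔄,
      (∀ i, ∀ a ∈ universalFilt n m i,
        Φ a ∈ (filt i : Submodule ℝ 𝔄)) ∧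
      (∀ i, Φ (universalClifford n m i) = Q i) ∧ (∀ j, Φ (universalLetter n m j) = R j) ∧
      ∀ f, HasDegreeSum (fun r => genericLift hQ R (PowerSeries.coeff r f.1)) (Φ f) := by
  have hφ := genericLift_mem hQ hR
  refine ⟨reesHom hφ, reesHom_mem hφ, fun i => ?_, fun j => ?_, hasDegreeSum_reesHom hφ⟩
  · refine (hasDegreeSum_reesHom hφ _).unique ?_
    convert hasDegreeSum_single 0 (fun r hr => ?_) (mem_filt_zero _)
    · simp [universalClifford, genericLift_clifford]
    · simp [universalClifford, PowerSeries.coeff_C, hr]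
  · refine (hasDegreeSum_reesHom hφ _).unique ?_
    convert hasDegreeSum_single 1 (fun r hr => ?_) ?_
    · simp [universalLetter, genericLift_letter]
    · simp [universalLetter, PowerSeries.coeff_monomial, hr]
    · simpa [universalLetter, genericLift_letter] using hR j

theorem exists_universal_expansion (B : Fin m → UniversalAlgebra n m) :
    ∃ ψ : SeriesData n m, ∀ k r, PowerSeries.coeff r (B k).1 =
      expansionTerm ψ (genericClifford n m) (genericLetter n m) k r :=
  exists_expansion fun k r => (B k).2 r

theorem genericLift_expansionTerm {Q : Fin n → 𝔄} (hQ : IsClifford Q) (R : Fin m → 𝔄)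
    (ψ : SeriesData n m) (k : Fin m) (r : ℕ) :
    genericLift hQ R (expansionTerm ψ (genericClifford n m) (genericLetter n m) k r) =
      expansionTerm ψ Q R k r := by
  rw [map_expansionTerm]
  simp only [genericLift_clifford, genericLift_letter]

end Analytic

/-! ### Universal power series expansions. -/

section AnalyticSolutions

/-- The coefficients come from the solution in the universal algebra, whose degree r coefficient is
a combination of words with r letters. Solutions are preserved by filtered homomorphisms, even
between universes, so this expansion maps to every other one. -/
theorem formallyAnalytic_orthogonalization {n : ℕ} (ω : ConnectionData n) :
    FormallyAnalytic (orthogonalization.{u} ω) := by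
  obtain ⟨B, hB⟩ := exists_solution ω
    (A := fun i => universalClifford n n i + universalLetter n n i)
    ⟨universalClifford n n, isClifford_universalClifford, fun j => by
      have h := universalLetter_mem (n := n) j
      rwa [← add_sub_cancel_left (universalClifford n n j) (universalLetter n n j)] at h⟩
  obtain ⟨ψ, hψ⟩ := exists_universal_expansion B
  refine ⟨ψ, fun 𝔄 _ _ _ Q R hQ hR => ?_⟩
  obtain ⟨Φ, hΦ, h1, h2, h3⟩ := exists_universalHom hQ hR
  refine ⟨fun k => Φ (B k), ?_, fun k => ?_⟩
  · rw [orthogonalization_iff]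
    have := hB.map Φ hΦ
    simpa only [map_add, h1, h2] using this
  · have := (h3 (B k)).convergesTo
    simpa only [hψ, genericLift_expansionTerm] using this

theorem floatFormallyAnalytic_conformOrthogonalization {n : ℕ} (ω : ConnectionData (n + 1)) :
    FloatFormallyAnalytic (conformOrthogonalization.{u} ω) := by
  obtain ⟨B, hB⟩ := exists_floatSolution ω
    (A := fun i => (Fin.cons 1 (universalClifford n (n + 1)) : Fin (n + 1) → _) i +
      universalLetter n (n + 1) i)
    ⟨Fin.cons 1 (universalClifford n (n + 1)), isClifford_universalClifford.cons_one, fun j => by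
      have h := universalLetter_mem (n := n) j
      rwa [← add_sub_cancel_left ((Fin.cons 1 (universalClifford n (n + 1)) : Fin (n + 1) → _) j)
        (universalLetter n (n + 1) j)] at h⟩
  obtain ⟨ψ, hψ⟩ := exists_universal_expansion B
  refine ⟨ψ, fun 𝔄 _ _ _ Q R hQ hR => ?_⟩
  obtain ⟨Φ, hΦ, h1, h2, h3⟩ := exists_universalHom hQ.2
    (R := fun j => R j * Ring.inverse (Q 0)) fun j => mul_mem_filt_right _ (hR j)
  refine ⟨fun k => Φ (B k) * Q 0, ?_, fun k => convergesTo_of_sub_mem fun N => ?_⟩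
  · rw [conformOrthogonalization_iff]
    -- The universal solution is based at (1, P); multiplication by Q₀ from the right moves it to Q.
    have := (hB.map Φ hΦ).bivariant isUnit_one hQ.1
    simp only [one_mul] at this
    convert this using 1
    funext j
    rw [map_add, h2, add_mul, mul_assoc, Ring.inverse_mul_cancel _ hQ.1, mul_one]
    congr 1
    induction j using Fin.cases with
    | zero => simp
    | succ s => rw [Fin.cons_succ, h1, ← hQ.succ_eq]
  · have := mul_mem_filt_right (Q 0) (h3 (B k) N)
    simpa only [hψ, genericLift_expansionTerm, sub_mul, Finset.sum_mul] using this

end AnalyticSolutions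

/-! ### The integral inverse square root and polarization near Clifford elements. -/

section InverseSqrt

theorem choose_succ_mul (c : ℝ) (k : ℕ) :
    ((k : ℝ) + 1) * Ring.choose c (k + 1) = Ring.choose c k * (c - k) := by
  have := Ring.choose_smul_choose c (Nat.le_succ k)
  rw [Nat.choose_succ_self_right, Nat.succ_sub (le_refl k), Nat.sub_self, Ring.choose_one_right,
    nsmul_eq_mul] at this
  exact_mod_cast this

/-- Both sides satisfy the same recursion: integration by parts has vanishing boundary terms and
gives the ratio -(2r+1)/(2r+2), which is that of the binomial coefficients of -1/2. -/
theorem integral_neg_sin_sq_pow (r : ℕ) :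
    ∫ t in (0 : ℝ)..(2 * Real.pi), (-(Real.sin t ^ 2)) ^ r =
      2 * Real.pi * Ring.choose (-1 / 2 : ℝ) r := by
  induction r with
  | zero => simp
  | succ r ih =>
    have h1 : ∀ t : ℝ, (-(Real.sin t ^ 2)) ^ (r + 1) =
        (-1) ^ (r + 1) * Real.sin t ^ (2 * r + 2) := fun t => by
      rw [neg_pow, ← pow_mul, mul_add, mul_one]
    have h2 : ∀ t : ℝ, (-(Real.sin t ^ 2)) ^ r = (-1) ^ r * Real.sin t ^ (2 * r) := fun t => by
      rw [neg_pow, ← pow_mul]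
    simp only [h2, intervalIntegral.integral_const_mul] at ih
    simp only [h1, intervalIntegral.integral_const_mul]
    rw [integral_sin_pow]
    have h3 := choose_succ_mul (-1 / 2) r
    have h4 : Ring.choose (-1 / 2 : ℝ) (r + 1) =
        Ring.choose (-1 / 2 : ℝ) r * (-1 / 2 - r) / (r + 1) := by
      rw [← h3]; field_simp
    rw [h4]
    rw [Real.sin_zero, Real.sin_two_pi, zero_pow (Nat.succ_ne_zero _), zero_mul, zero_mul,
      sub_self, zero_div, zero_add]
    push_cast
    have h5 : (2 : ℝ) * r + 2 ≠ 0 := by positivity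
    have h6 : (r : ℝ) + 1 ≠ 0 := by positivity
    calc (-1 : ℝ) ^ (r + 1) * ((2 * r + 1) / (2 * r + 2) *
          ∫ x in (0 : ℝ)..(2 * Real.pi), Real.sin x ^ (2 * r))
        = -((2 * r + 1) / (2 * r + 2)) *
          ((-1) ^ r * ∫ x in (0 : ℝ)..(2 * Real.pi), Real.sin x ^ (2 * r)) := by ring
      _ = _ := by
        rw [ih]
        field_simp
        ring

variable {𝔄 : Type u} [Ring 𝔄] [Algebra ℝ 𝔄] [ConvenientAlgebra 𝔄]

theorem HasDegreeSum.functional_eq {f : ℕ → 𝔄} {a : 𝔄} (h : HasDegreeSum f a)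
    {g : 𝔄 →ₗ[ℝ] ℝ} {i : ℕ} (hg : ∀ b ∈ (filt i : Submodule ℝ 𝔄), g b = 0) :
    g a = ∑ r ∈ Finset.range i, g (f r) := by
  have := hg _ (h i)
  rwa [map_sub, map_sum, sub_eq_zero] at this

/-- The pencil is 1 + s sin² t, inverted by a geometric series. A continuous functional sees only
finitely many of its terms, so the integral can be taken termwise. -/
theorem isInvSqrt_one_add {s X : 𝔄} (hs : s ∈ (filt 1 : Submodule ℝ 𝔄))
    (hX : IsSeriesValue (PowerSeries.binomialSeries ℝ (-1 / 2 : ℝ)) s X) :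
    IsInvSqrt (1 + s) X := by
  have hpen : ∀ t : ℝ, pencil (1 + s) t = 1 + (Real.sin t ^ 2) • s := fun t => by
    rw [pencil, smul_add, ← add_assoc, Algebra.algebraMap_eq_smul_one, ← add_smul,
      Real.cos_sq_add_sin_sq, one_smul]
  refine ⟨fun t => by rw [hpen]; exact isUnit_one_add_smul _ hs, fun f hf => ?_⟩
  obtain ⟨i, hi⟩ := hf
  have h1 : ∀ t : ℝ, f (Ring.inverse (pencil (1 + s) t)) =
      ∑ r ∈ Finset.range i, (-(Real.sin t ^ 2)) ^ r * f (s ^ r) := fun t => by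
    obtain ⟨a, ha, h2, h3⟩ := exists_geometric (Real.sin t ^ 2) hs
    rw [hpen, inverse_eq_of_mul h2 h3, HasDegreeSum.functional_eq ha hi]
    simp
  simp only [h1]
  rw [intervalIntegral.integral_finsetSum, Finset.sum_div, HasDegreeSum.functional_eq hX hi]
  · refine Finset.sum_congr rfl fun r _ => ?_
    rw [intervalIntegral.integral_mul_const, integral_neg_sin_sq_pow]
    simp only [PowerSeries.binomialSeries_coeff, map_smul, smul_eq_mul, mul_one]
    have := Real.pi_ne_zero
    field_simp
  · intro r _
    exact Continuous.intervalIntegrable (by fun_prop) _ _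

/-- Since (1 + (y - 1)/2)(y - 1) = (y² - 1)/2 = 0, and the first factor is invertible near 1. -/
theorem eq_one_of_sq_eq_one {y : 𝔄} (hy : y * y = 1) (h : y - 1 ∈ (filt 1 : Submodule ℝ 𝔄)) :
    y = 1 := by
  have hu : IsUnit (1 + (1 / 2 : ℝ) • (y - 1)) := isUnit_one_add_smul _ h
  have h1 : (1 + (1 / 2 : ℝ) • (y - 1)) * (y - 1) = 0 := by
    rw [add_mul, one_mul, smul_mul_assoc]
    have h2 : (y - 1) * (y - 1) = (-2 : ℝ) • (y - 1) := by
      have : (y - 1) * (y - 1) = y * y - y - y + 1 := by noncomm_ring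
      rw [this, hy, neg_smul, two_smul]
      abel
    rw [h2, smul_smul]
    norm_num
  exact sub_eq_zero.mp ((hu.mul_right_eq_zero).mp h1)

theorem binomialSeries_neg_half_sq :
    PowerSeries.binomialSeries ℝ (-1 / 2 : ℝ) * PowerSeries.binomialSeries ℝ (-1 / 2 : ℝ) *
      (1 + PowerSeries.X) = 1 := by
  have h1 := PowerSeries.binomialSeries_nat (R := ℝ) (A := ℝ) 1
  rw [pow_one, Nat.cast_one] at h1
  rw [← h1, ← PowerSeries.binomialSeries_add, ← PowerSeries.binomialSeries_add]
  norm_num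

/-- A square root `P` of `-1` near `H` which commutes with `H` is the polarization of `H`. -/
theorem isPolarization_of_commute {H P : 𝔄} (hP : P * P = -1) (hc : Commute H P)
    (h : H - P ∈ (filt 1 : Submodule ℝ 𝔄)) : IsPolarization H P := by
  -- The modulus of H: it is near 1, commutes with P, and satisfies H = KP and -H² = K². It remains
  -- to see that (K²)^{-1/2} = K⁻¹.
  set K := -(H * P) with hK
  have hKP : K * P = H := by rw [hK, neg_mul, mul_assoc, hP]; simp
  have hcK : Commute K P := (hc.mul_left (Commute.refl P)).neg_left
  have hK1 : K - 1 ∈ (filt 1 : Submodule ℝ 𝔄) := by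
    have : K - 1 = -((H - P) * P) := by rw [sub_mul, hP, hK]; abel
    rw [this]
    exact neg_mem (mul_mem_filt_right _ h)
  have hHH : -(H * H) = 1 + (K * K - 1) := by
    rw [← hKP]
    have : K * P * (K * P) = K * (P * K) * P := by noncomm_ring
    rw [this, ← hcK.eq]
    have : K * (K * P) * P = K * K * (P * P) := by noncomm_ring
    rw [this, hP]
    noncomm_ring
  set s := K * K - 1 with hs
  have hs1 : s ∈ (filt 1 : Submodule ℝ 𝔄) := by
    have := mul_sub_mul_mem hK1 hK1
    rwa [one_mul] at this
  obtain ⟨X, hX⟩ := exists_isSeriesValue (PowerSeries.binomialSeries ℝ (-1 / 2 : ℝ)) hs1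
  refine ⟨X, hHH ▸ isInvSqrt_one_add hs1 hX, ?_⟩
  have hXX : X * X * (1 + s) = 1 := by
    have h1 := (hX.mul hs1 hX).mul hs1 (isSeriesValue_one_add_X hs1)
    rw [binomialSeries_neg_half_sq] at h1
    exact h1.unique (isSeriesValue_one s)
  have hXK : Commute X K := hX.commute
    (((Commute.refl K).mul_left (Commute.refl K)).sub_left (Commute.one_left K))
  have hXP : Commute X P := hX.commute ((hcK.mul_left hcK).sub_left (Commute.one_left P))
  -- The square of XK is X²K² = 1, and XK is near 1, so the sign ambiguity disappears.
  have hy : X * K = 1 := by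
    refine eq_one_of_sq_eq_one ?_ ?_
    · have : X * K * (X * K) = X * (K * X) * K := by noncomm_ring
      rw [this, ← hXK.eq]
      have : X * (X * K) * K = X * X * (1 + (K * K - 1)) := by noncomm_ring
      rw [this]
      exact hXX
    · have h2 : X - 1 ∈ (filt 1 : Submodule ℝ 𝔄) := hX.sub_mem (by simp)
      have := mul_sub_mul_mem h2 hK1
      rwa [one_mul] at this
  rw [← hKP, mul_assoc, ← hXP.eq, ← mul_assoc, ← hXK.eq, hy, one_mul]

theorem IsInvSqrt.unique {S X X' : 𝔄} (h : IsInvSqrt S X) (h' : IsInvSqrt S X') : X = X' :=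
  eq_of_forall_functional fun f hf => (h.2 f hf).trans (h'.2 f hf).symm

theorem IsPolarization.unique {H P P' : 𝔄} (h : IsPolarization H P) (h' : IsPolarization H P') :
    P = P' := by
  obtain ⟨X, hX, rfl⟩ := h
  obtain ⟨X', hX', rfl⟩ := h'
  rw [hX.unique hX']

end InverseSqrt

/-! ### Gram–Schmidt data give the Gram–Schmidt procedure. -/

section GramSchmidt

theorem take_ofFn {α : Type*} {n : ℕ} (B : Fin n → α) (k : ℕ) :
    (List.ofFn B).take k = ((List.finRange n).take k).map B := by
  rw [List.ofFn_eq_map, List.map_take]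

theorem mem_take_finRange {n : ℕ} (k h : Fin n) : h ∈ (List.finRange n).take k ↔ h < k := by
  rw [List.mem_take_iff_getElem]
  constructor
  · rintro ⟨i, hi, rfl⟩
    rw [Fin.lt_def]
    simp only [List.getElem_finRange, Fin.val_cast]
    exact lt_of_lt_of_le hi (min_le_left _ _)
  · intro hh
    refine ⟨h, ?_, by simp⟩
    have := h.isLt
    have := Fin.lt_def.mp hh
    simp only [List.length_finRange]
    omega

section Algebraic

variable {𝔄 : Type*} [Ring 𝔄] [Algebra ℝ 𝔄] {n : ℕ}

theorem component_symmetrization {P : Fin n → 𝔄} (hP : IsClifford P) (e : Fin n → Fin 2)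
    (h : Fin n) (a : Fin 2) (Z : 𝔄) :
    component P e (symmetrization (P h) a Z) = if e h = a then component P e Z else 0 := by
  rw [symmetrization_clifford (hP.sq h), component_smul, component_add, component_smul,
    component_conj hP]
  rcases fin_two_eq a with rfl | rfl <;> rcases fin_two_eq (e h) with h1 | h1 <;>
    simp only [h1, Fin.val_zero, Fin.val_one, pow_zero, pow_one, one_smul, neg_smul, neg_neg,
      add_neg_cancel, smul_zero, if_true, zero_ne_one, one_ne_zero, if_false]
  all_goals
    rw [← two_smul ℝ (component P e Z), smul_smul]
    norm_num

/-- Right multiplication by an element anticommuting with P exchanges the two eigenspaces of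
conjugation by P. So the upper indices 1 of the recursion become the zeros that precede the first 1
of a multiindex. -/
theorem symmetrization_mul {P S : 𝔄} (hP : P * P = -1) (hPS : P * S = -(S * P)) (Z : 𝔄) :
    symmetrization P 1 Z * S = symmetrization P 0 (Z * S) := by
  rw [symmetrization_clifford hP, symmetrization_clifford hP, smul_mul_assoc, add_mul]
  have h : P * Z * P * S = -(P * (Z * S) * P) := by
    rw [mul_assoc (P * Z), hPS]
    noncomm_ring
  simp [h]

theorem component_foldl {B : Fin n → 𝔄} (hB : IsClifford B) (e : Fin n → Fin 2) (k : Fin n)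
    (L : List (Fin n)) (hL : ∀ h ∈ L, h ≠ k) (Z : 𝔄) :
    component B e ((L.map B).foldl (fun X Q => symmetrization Q 1 X) Z * B k) =
      if ∀ h ∈ L, e h = 0 then component B e (Z * B k) else 0 := by
  induction L generalizing Z with
  | nil => simp
  | cons h L ih =>
    rw [List.map_cons, List.foldl_cons, ih (fun h' hh' => hL h' (List.mem_cons_of_mem _ hh')),
      symmetrization_mul (hB.sq h) (hB.anticomm (hL h List.mem_cons_self)),
      component_symmetrization hB]
    simp only [List.forall_mem_cons]
    by_cases h1 : e h = 0 <;> by_cases h2 : ∀ h' ∈ L, e h' = 0 <;> simp [h1]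

theorem IsGramSchmidt.unique [ConvenientAlgebra 𝔄] {A B B' : Fin n → 𝔄} (h : IsGramSchmidt A B)
    (h' : IsGramSchmidt A B') : B = B' := by
  funext k
  induction k using WellFoundedLT.induction with
  | ind k ih =>
    have hk := h k
    rw [take_ofFn, List.map_congr_left (fun l hl => ih l ((mem_take_finRange k l).mp hl)),
      ← take_ofFn] at hk
    exact hk.unique (h' k)

open Classical in
theorem gsData_coeff (j : Fin n) (e : Fin n → Fin 2) :
    (gsData n).coeff j e = if e j = 1 ∧ ∀ h < j, e h = 0 then 1 else 0 := rfl

theorem orthPart_gsData (Q R : Fin n → 𝔄) {e : Fin n → Fin 2} {k : Fin n} (hk : e k = 1)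
    (hlt : ∀ h < k, e h = 0) :
    orthPart (gsData n) Q R e = component Q e (R k * Ring.inverse (Q k)) := by
  rw [orthPart, Finset.sum_eq_single k]
  · rw [gsData_coeff, if_pos ⟨hk, hlt⟩, one_smul]
  · intro j _ hj
    rw [gsData_coeff, if_neg, zero_smul]
    rintro ⟨h1, h2⟩
    rcases lt_or_gt_of_ne hj with h | h
    · simp [hlt j h] at h1
    · simp [h2 k h] at hk
  · simp

/-- The first active slot is slot zero if that is active, and otherwise the first active slot of the
tail. This reduces the floating statement to the non-floating one. -/
theorem gsData_succ (n : ℕ) : gsData (n + 1) = (gsData n).extend := by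
  have h : (gsData (n + 1)).coeff = (gsData n).extend.coeff := by
    funext j e
    induction j using Fin.cases with
    | zero => rw [extend_coeff_zero, gsData_coeff]; simp
    | succ j =>
      rw [extend_coeff_succ, gsData_coeff, gsData_coeff]
      have h1 : (∀ h < j.succ, e h = 0) ↔ e 0 = 0 ∧ ∀ h < j, Fin.tail e h = 0 := by
        constructor
        · exact fun hh => ⟨hh 0 (Fin.succ_pos j), fun h hj => hh h.succ (Fin.succ_lt_succ_iff.mpr hj)⟩
        · rintro ⟨h0, h2⟩ h hj
          induction h using Fin.cases with
          | zero => exact h0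
          | succ h => exact h2 h (Fin.succ_lt_succ_iff.mp hj)
      rcases fin_two_eq (e 0) with h0 | h0
      · simp only [h1, h0, Fin.tail, zero_ne_one, if_false, true_and]
        congr
      · simp [h1, h0]
  cases hg : gsData (n + 1)
  cases he : (gsData n).extend
  rw [hg, he] at h
  subst h
  rfl

end Algebraic

variable {𝔄 : Type u} [Ring 𝔄] [Algebra ℝ 𝔄] [ConvenientAlgebra 𝔄] {n : ℕ}

/-- Let H be the reduced A_k. The components of HB_k with e k = 1 vanish: if an earlier slot is
active by the reduction, and otherwise because they are the part of A at e. So H commutes with B_k.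
-/
theorem IsSolution.isGramSchmidt {A B : Fin n → 𝔄} (h : IsSolution (gsData n) A B) :
    IsGramSchmidt A B := by
  intro k
  have hB := h.clifford
  rw [take_ofFn]
  set L := (List.finRange n).take k with hL
  have hLk : ∀ l ∈ L, l ≠ k := fun l hl => ((mem_take_finRange k l).mp hl).ne
  set H := (L.map B).foldl (fun X Q => symmetrization Q 1 X) (A k) with hH
  refine isPolarization_of_commute (hB.sq k) ?_ ?_
  · have h0 : symmetrization (B k) 1 (H * B k) = 0 := by
      refine eq_zero_of_component (P := B) fun e => ?_
      rw [component_symmetrization hB, hH, component_foldl hB e k L hLk]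
      split_ifs with h1 h2
      · have h3 : ∀ l < k, e l = 0 := fun l hl => h2 l ((mem_take_finRange k l).mpr hl)
        have h4 := h.part_eq_zero e
        rw [orthPart_gsData _ _ h1 h3, Pi.sub_apply, hB.inverse, sub_mul, mul_neg, mul_neg, hB.sq,
          component_sub, component_neg, neg_neg, component_one hB, sub_zero, neg_eq_zero] at h4
        · exact h4
        · intro he
          simp [he] at h1
      · rfl
      · rfl
    rw [symmetrization_clifford (hB.sq k)] at h0
    have h1 := (smul_eq_zero.mp h0).resolve_left (by norm_num)
    have h2 : B k * (H * B k) * B k = -(B k * H) := by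
      rw [mul_assoc, mul_assoc, hB.sq]; noncomm_ring
    rw [h2] at h1
    simp only [Fin.val_one, pow_one, neg_neg, neg_smul, one_smul] at h1
    exact add_neg_eq_zero.mp h1
  -- B_k anticommutes with the other elements, so the reduction fixes it, and closeness to it is
  -- preserved.
  · have key : ∀ (L : List (Fin n)), (∀ l ∈ L, l ≠ k) → ∀ Z, Z - B k ∈ (filt 1 : Submodule ℝ 𝔄) →
        (L.map B).foldl (fun X Q => symmetrization Q 1 X) Z - B k ∈
          (filt 1 : Submodule ℝ 𝔄) := by
      intro L
      induction L with
      | nil => exact fun _ Z hZ => hZ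
      | cons l L ih =>
        intro hL Z hZ
        rw [List.map_cons, List.foldl_cons]
        refine ih (fun l' hl' => hL l' (List.mem_cons_of_mem _ hl')) _ ?_
        have h1 : symmetrization (B l) 1 (B k) = B k := by
          rw [symmetrization_clifford (hB.sq l), hB.anticomm (hL l List.mem_cons_self), neg_mul,
            mul_assoc, hB.sq]
          simp [← two_smul ℝ (B k), smul_smul]
        have h2 := symmetrization_mem (B l) 1 hZ
        rw [← symmetrizationₗ_apply, map_sub, symmetrizationₗ_apply, symmetrizationₗ_apply,
          h1] at h2
        exact h2
    exact key L hLk _ (h.close k)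

/-- Conversely, a solution exists on the formal domain, is a Gram–Schmidt value, and such values are
unique. -/
theorem isSolution_gsData_iff (A B : Fin n → 𝔄) :
    IsSolution (gsData n) A B ↔ FormalDomain A ∧ IsGramSchmidt A B := by
  constructor
  · exact fun h => ⟨⟨B, h.clifford, h.close⟩, h.isGramSchmidt⟩
  · rintro ⟨hA, h⟩
    obtain ⟨B', hB'⟩ := exists_solution (gsData n) hA
    rwa [h.unique hB'.isGramSchmidt]

theorem FloatFormalDomain.isUnit {A : Fin (n + 1) → 𝔄} (hA : FloatFormalDomain A) :
    IsUnit (A 0) := by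
  obtain ⟨Q, hQ, h⟩ := hA
  exact isUnit_of_sub_mem hQ.1 (h 0)

theorem FloatFormalDomain.tilde {A : Fin (n + 1) → 𝔄} (hA : FloatFormalDomain A) :
    FormalDomain (tilde A) := by
  have h0 := hA.isUnit
  obtain ⟨Q, hQ, h⟩ := hA
  exact ⟨FQ.tilde Q, hQ.2, tilde_sub_mem h0 hQ.1 h⟩

theorem isFloatSolution_gsData_iff (A B : Fin (n + 1) → 𝔄) :
    IsFloatSolution (gsData (n + 1)) A B ↔ FloatFormalDomain A ∧ IsConformGramSchmidt A B := by
  have hcons : ∀ C : Fin n → 𝔄, IsUnit (A 0) →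
      tilde (Fin.cons (A 0) fun i => C i * A 0 : Fin (n + 1) → 𝔄) = C := fun C hu => by
    funext s
    rw [tilde, Fin.cons_succ, Fin.cons_zero, mul_assoc, Ring.mul_inverse_cancel _ hu, mul_one]
  constructor
  · intro h
    refine ⟨⟨B, h.floating, h.close⟩, ?_⟩
    have hfl := h.floating
    rw [gsData_succ, isFloatSolution_extend_iff] at h
    obtain ⟨hu, h0, h⟩ := h
    refine ⟨hu, tilde B, h.isGramSchmidt, ?_⟩
    funext j
    induction j using Fin.cases with
    | zero => exact h0
    | succ s => rw [Fin.cons_succ, ← h0]; exact hfl.succ_eq s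
  · rintro ⟨hA, hu, C, hC, rfl⟩
    rw [gsData_succ, isFloatSolution_extend_iff, hcons C hu]
    exact ⟨hu, rfl, (isSolution_gsData_iff _ _).mpr ⟨hA.tilde, hC⟩⟩

end GramSchmidt

/-! ### The equations for the symmetric connection. -/

section SymmetricConnection

theorem syData_coeff {n : ℕ} (j : Fin n) (e : Fin n → Fin 2) :
    (syData n).coeff j e = ((e j : ℕ) : ℝ) / ∑ i, ((e i : ℕ) : ℝ) := rfl

theorem sum_index_ne_zero {n : ℕ} {e : Fin n → Fin 2} (he : e ≠ 0) :
    ∑ i, ((e i : ℕ) : ℝ) ≠ 0 := by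
  intro h
  have h1 := (syData n).sum_coeff e he
  simp only [syData_coeff, h, div_zero, Finset.sum_const_zero] at h1
  exact zero_ne_one h1

theorem sum_syData_smul {M : Type*} [AddCommGroup M] [Module ℝ M] {n : ℕ} (e : Fin n → Fin 2)
    (z : Fin n → M) : (∑ i, ((e i : ℕ) : ℝ)) • ∑ j, (syData n).coeff j e • z j =
      ∑ j, ((e j : ℕ) : ℝ) • z j := by
  by_cases he : e = 0
  · simp [he]
  · rw [Finset.smul_sum]
    refine Finset.sum_congr rfl fun j _ => ?_
    rw [smul_smul, syData_coeff, mul_div_cancel₀ _ (sum_index_ne_zero he)]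

/-- The denominator ∑ ι_i does not depend on j and can be cleared; for index 0 both sums are zero.
-/
theorem sum_syData_eq_zero_iff {M : Type*} [AddCommGroup M] [Module ℝ M] {n : ℕ}
    (e : Fin n → Fin 2) (z : Fin n → M) :
    ∑ j, (syData n).coeff j e • z j = 0 ↔ ∑ j, ((e j : ℕ) : ℝ) • z j = 0 := by
  rw [← sum_syData_smul]
  by_cases he : e = 0
  · simp [he, syData_coeff]
  · rw [smul_eq_zero_iff_right (sum_index_ne_zero he)]

variable {𝔄 : Type*} [Ring 𝔄] [Algebra ℝ 𝔄] {n : ℕ}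

/-- The factor e j is the effect of antisymmetrizing the j-th term by B_j, which turns R_jB_j⁻¹ into
a multiple of the commutator of R_j and B_j. So all parts are components of the single sum of
commutators. -/
theorem orthPart_syData_iff {B : Fin n → 𝔄} (hB : IsClifford B) (R : Fin n → 𝔄) :
    (∀ e, orthPart (syData n) B R e = 0) ↔ ∑ j, (R j * B j - B j * R j) = 0 := by
  have h1 : ∀ j, symmetrization (B j) 1 (R j * Ring.inverse (B j)) =
      (-(1 / 2) : ℝ) • (R j * B j - B j * R j) := fun j => by
    have h2 : B j * (R j * B j) * B j = -(B j * R j) := by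
      rw [mul_assoc, mul_assoc, hB.sq]; noncomm_ring
    rw [symmetrization_clifford (hB.sq j), hB.inverse, mul_neg, mul_neg, neg_mul, h2]
    simp only [Fin.val_one, pow_one, neg_neg, neg_smul, one_smul, ← smul_neg]
    congr 1
    abel
  have h2 : ∀ e, component B e (∑ j, symmetrization (B j) 1 (R j * Ring.inverse (B j))) =
      ∑ j, ((e j : ℕ) : ℝ) • component B e (R j * Ring.inverse (B j)) := fun e => by
    rw [component_sum]
    refine Finset.sum_congr rfl fun j _ => ?_
    rw [component_symmetrization hB]
    rcases fin_two_eq (e j) with h | h <;> simp [h]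
  have h3 : ∑ j, symmetrization (B j) 1 (R j * Ring.inverse (B j)) =
      (-(1 / 2) : ℝ) • ∑ j, (R j * B j - B j * R j) := by
    rw [Finset.smul_sum]
    exact Finset.sum_congr rfl fun j _ => h1 j
  simp only [orthPart, sum_syData_eq_zero_iff, ← h2, h3]
  constructor
  · intro h
    exact (smul_eq_zero.mp (eq_zero_of_component h)).resolve_left (by norm_num)
  · intro h e
    rw [h, smul_zero, component_map_zero]

theorem floatPart_syData_iff {B : Fin (n + 1) → 𝔄} (hB : IsFloatingClifford B)
    (R : Fin (n + 1) → 𝔄) :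
    (∀ e, floatPart (syData (n + 1)) B R e = 0) ↔
      ∑ j, R j * Ring.inverse (B j) = 0 ∧ ∑ j, Ring.inverse (B j) * R j = 0 := by
  set Z : Fin (n + 1) → 𝔄 := fun j => R j * Ring.inverse (B j) with hZ
  set W : Fin (n + 1) → 𝔄 := fun j => B 0 * (Ring.inverse (B j) * R j) * Ring.inverse (B 0) with hW
  have hW0 : W 0 = Z 0 := by
    simp only [hW, hZ]
    rw [← mul_assoc (B 0), Ring.mul_inverse_cancel _ hB.1, one_mul]
  have hWs : ∀ s : Fin n, W s.succ = -(tilde B s * Z s.succ * tilde B s) := fun s => by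
    simp only [hW, hZ]
    rw [hB.inverse_succ]
    have h1 : B 0 * (-(Ring.inverse (B 0) * tilde B s) * R s.succ) * Ring.inverse (B 0) =
        -((B 0 * Ring.inverse (B 0)) * tilde B s * R s.succ * Ring.inverse (B 0)) := by noncomm_ring
    have h2 : -(tilde B s * (R s.succ * -(Ring.inverse (B 0) * tilde B s)) * tilde B s) =
        tilde B s * R s.succ * Ring.inverse (B 0) * (tilde B s * tilde B s) := by noncomm_ring
    rw [h1, h2, Ring.mul_inverse_cancel _ hB.1, hB.2.sq]
    noncomm_ring
  -- The components of W_j and Z_j agree up to sign, so that half of the signed difference is the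
  -- component of Z_j when e j = 1, and zero otherwise.
  have key : ∀ e : Fin (n + 1) → Fin 2,
      ∑ j, ((e j : ℕ) : ℝ) • component (tilde B) (relIndex e) (Z j) =
      (1 / 2 : ℝ) • (component (tilde B) (relIndex e) (∑ j, Z j) -
        (-1 : ℝ) ^ (e 0 : ℕ) • component (tilde B) (relIndex e) (∑ j, W j)) := fun e => by
    rw [component_sum, component_sum, Finset.smul_sum, ← Finset.sum_sub_distrib, Finset.smul_sum]
    refine Finset.sum_congr rfl fun j _ => ?_
    induction j using Fin.cases with
    | zero =>
      rw [hW0]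
      rcases fin_two_eq (e 0) with h | h
      · simp [h]
      · simp only [h, Fin.val_one, Nat.cast_one, pow_one, neg_smul, one_smul, sub_neg_eq_add]
        rw [← two_smul ℝ (component _ _ _), smul_smul]
        norm_num
    | succ s =>
      rw [hWs, component_conj hB.2, relIndex]
      rcases fin_two_eq (e 0) with h0 | h0 <;> rcases fin_two_eq (e s.succ) with h | h
      · simp [h, h0]
      · simp only [h, h0, sub_zero, Fin.val_one, Fin.val_zero, Nat.cast_one, pow_one, pow_zero,
          neg_smul, one_smul, sub_neg_eq_add]
        rw [← two_smul ℝ (component _ _ _), smul_smul]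
        norm_num
      · simp [h, h0]
      · simp only [h, h0, sub_self, Fin.val_one, Fin.val_zero, Nat.cast_one, pow_one, pow_zero,
          neg_smul, one_smul, sub_neg_eq_add]
        rw [← two_smul ℝ (component _ _ _), smul_smul]
        norm_num
  have hSW : ∑ j, W j = B 0 * (∑ j, Ring.inverse (B j) * R j) * Ring.inverse (B 0) := by
    rw [Finset.mul_sum, Finset.sum_mul]
  have hSW' : ∑ j, W j = 0 ↔ ∑ j, Ring.inverse (B j) * R j = 0 := by
    rw [hSW]
    constructor
    · intro h
      have h1 := congrArg (fun x => Ring.inverse (B 0) * x * B 0) h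
      have h2 : ∀ x, Ring.inverse (B 0) * (B 0 * x * Ring.inverse (B 0)) * B 0 =
        (Ring.inverse (B 0) * B 0) * x * (Ring.inverse (B 0) * B 0) := fun x => by noncomm_ring
      simpa only [h2, Ring.inverse_mul_cancel _ hB.1, one_mul, mul_one, mul_zero, zero_mul] using h1
    · intro h
      rw [h, mul_zero, zero_mul]
  simp only [floatPart, sum_syData_eq_zero_iff]
  rw [← hSW']
  constructor
  · intro h
    -- The two multiindices with relative index f give the difference and the sum of the same two
    -- components.
    have h1 : ∀ f, component (tilde B) f (∑ j, Z j) = component (tilde B) f (∑ j, W j) ∧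
        component (tilde B) f (∑ j, Z j) = -component (tilde B) f (∑ j, W j) := fun f => by
      have hf0 : relIndex (Fin.cons 0 f : Fin (n + 1) → Fin 2) = f := by
        funext s; simp [relIndex]
      have hf1 : relIndex (Fin.cons 1 fun s => f s + 1 : Fin (n + 1) → Fin 2) = f := by
        funext s; simp [relIndex]
      have e0 := (key (Fin.cons 0 f)).symm.trans (h _)
      have e1 := (key (Fin.cons 1 fun s => f s + 1)).symm.trans (h _)
      rw [hf0] at e0
      rw [hf1] at e1
      have e0' := (smul_eq_zero.mp e0).resolve_left (by norm_num)
      have e1' := (smul_eq_zero.mp e1).resolve_left (by norm_num)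
      simp only [Fin.cons_zero, Fin.val_zero, Fin.val_one, pow_zero, pow_one, one_smul, neg_smul,
        sub_neg_eq_add] at e0' e1'
      exact ⟨sub_eq_zero.mp e0', eq_neg_of_add_eq_zero_left e1'⟩
    have h2 : ∀ f, component (tilde B) f (∑ j, W j) = 0 := fun f => by
      have := (h1 f).1.symm.trans (h1 f).2
      rw [eq_neg_iff_add_eq_zero, ← two_smul ℝ] at this
      exact (smul_eq_zero.mp this).resolve_left two_ne_zero
    exact ⟨eq_zero_of_component fun f => (h1 f).1.trans (h2 f), eq_zero_of_component h2⟩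
  · rintro ⟨h1, h2⟩ e
    rw [key, h1, h2]
    simp [component_map_zero]

/-- Floating Clifford systems in terms of the tuple of inverses. -/
theorem isFloatingClifford_iff {Q : Fin (n + 1) → 𝔄} : IsFloatingClifford Q ↔
    ∃ S : Fin (n + 1) → 𝔄, (∀ j k, Q j * S k + Q k * S j = if j = k then 2 else 0) ∧
      ∀ j k, S j * Q k + S k * Q j = if j = k then 2 else 0 := by
  constructor
  · intro hQ
    have h1 := Ring.mul_inverse_cancel _ hQ.1
    have h2 := Ring.inverse_mul_cancel _ hQ.1
    have hPQ : ∀ s t : Fin n, Q s.succ * Ring.inverse (Q t.succ) = -(tilde Q s * tilde Q t) :=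
      fun s t => by
        rw [hQ.inverse_succ, hQ.succ_eq s, mul_neg, mul_assoc, ← mul_assoc (Q 0), h1, one_mul]
    have hQP : ∀ s t : Fin n, Ring.inverse (Q s.succ) * Q t.succ =
        -(Ring.inverse (Q 0) * (tilde Q s * tilde Q t) * Q 0) := fun s t => by
      rw [hQ.inverse_succ, hQ.succ_eq t]
      noncomm_ring
    have hcl : ∀ s t : Fin n, -(tilde Q s * tilde Q t) + -(tilde Q t * tilde Q s) =
        if s.succ = t.succ then 2 else 0 := fun s t => by
      rw [← neg_add, hQ.2 s t]
      simp only [Fin.succ_inj]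
      split_ifs <;> simp
    have h0Q : ∀ s : Fin n, Q 0 * Ring.inverse (Q s.succ) = -tilde Q s := fun s => by
      rw [hQ.inverse_succ, mul_neg, ← mul_assoc, h1, one_mul]
    refine ⟨fun j => Ring.inverse (Q j), fun j k => ?_, fun j k => ?_⟩
    · induction j using Fin.cases with
      | zero =>
        induction k using Fin.cases with
        | zero => simp [h1, one_add_one_eq_two]
        | succ t =>
          rw [if_neg (Fin.succ_ne_zero t).symm]
          change _ + tilde Q t = 0
          rw [h0Q, neg_add_cancel]
      | succ s =>
        induction k using Fin.cases with
        | zero =>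
          rw [if_neg (Fin.succ_ne_zero s)]
          change tilde Q s + _ = 0
          rw [h0Q, add_neg_cancel]
        | succ t => rw [hPQ, hPQ, hcl]
    · induction j using Fin.cases with
      | zero =>
        induction k using Fin.cases with
        | zero => simp [h2, one_add_one_eq_two]
        | succ t =>
          rw [if_neg (Fin.succ_ne_zero t).symm]
          dsimp only
          rw [hQ.inverse_succ, hQ.succ_eq]
          noncomm_ring
      | succ s =>
        induction k using Fin.cases with
        | zero =>
          rw [if_neg (Fin.succ_ne_zero s)]
          dsimp only
          rw [hQ.inverse_succ, hQ.succ_eq]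
          noncomm_ring
        | succ t =>
          rw [hQP, hQP, ← hcl]
          have h3 : -(Ring.inverse (Q 0) * (tilde Q s * tilde Q t) * Q 0) +
              -(Ring.inverse (Q 0) * (tilde Q t * tilde Q s) * Q 0) =
              -(Ring.inverse (Q 0) * (tilde Q s * tilde Q t + tilde Q t * tilde Q s) * Q 0) := by
            noncomm_ring
          rw [h3, hQ.2 s t, ← neg_add, hQ.2 s t]
          split_ifs
          · have : Ring.inverse (Q 0) * (-2 : 𝔄) * Q 0 = (Ring.inverse (Q 0) * Q 0) * -2 := by
              noncomm_ring
            rw [this, h2, one_mul]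
          · simp
  · rintro ⟨S, h1, h2⟩
    have hQS : ∀ j, Q j * S j = 1 := fun j => by
      have := h1 j j
      rw [if_pos rfl, ← one_add_one_eq_two, ← two_smul ℝ, ← two_smul ℝ (1 : 𝔄)] at this
      exact smul_right_injective 𝔄 (two_ne_zero (α := ℝ)) this
    have hSQ : ∀ j, S j * Q j = 1 := fun j => by
      have := h2 j j
      rw [if_pos rfl, ← one_add_one_eq_two, ← two_smul ℝ, ← two_smul ℝ (1 : 𝔄)] at this
      exact smul_right_injective 𝔄 (two_ne_zero (α := ℝ)) this
    refine ⟨⟨⟨Q 0, S 0, hQS 0, hSQ 0⟩, rfl⟩, fun s t => ?_⟩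
    -- From S₀Q_t = -S_tQ₀, which reduces the Clifford relations to the first family of pairings.
    have h3 : ∀ s t : Fin n, tilde Q s * tilde Q t = -(Q s.succ * S t.succ) := fun s t => by
      have h4 := h2 0 t.succ
      rw [if_neg (Fin.succ_ne_zero t).symm] at h4
      rw [tilde, tilde, inverse_eq_of_mul (hQS 0) (hSQ 0)]
      have : Q s.succ * S 0 * (Q t.succ * S 0) = Q s.succ * (S 0 * Q t.succ) * S 0 := by
        noncomm_ring
      rw [this, eq_neg_of_add_eq_zero_left h4]
      have : Q s.succ * -(S t.succ * Q 0) * S 0 = -(Q s.succ * S t.succ * (Q 0 * S 0)) := by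
        noncomm_ring
      rw [this, hQS, mul_one]
    rw [h3, h3, ← neg_add, h1]
    simp only [Fin.succ_inj]
    split_ifs <;> simp

theorem inverse_eq_of_pair {Q S : Fin (n + 1) → 𝔄}
    (h1 : ∀ j k, Q j * S k + Q k * S j = if j = k then 2 else 0)
    (h2 : ∀ j k, S j * Q k + S k * Q j = if j = k then 2 else 0) (j : Fin (n + 1)) :
    Ring.inverse (Q j) = S j := by
  refine inverse_eq_of_mul ?_ ?_
  · have := h1 j j
    rw [if_pos rfl, ← one_add_one_eq_two, ← two_smul ℝ, ← two_smul ℝ (1 : 𝔄)] at this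
    exact smul_right_injective 𝔄 (two_ne_zero (α := ℝ)) this
  · have := h2 j j
    rw [if_pos rfl, ← one_add_one_eq_two, ← two_smul ℝ, ← two_smul ℝ (1 : 𝔄)] at this
    exact smul_right_injective 𝔄 (two_ne_zero (α := ℝ)) this

end SymmetricConnection

/-! ### Orthogonal changes of coordinates. -/

section Rotation

variable {𝔄 : Type*} [Ring 𝔄] [Algebra ℝ 𝔄] {n : ℕ}

/-- The tuple `U A` for a real matrix `U`. -/
def rotate (U : Matrix (Fin n) (Fin n) ℝ) (A : Fin n → 𝔄) : Fin n → 𝔄 := fun i => ∑ j, U i j • A j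

theorem rotate_mul_rotate (U : Matrix (Fin n) (Fin n) ℝ) (A B : Fin n → 𝔄) (i k : Fin n) :
    rotate U A i * rotate U B k = ∑ j, ∑ l, (U i j * U k l) • (A j * B l) := by
  simp only [rotate, Finset.sum_mul_sum, smul_mul_smul_comm]

theorem sum_rotate_mul_rotate {U : Matrix (Fin n) (Fin n) ℝ}
    (hU : U ∈ Matrix.orthogonalGroup (Fin n) ℝ) (A B : Fin n → 𝔄) :
    ∑ i, rotate U A i * rotate U B i = ∑ j, A j * B j := by
  have hU' : ∀ j l, ∑ i, U i j * U i l = if j = l then 1 else 0 := fun j l => by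
    have := congrFun (congrFun ((Matrix.mem_orthogonalGroup_iff' _ _).mp hU) j) l
    simpa [Matrix.mul_apply, Matrix.one_apply] using this
  simp only [rotate_mul_rotate]
  rw [Finset.sum_comm]
  refine Finset.sum_congr rfl fun j _ => ?_
  rw [Finset.sum_comm]
  simp only [← Finset.sum_smul, hU']
  simp

theorem rotate_polar {U : Matrix (Fin n) (Fin n) ℝ} (hU : U ∈ Matrix.orthogonalGroup (Fin n) ℝ)
    {A B : Fin n → 𝔄} {c : 𝔄} (h : ∀ j k, A j * B k + A k * B j = if j = k then c else 0)
    (i k : Fin n) : rotate U A i * rotate U B k + rotate U A k * rotate U B i =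
      if i = k then c else 0 := by
  have hU' : ∑ j, U i j * U k j = if i = k then 1 else 0 := by
    have := congrFun (congrFun ((Matrix.mem_orthogonalGroup_iff _ _).mp hU) i) k
    simpa [Matrix.mul_apply, Matrix.one_apply] using this
  have h1 : rotate U A k * rotate U B i = ∑ j, ∑ l, (U i j * U k l) • (A l * B j) := by
    rw [rotate_mul_rotate, Finset.sum_comm]
    simp only [mul_comm]
  rw [rotate_mul_rotate, h1]
  simp only [← Finset.sum_add_distrib, ← smul_add, h]
  simp only [smul_ite, smul_zero, Finset.sum_ite_eq, Finset.mem_univ, if_true, ← Finset.sum_smul,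
    hU', ite_smul, one_smul, zero_smul]

theorem rotate_sub (U : Matrix (Fin n) (Fin n) ℝ) (A B : Fin n → 𝔄) :
    rotate U A - rotate U B = rotate U (A - B) := by
  funext i
  simp [rotate, smul_sub, Finset.sum_sub_distrib]

theorem IsClifford.rotate {U : Matrix (Fin n) (Fin n) ℝ}
    (hU : U ∈ Matrix.orthogonalGroup (Fin n) ℝ) {Q : Fin n → 𝔄} (hQ : IsClifford Q) :
    IsClifford (rotate U Q) := rotate_polar hU hQ

variable [ConvenientAlgebra 𝔄]

theorem rotate_mem {U : Matrix (Fin n) (Fin n) ℝ} {A : Fin n → 𝔄} {i : ℕ}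
    (hA : ∀ j, A j ∈ (filt i : Submodule ℝ 𝔄)) (j : Fin n) :
    rotate U A j ∈ (filt i : Submodule ℝ 𝔄) :=
  Submodule.sum_mem _ fun j _ => Submodule.smul_mem _ _ (hA j)

theorem FormallyClose.rotate {U : Matrix (Fin n) (Fin n) ℝ} {A B : Fin n → 𝔄}
    (h : FormallyClose A B) : FormallyClose (rotate U A) (FQ.rotate U B) := fun j => by
  rw [← Pi.sub_apply, rotate_sub]
  exact rotate_mem h j

end Rotation

/-! ### Orthogonal and permutation symmetry of the symmetric procedures. -/

section SymmetricSolutions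

variable {𝔄 : Type u} [Ring 𝔄] [Algebra ℝ 𝔄] [ConvenientAlgebra 𝔄] {n : ℕ}

theorem isSolution_syData_iff (A B : Fin n → 𝔄) : IsSolution (syData n) A B ↔
    IsClifford B ∧ FormallyClose A B ∧ ∑ j, A j * B j = ∑ j, B j * A j := by
  have h : ∀ A B : Fin n → 𝔄, ∑ j, ((A - B) j * B j - B j * (A - B) j) = 0 ↔
      ∑ j, A j * B j = ∑ j, B j * A j := fun A B => by
    rw [← sub_eq_zero (a := ∑ j, A j * B j), ← Finset.sum_sub_distrib]
    simp [sub_mul, mul_sub]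
  constructor
  · exact fun hs => ⟨hs.clifford, hs.close, (h A B).mp
      ((orthPart_syData_iff hs.clifford _).mp hs.part_eq_zero)⟩
  · exact fun ⟨h1, h2, h3⟩ => ⟨h1, h2, (orthPart_syData_iff h1 _).mpr ((h A B).mpr h3)⟩

theorem isFloatSolution_syData_iff (A B : Fin (n + 1) → 𝔄) :
    IsFloatSolution (syData (n + 1)) A B ↔ IsFloatingClifford B ∧ FormallyClose A B ∧
      ∑ j, (A - B) j * Ring.inverse (B j) = 0 ∧ ∑ j, Ring.inverse (B j) * (A - B) j = 0 :=
  ⟨fun h => ⟨h.floating, h.close, (floatPart_syData_iff h.floating _).mp h.part_eq_zero⟩,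
    fun ⟨h1, h2, h3⟩ => ⟨h1, h2, (floatPart_syData_iff h1 _).mpr h3⟩⟩

theorem IsSolution.rotate {A B : Fin n → 𝔄} (h : IsSolution (syData n) A B)
    {U : Matrix (Fin n) (Fin n) ℝ} (hU : U ∈ Matrix.orthogonalGroup (Fin n) ℝ) :
    IsSolution (syData n) (FQ.rotate U A) (FQ.rotate U B) := by
  rw [isSolution_syData_iff] at h ⊢
  refine ⟨h.1.rotate hU, h.2.1.rotate, ?_⟩
  rw [sum_rotate_mul_rotate hU, sum_rotate_mul_rotate hU, h.2.2]

/-- The pair of B and its tuple of inverses is described by symmetric relations invariant under a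
common rotation. Hence the inverses of the rotated tuple are the rotated inverses, and the two sums
are unchanged. -/
theorem IsFloatSolution.rotate {A B : Fin (n + 1) → 𝔄}
    (h : IsFloatSolution (syData (n + 1)) A B)
    {U : Matrix (Fin (n + 1)) (Fin (n + 1)) ℝ}
    (hU : U ∈ Matrix.orthogonalGroup (Fin (n + 1)) ℝ) :
    IsFloatSolution (syData (n + 1)) (FQ.rotate U A) (FQ.rotate U B) := by
  rw [isFloatSolution_syData_iff] at h ⊢
  obtain ⟨hB, hc, h1, h2⟩ := h
  obtain ⟨S, h3, h4⟩ := isFloatingClifford_iff.mp hB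
  have h3' := rotate_polar hU h3
  have h4' := rotate_polar hU h4
  simp only [inverse_eq_of_pair h3 h4] at h1 h2
  refine ⟨isFloatingClifford_iff.mpr ⟨FQ.rotate U S, h3', h4'⟩, hc.rotate, ?_, ?_⟩
  · simp only [inverse_eq_of_pair h3' h4', rotate_sub]
    rw [sum_rotate_mul_rotate hU, h1]
  · simp only [inverse_eq_of_pair h3' h4', rotate_sub]
    rw [sum_rotate_mul_rotate hU, h2]

/-- The matrix of a permutation. -/
def permMatrix (σ : Equiv.Perm (Fin n)) : Matrix (Fin n) (Fin n) ℝ :=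
  fun i j => if σ i = j then 1 else 0

theorem permMatrix_mem (σ : Equiv.Perm (Fin n)) :
    permMatrix σ ∈ Matrix.orthogonalGroup (Fin n) ℝ := by
  rw [Matrix.mem_orthogonalGroup_iff]
  ext i k
  simp [Matrix.mul_apply, Matrix.one_apply, permMatrix, eq_comm]

theorem rotate_permMatrix (σ : Equiv.Perm (Fin n)) (A : Fin n → 𝔄) :
    rotate (permMatrix σ) A = fun i => A (σ i) := by
  funext i
  simp [rotate, permMatrix]

end SymmetricSolutions

/-! ### Square roots of Gram matrices over formal power series. -/

section Filtrations

/-- A finite dimensional algebra with the trivial filtration. -/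
abbrev trivialFiltration (𝔄 : Type*) [Ring 𝔄] [Algebra ℝ 𝔄] [Module.Finite ℝ 𝔄] :
    ConvenientAlgebra 𝔄 where
  filt i := if i = 0 then ⊤ else ⊥
  filt_zero := if_pos rfl
  filt_antitone i j hij := by
    rcases Nat.eq_zero_or_pos i with h | h
    · simp [h]
    · have : j ≠ 0 := by omega
      simp [this]
  mul_mem_filt {i j a b} ha hb := by
    by_cases hi : i = 0
    · by_cases hj : j = 0
      · simp [hi, hj]
      · simp only [hj, if_false, Submodule.mem_bot] at hb
        simp [hb]
    · simp only [hi, if_false, Submodule.mem_bot] at ha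
      simp [ha]
  hausdorff a h := by simpa using h 1
  complete x hx := by
    refine ⟨x 1, fun i => ?_⟩
    by_cases hi : i = 0
    · simp [hi]
    · have h1 : ∀ k, x (k + 1) = x 1 := by
        intro k
        induction k with
        | zero => rfl
        | succ k ih =>
          have := hx (k + 1)
          simp only [Nat.add_eq_zero_iff, one_ne_zero, and_false, if_false,
            Submodule.mem_bot] at this
          rw [← ih, ← sub_eq_zero, this]
      obtain ⟨k, rfl⟩ := Nat.exists_eq_succ_of_ne_zero hi
      simp [h1]
  finite_quotient i := inferInstance

instance instReal : ConvenientAlgebra ℝ := trivialFiltration ℝ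

/-- Matrices over a convenient algebra, filtered entrywise. -/
instance instMatrix (n : ℕ) (𝔄 : Type*) [Ring 𝔄] [Algebra ℝ 𝔄] [ConvenientAlgebra 𝔄] :
    ConvenientAlgebra (Matrix (Fin n) (Fin n) 𝔄) where
  filt i :=
    { carrier := {M | ∀ j k, M j k ∈ (filt i : Submodule ℝ 𝔄)}
      add_mem' := fun ha hb j k => Submodule.add_mem _ (ha j k) (hb j k)
      zero_mem' := fun _ _ => Submodule.zero_mem _
      smul_mem' := fun c _ hf j k => Submodule.smul_mem _ c (hf j k) }
  filt_zero := by
    ext f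
    simp [ConvenientAlgebra.filt_zero]
  filt_antitone i j hij f hf k l := ConvenientAlgebra.filt_antitone hij (hf k l)
  mul_mem_filt ha hb j k := by
    rw [Matrix.mul_apply]
    exact Submodule.sum_mem _ fun l _ => ConvenientAlgebra.mul_mem_filt (ha j l) (hb l k)
  hausdorff f h := by
    ext j k
    exact ConvenientAlgebra.hausdorff _ fun i => h i j k
  complete x hx := by
    have key := fun j k => ConvenientAlgebra.complete (fun i => x i j k) fun i => hx i j k
    choose a ha using key
    exact ⟨a, fun i j k => ha j k i⟩
  finite_quotient i := by
    have hq : Module.Finite ℝ (𝔄 ⧸ (filt i : Submodule ℝ 𝔄)) :=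
      ConvenientAlgebra.finite_quotient i
    let f : Matrix (Fin n) (Fin n) 𝔄 →ₗ[ℝ] (Fin n → Fin n → 𝔄 ⧸ (filt i : Submodule ℝ 𝔄)) :=
      LinearMap.pi fun j => LinearMap.pi fun k => (filt i : Submodule ℝ 𝔄).mkQ ∘ₗ
        { toFun := fun M => M j k
          map_add' := fun _ _ => rfl
          map_smul' := fun _ _ => rfl }
    refine finite_quotient_of_ker_le f _ ?_
    intro g hg j k
    exact (Submodule.Quotient.mk_eq_zero _).mp
      (congrFun (congrFun (LinearMap.mem_ker.mp hg) j) k)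

theorem IsSeriesValue.transpose {n : ℕ} {𝔄 : Type*} [CommRing 𝔄] [Algebra ℝ 𝔄]
    [ConvenientAlgebra 𝔄] {F : PowerSeries ℝ} {x a : Matrix (Fin n) (Fin n) 𝔄}
    (h : IsSeriesValue F x a) : IsSeriesValue F x.transpose a.transpose := fun N => by
  have h1 : a.transpose - ∑ r ∈ Finset.range N, PowerSeries.coeff r F • x.transpose ^ r =
      (a - ∑ r ∈ Finset.range N, PowerSeries.coeff r F • x ^ r).transpose := by
    simp [Matrix.transpose_sum, Matrix.transpose_pow]
  rw [h1]
  exact fun j k => h N k j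

theorem mem_filt_one_iff {m : ℕ} {𝔄 : Type*} [Ring 𝔄] [Algebra ℝ 𝔄] [ConvenientAlgebra 𝔄]
    (h : (filt 1 : Submodule ℝ 𝔄) = ⊥) (f : MvPowerSeries (Fin m) 𝔄) :
    f ∈ (filt 1 : Submodule ℝ (MvPowerSeries (Fin m) 𝔄)) ↔ MvPowerSeries.constantCoeff f = 0 := by
  constructor
  · intro hf
    have := hf 0
    simpa [h] using this
  · intro hf d
    rcases eq_or_ne d 0 with rfl | hd
    · simp [hf]
    · have : 1 - d.degree = 0 := by
        have : d.degree ≠ 0 := fun h => hd ((Finsupp.degree_eq_zero_iff d).mp h)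
        omega
      rw [this, ConvenientAlgebra.filt_zero]
      trivial

theorem filt_one_real : (filt 1 : Submodule ℝ ℝ) = ⊥ := if_neg one_ne_zero

theorem binomialSeries_half_sq :
    PowerSeries.binomialSeries ℝ (1 / 2 : ℝ) * PowerSeries.binomialSeries ℝ (1 / 2 : ℝ) =
      1 + PowerSeries.X := by
  have h1 := PowerSeries.binomialSeries_nat (R := ℝ) (A := ℝ) 1
  rw [pow_one] at h1
  rw [← h1, ← PowerSeries.binomialSeries_add]
  norm_num

/-- The root is √c times the binomial series of exponent 1/2 at S/c - 1, which has zero constant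
term. It is symmetric because its transpose is the value of the same series at the same argument. -/
theorem exists_isFormalSqrt {m n : ℕ} {c : ℝ} (hc : 0 < c)
    {S : Matrix (Fin n) (Fin n) (MvPowerSeries (Fin m) ℝ)}
    (hS : S.map MvPowerSeries.constantCoeff = c • (1 : Matrix (Fin n) (Fin n) ℝ))
    (hsymm : S.transpose = S) : ∃ W, IsFormalSqrt c S W ∧ W.transpose = W := by
  set s : Matrix (Fin n) (Fin n) (MvPowerSeries (Fin m) ℝ) := c⁻¹ • S - 1 with hs
  have hs1 : s ∈ (filt 1 : Submodule ℝ (Matrix (Fin n) (Fin n) (MvPowerSeries (Fin m) ℝ))) := by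
    intro j k
    rw [mem_filt_one_iff filt_one_real]
    have h1 : MvPowerSeries.constantCoeff (S j k) = c * (1 : Matrix (Fin n) (Fin n) ℝ) j k :=
      congrFun (congrFun hS j) k
    have h2 : MvPowerSeries.constantCoeff (c⁻¹ • S j k) =
        c⁻¹ * MvPowerSeries.constantCoeff (S j k) := rfl
    simp only [hs, Matrix.sub_apply, Matrix.smul_apply, map_sub, h2, h1]
    by_cases hjk : j = k
    · subst hjk; simp [hc.ne']
    · simp [hjk]
  obtain ⟨Y, hY⟩ := exists_isSeriesValue (PowerSeries.binomialSeries ℝ (1 / 2 : ℝ)) hs1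
  have hYY : Y * Y = c⁻¹ • S := by
    have h1 := hY.mul hs1 hY
    rw [binomialSeries_half_sq] at h1
    rw [h1.unique (isSeriesValue_one_add_X hs1), hs, add_sub_cancel]
  have hYt : Y.transpose = Y := by
    have h1 := hY.transpose
    have h2 : s.transpose = s := by simp [hs, hsymm]
    rw [h2] at h1
    exact h1.unique hY
  have hY1 := hY.sub_mem (by simp)
  refine ⟨Real.sqrt c • Y, ⟨?_, ?_⟩, by rw [Matrix.transpose_smul, hYt]⟩
  · rw [smul_mul_smul_comm, Real.mul_self_sqrt hc.le, hYY, smul_smul, mul_inv_cancel₀ hc.ne',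
      one_smul]
  · ext j k
    have h1 := (mem_filt_one_iff filt_one_real _).mp (hY1 j k)
    have h2 : MvPowerSeries.constantCoeff (Real.sqrt c • Y j k) =
        Real.sqrt c * MvPowerSeries.constantCoeff (Y j k) := rfl
    rw [Matrix.sub_apply, map_sub, sub_eq_zero] at h1
    simp only [Matrix.map_apply, Matrix.smul_apply, h2, h1, smul_eq_mul]
    by_cases hjk : j = k
    · subst hjk; simp
    · simp [hjk]

variable {m n : ℕ} {c : ℝ} {S W : Matrix (Fin n) (Fin n) (MvPowerSeries (Fin m) ℝ)}

theorem IsFormalSqrt.isUnit_det (h : IsFormalSqrt c S W) (hc : 0 < c) : IsUnit W.det := by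
  rw [MvPowerSeries.isUnit_iff_constantCoeff, RingHom.map_det, RingHom.mapMatrix_apply, h.2,
    Matrix.det_smul, Matrix.det_one, mul_one]
  exact ((Real.sqrt_pos.mpr hc).ne').isUnit.pow _

theorem IsFormalSqrt.map_inv (h : IsFormalSqrt c S W) (hc : 0 < c) :
    W⁻¹.map MvPowerSeries.constantCoeff = (Real.sqrt c)⁻¹ • (1 : Matrix (Fin n) (Fin n) ℝ) := by
  have h1 := congrArg (RingHom.mapMatrix MvPowerSeries.constantCoeff)
    (Matrix.nonsing_inv_mul W (h.isUnit_det hc))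
  rw [map_mul, map_one] at h1
  simp only [RingHom.mapMatrix_apply] at h1
  rw [h.2, mul_smul_comm, mul_one] at h1
  rw [← h1, smul_smul, inv_mul_cancel₀ (Real.sqrt_pos.mpr hc).ne', one_smul]

theorem IsFormalSqrt.constantCoeff_trace (h : IsFormalSqrt c S W) :
    MvPowerSeries.constantCoeff W.trace = n * Real.sqrt c := by
  have h1 := congrArg Matrix.trace h.2
  rw [Matrix.trace_smul, Matrix.trace_one, Fintype.card_fin] at h1
  rw [Matrix.trace, map_sum, mul_comm, ← smul_eq_mul, ← h1]
  rfl

end Filtrations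

/-! ### Linear combinations with central coefficients. -/

section CentralScalars

variable {K 𝔄 : Type*} [CommRing K] [Ring 𝔄] (κ : K →+* 𝔄) {n : ℕ}

/-- The tuple `[A₁, ..., Aₙ] T` for a matrix `T` over a ring of central scalars. -/
def combine (A : Fin n → 𝔄) (T : Matrix (Fin n) (Fin n) K) : Fin n → 𝔄 :=
  fun i => ∑ j, κ (T j i) * A j

theorem combine_combine (A : Fin n → 𝔄) (T U : Matrix (Fin n) (Fin n) K) :
    combine κ (combine κ A T) U = combine κ A (T * U) := by
  funext i
  simp only [combine, Finset.mul_sum, Matrix.mul_apply, map_sum, map_mul, Finset.sum_mul]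
  rw [Finset.sum_comm]
  refine Finset.sum_congr rfl fun j _ => Finset.sum_congr rfl fun k _ => ?_
  rw [← mul_assoc, ← map_mul, ← map_mul, mul_comm]

theorem combine_one (A : Fin n → 𝔄) : combine κ A 1 = A := by
  funext i
  simp [combine, Matrix.one_apply]

variable {κ}

theorem combine_polar (hκ : ∀ k a, Commute (κ k) a) {A : Fin n → 𝔄} {S : Matrix (Fin n) (Fin n) K}
    (hA : ∀ i k, A i * A k + A k * A i = κ (-2 * S i k)) (T : Matrix (Fin n) (Fin n) K)
    (i k : Fin n) : combine κ A T i * combine κ A T k + combine κ A T k * combine κ A T i =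
      κ (-2 * (T.transpose * S * T) i k) := by
  have h0 : ∀ s t a b, κ s * a * (κ t * b) = κ (s * t) * (a * b) := fun s t a b => by
    rw [mul_assoc, ← mul_assoc a, ← (hκ t a).eq, map_mul]
    noncomm_ring
  have h1 : combine κ A T k * combine κ A T i = ∑ j, ∑ l, κ (T j i * T l k) * (A l * A j) := by
    simp only [combine, Finset.sum_mul_sum, h0]
    rw [Finset.sum_comm]
    simp only [mul_comm]
  have h2 : combine κ A T i * combine κ A T k = ∑ j, ∑ l, κ (T j i * T l k) * (A j * A l) := by
    simp only [combine, Finset.sum_mul_sum, h0]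
  rw [h1, h2]
  simp only [← Finset.sum_add_distrib, ← mul_add, hA, ← map_mul, ← map_sum]
  congr 1
  simp only [Matrix.mul_apply, Matrix.transpose_apply, Finset.sum_mul, Finset.mul_sum]
  rw [Finset.sum_comm]
  refine Finset.sum_congr rfl fun j _ => Finset.sum_congr rfl fun l _ => ?_
  ring

/-- For `A = C W` with a Clifford system `C` and a symmetric matrix `W`. -/
theorem sum_combine_mul [Algebra ℝ 𝔄] (hκ : ∀ k a, Commute (κ k) a) {C : Fin n → 𝔄}
    (hC : IsClifford C) {W : Matrix (Fin n) (Fin n) K} (hW : W.transpose = W) :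
    ∑ j, combine κ C W j * C j = -κ W.trace ∧ ∑ j, C j * combine κ C W j = -κ W.trace := by
  have hW' : ∀ i j, W i j = W j i := fun i j => congrFun (congrFun hW j) i
  have h1 : ∑ j, combine κ C W j * C j = ∑ j, ∑ i, κ (W i j) * (C i * C j) := by
    simp only [combine, Finset.sum_mul, mul_assoc]
  have h2 : ∑ j, C j * combine κ C W j = ∑ j, ∑ i, κ (W i j) * (C j * C i) := by
    simp only [combine, Finset.mul_sum]
    refine Finset.sum_congr rfl fun j _ => Finset.sum_congr rfl fun i _ => ?_
    rw [← mul_assoc, ← (hκ _ (C j)).eq, mul_assoc]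
  -- Symmetry of W makes both orders equal; their sum only sees anticommutators, which contribute -2
  -- on the diagonal, so each is minus the trace.
  have h3 : ∑ j, ∑ i, κ (W i j) * (C i * C j) = ∑ j, ∑ i, κ (W i j) * (C j * C i) := by
    rw [Finset.sum_comm]
    refine Finset.sum_congr rfl fun j _ => Finset.sum_congr rfl fun i _ => ?_
    rw [hW']
  have h4 : ∑ j, ∑ i, κ (W i j) * (C i * C j) + ∑ j, ∑ i, κ (W i j) * (C j * C i) =
      -κ W.trace + -κ W.trace := by
    simp only [← Finset.sum_add_distrib, ← mul_add, hC _ _]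
    simp only [mul_ite, mul_zero, Finset.sum_ite_eq', Finset.mem_univ, if_true, Matrix.trace,
      Matrix.diag, map_sum, ← Finset.sum_neg_distrib, ← Finset.sum_add_distrib]
    refine Finset.sum_congr rfl fun j _ => ?_
    rw [← one_add_one_eq_two]
    noncomm_ring
  have h5 : ∑ j, ∑ i, κ (W i j) * (C i * C j) = -κ W.trace := by
    rw [← h3, ← two_smul ℝ, ← two_smul ℝ] at h4
    exact smul_right_injective 𝔄 (two_ne_zero (α := ℝ)) h4
  exact ⟨h1.trans h5, (h2.trans h3.symm).trans h5⟩

end CentralScalars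

/-! ### Formal families of vectors in the Clifford algebra. -/

section FormalVectors

variable {V : Type u} [AddCommGroup V] [Module ℝ V] {m n : ℕ} (q : QuadraticForm ℝ V)

/-- Formal scalar series as elements of the formal Clifford algebra. -/
def scalarSeries (m : ℕ) :
    MvPowerSeries (Fin m) ℝ →+* MvPowerSeries (Fin m) (CliffordAlgebra (-q)) :=
  MvPowerSeries.map (algebraMap ℝ (CliffordAlgebra (-q)))

theorem sum_antidiagonal_swap_mv {M : Type*} [AddCommMonoid M] (d : Fin m →₀ ℕ)
    (f : (Fin m →₀ ℕ) → (Fin m →₀ ℕ) → M) :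
    ∑ p ∈ Finset.HasAntidiagonal.antidiagonal d, f p.1 p.2 =
      ∑ p ∈ Finset.HasAntidiagonal.antidiagonal d, f p.2 p.1 :=
  Finset.sum_equiv (Equiv.prodComm _ _)
    (fun p => by simp [Finset.HasAntidiagonal.mem_antidiagonal, add_comm]) fun p _ => rfl

theorem commute_scalarSeries (k : MvPowerSeries (Fin m) ℝ)
    (a : MvPowerSeries (Fin m) (CliffordAlgebra (-q))) : Commute (scalarSeries q m k) a := by
  classical
  refine MvPowerSeries.ext fun d => ?_
  rw [MvPowerSeries.coeff_mul, MvPowerSeries.coeff_mul, sum_antidiagonal_swap_mv d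
    fun x y => MvPowerSeries.coeff x a * MvPowerSeries.coeff y (scalarSeries q m k)]
  refine Finset.sum_congr rfl fun p _ => ?_
  rw [scalarSeries, MvPowerSeries.coeff_map, Algebra.commutes]

theorem gram_transpose (a : Fin n → FormalVector m V) : (gram q a).transpose = gram q a := by
  ext i j d
  change ∑ p ∈ _, _ = ∑ p ∈ _, _
  rw [sum_antidiagonal_swap_mv d fun x y => QuadraticMap.associated q (a i x) (a j y)]
  exact Finset.sum_congr rfl fun p _ => QuadraticMap.associated_isSymm _ _ _ _

theorem map_gram (a : Fin n → FormalVector m V) {c : ℝ}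
    (ha : ∀ i j, QuadraticMap.associated q (a i 0) (a j 0) = if i = j then c else 0) :
    (gram q a).map MvPowerSeries.constantCoeff = c • (1 : Matrix (Fin n) (Fin n) ℝ) := by
  ext i j
  have : MvPowerSeries.constantCoeff (gram q a i j) =
      ∑ p ∈ Finset.HasAntidiagonal.antidiagonal (0 : Fin m →₀ ℕ),
        QuadraticMap.associated q (a j p.1) (a i p.2) := rfl
  rw [Matrix.map_apply, this]
  simp [ha, Matrix.one_apply, eq_comm]

theorem cl_mul_cl (a : Fin n → FormalVector m V) (i k : Fin n) :
    cl q (a i) * cl q (a k) + cl q (a k) * cl q (a i) = scalarSeries q m (-2 * gram q a i k) := by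
  classical
  refine MvPowerSeries.ext fun d => ?_
  have h2 : MvPowerSeries.coeff d (-2 * gram q a i k) = -2 * ∑ p ∈
      Finset.HasAntidiagonal.antidiagonal d, QuadraticMap.associated q (a k p.1) (a i p.2) := by
    have : (-2 : MvPowerSeries (Fin m) ℝ) = MvPowerSeries.C (-2) := by
      rw [map_neg, map_ofNat]
    rw [this, MvPowerSeries.coeff_C_mul]
    rfl
  have hpol : ∀ x y, QuadraticMap.polar (-q) x y = -2 * QuadraticMap.associated q y x :=
    fun x y => by
      have h := LinearMap.congr_fun₂ (QuadraticMap.two_nsmul_associated ℝ q) x y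
      have h' : QuadraticMap.polar (-q) x y = -QuadraticMap.polar q x y := by
        simp [QuadraticMap.polar]
        ring
      rw [h', QuadraticMap.associated_isSymm ℝ q y x, ← QuadraticMap.polarBilin_apply_apply, ← h,
        two_nsmul, LinearMap.add_apply, LinearMap.add_apply]
      ring
  rw [map_add, MvPowerSeries.coeff_mul, MvPowerSeries.coeff_mul, sum_antidiagonal_swap_mv d
    fun x y => MvPowerSeries.coeff x (cl q (a i)) * MvPowerSeries.coeff y (cl q (a k)),
    ← Finset.sum_add_distrib, scalarSeries, MvPowerSeries.coeff_map, h2, Finset.mul_sum, map_sum]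
  refine Finset.sum_congr rfl fun p _ => ?_
  rw [← hpol, ← CliffordAlgebra.ι_mul_ι_add_swap]
  rfl

theorem cl_vecMul (a : Fin n → FormalVector m V)
    (T : Matrix (Fin n) (Fin n) (MvPowerSeries (Fin m) ℝ)) :
    (fun i => cl q (vecMul a T i)) = combine (scalarSeries q m) (fun i => cl q (a i)) T := by
  classical
  funext i
  refine MvPowerSeries.ext fun d => ?_
  change CliffordAlgebra.ι (-q) (∑ j, ∑ p ∈ _, _) = _
  simp only [combine, map_sum, MvPowerSeries.coeff_mul, map_smul]
  refine Finset.sum_congr rfl fun j _ => Finset.sum_congr rfl fun p _ => ?_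
  rw [scalarSeries, MvPowerSeries.coeff_map, Algebra.smul_def]
  rfl

theorem constantCoeff_combine_cl (a : Fin n → FormalVector m V)
    {T : Matrix (Fin n) (Fin n) (MvPowerSeries (Fin m) ℝ)} {r : ℝ}
    (hT : T.map MvPowerSeries.constantCoeff = r • (1 : Matrix (Fin n) (Fin n) ℝ)) (i : Fin n) :
    MvPowerSeries.constantCoeff (combine (scalarSeries q m) (fun i => cl q (a i)) T i) =
      r • CliffordAlgebra.ι (-q) (a i 0) := by
  have h0 : ∀ j, MvPowerSeries.constantCoeff (cl q (a j)) = CliffordAlgebra.ι (-q) (a j 0) :=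
    fun j => rfl
  have h1 : ∀ j, MvPowerSeries.constantCoeff (T j i) = r * (1 : Matrix (Fin n) (Fin n) ℝ) j i :=
    fun j => congrFun (congrFun hT j) i
  simp only [combine, map_sum, map_mul, scalarSeries, MvPowerSeries.constantCoeff_map, h0, h1]
  simp [Matrix.one_apply, Algebra.smul_def]

variable {q}

/-- The Gram matrix of the combined tuple is W⁻¹SW⁻¹ = 1. -/
theorem isClifford_combine_cl {a : Fin n → FormalVector m V} {c : ℝ} (hc : 0 < c)
    {W : Matrix (Fin n) (Fin n) (MvPowerSeries (Fin m) ℝ)} (hW : IsFormalSqrt c (gram q a) W)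
    (hWt : W.transpose = W) :
    IsClifford (combine (scalarSeries q m) (fun i => cl q (a i)) W⁻¹) := fun i k => by
  rw [combine_polar (commute_scalarSeries q) (cl_mul_cl q a), Matrix.transpose_nonsing_inv, hWt,
    ← hW.1, ← mul_assoc, Matrix.nonsing_inv_mul W (hW.isUnit_det hc), one_mul,
    Matrix.mul_nonsing_inv W (hW.isUnit_det hc), Matrix.one_apply]
  split_ifs
  · rw [mul_one, map_neg, map_ofNat]
  · rw [mul_zero, map_zero]

theorem combine_combine_inv {a : Fin n → FormalVector m V} {c : ℝ} (hc : 0 < c)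
    {W : Matrix (Fin n) (Fin n) (MvPowerSeries (Fin m) ℝ)} (hW : IsFormalSqrt c (gram q a) W) :
    combine (scalarSeries q m) (combine (scalarSeries q m) (fun i => cl q (a i)) W⁻¹) W =
      fun i => cl q (a i) := by
  rw [combine_combine, Matrix.nonsing_inv_mul W (hW.isUnit_det hc), combine_one]

variable [FiniteDimensional ℝ V]

theorem filt_one_cliffordAlgebra : (filt 1 : Submodule ℝ (CliffordAlgebra (-q))) = ⊥ :=
  if_neg one_ne_zero

/-- With C = AW⁻¹ one has A = CW with W symmetric, so ∑ A_jC_j and ∑ C_jA_j are both minus the trace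
of W. -/
theorem isSolution_syData_cl {a : Fin n → FormalVector m V}
    {W : Matrix (Fin n) (Fin n) (MvPowerSeries (Fin m) ℝ)} (hW : IsFormalSqrt 1 (gram q a) W)
    (hWt : W.transpose = W) :
    IsSolution (syData n) (fun i => cl q (a i)) fun i => cl q (vecMul a W⁻¹ i) := by
  rw [cl_vecMul, isSolution_syData_iff]
  have hC := isClifford_combine_cl one_pos hW hWt
  refine ⟨hC, fun i => ?_, ?_⟩
  · rw [mem_filt_one_iff filt_one_cliffordAlgebra, map_sub, sub_eq_zero,
      constantCoeff_combine_cl q a (hW.map_inv one_pos), Real.sqrt_one, inv_one, one_smul]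
    rfl
  · have h := sum_combine_mul (commute_scalarSeries q) hC hWt
    rw [combine_combine_inv one_pos hW] at h
    exact h.1.trans h.2.symm

/-- The value is B = zC with z central and B_j⁻¹ = -z⁻¹C_j, so ∑ A_jB_j⁻¹ = z⁻¹ tr W. The equations
require this to be ∑ B_jB_j⁻¹, the number of elements, which explains the normalization z = tr
W/(n+1). -/
theorem isFloatSolution_syData_cl {a : Fin (n + 1) → FormalVector m V} {c : ℝ} (hc : 0 < c)
    {W : Matrix (Fin (n + 1)) (Fin (n + 1)) (MvPowerSeries (Fin m) ℝ)}
    (hW : IsFormalSqrt c (gram q a) W) (hWt : W.transpose = W) :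
    IsFloatSolution (syData (n + 1)) (fun i => cl q (a i))
      fun i => cl q (vecMul a (((n + 1 : ℕ) : ℝ)⁻¹ • (W.trace • W⁻¹)) i) := by
  have hn : ((n + 1 : ℕ) : ℝ) ≠ 0 := by positivity
  have hs : Real.sqrt c ≠ 0 := (Real.sqrt_pos.mpr hc).ne'
  set A : Fin (n + 1) → MvPowerSeries (Fin m) (CliffordAlgebra (-q)) := fun i => cl q (a i) with hA
  set κ := scalarSeries q m with hκ
  have hcomm : ∀ k x, Commute (κ k) x := commute_scalarSeries q
  set z : MvPowerSeries (Fin m) ℝ := ((n + 1 : ℕ) : ℝ)⁻¹ • W.trace with hz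
  set C := combine κ A W⁻¹ with hCdef
  have hC : IsClifford C := isClifford_combine_cl hc hW hWt
  have hz0 : MvPowerSeries.constantCoeff z = Real.sqrt c := by
    have : MvPowerSeries.constantCoeff z =
      ((n + 1 : ℕ) : ℝ)⁻¹ * MvPowerSeries.constantCoeff W.trace := rfl
    rw [this, hW.constantCoeff_trace, ← mul_assoc, inv_mul_cancel₀ hn, one_mul]
  -- The constant term of W is √c times the identity, so that of z is √c ≠ 0.
  obtain ⟨z', hzz⟩ := ((MvPowerSeries.isUnit_iff_constantCoeff).mpr
    (hz0 ▸ hs.isUnit)).exists_right_inv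
  have hκz : κ z * κ z' = 1 := by rw [← map_mul, hzz, map_one]
  have hκz' : κ z' * κ z = 1 := by rw [(hcomm _ _).eq, hκz]
  have hB : (fun i => cl q (vecMul a (((n + 1 : ℕ) : ℝ)⁻¹ • (W.trace • W⁻¹)) i)) =
      fun i => κ z * C i := by
    rw [cl_vecMul, ← smul_assoc]
    funext i
    simp only [hCdef, combine, Finset.mul_sum, Matrix.smul_apply, smul_eq_mul, map_mul, mul_assoc]
    rfl
  have htr : κ W.trace = (n + 1 : ℕ) * κ z := by
    rw [← map_natCast κ, ← map_mul, hz]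
    congr 1
    rw [← nsmul_eq_mul, ← Nat.cast_smul_eq_nsmul ℝ, smul_smul, mul_inv_cancel₀ hn, one_smul]
  have hpair : ∀ x y j k, κ x * κ y = 1 →
      κ x * C j * -(κ y * C k) + κ x * C k * -(κ y * C j) = if j = k then 2 else 0 :=
    fun x y j k hxy => by
      have h0 : ∀ j k, κ x * C j * -(κ y * C k) = -(C j * C k) := fun j k => by
        rw [mul_neg, mul_assoc, ← mul_assoc (C j), ← (hcomm y (C j)).eq, mul_assoc (κ y),
          ← mul_assoc, hxy, one_mul]
      rw [h0, h0, ← neg_add, hC j k]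
      split_ifs <;> simp
  have h1 : ∀ j k, κ z * C j * -(κ z' * C k) + κ z * C k * -(κ z' * C j) =
      if j = k then 2 else 0 := fun j k => hpair z z' j k hκz
  have h2 : ∀ j k, -(κ z' * C j) * (κ z * C k) + -(κ z' * C k) * (κ z * C j) =
      if j = k then 2 else 0 := fun j k => by
    rw [← hpair z' z j k hκz']
    noncomm_ring
  have hinv : ∀ j, Ring.inverse (κ z * C j) = -(κ z' * C j) := fun j =>
    inverse_eq_of_pair (Q := fun j => κ z * C j) (S := fun j => -(κ z' * C j)) h1 h2 j
  have hfl : IsFloatingClifford fun i => κ z * C i :=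
    isFloatingClifford_iff.mpr ⟨fun j => -(κ z' * C j), h1, h2⟩
  have hsum := sum_combine_mul hcomm hC hWt
  rw [combine_combine_inv hc hW] at hsum
  have hu : ∀ j, IsUnit (κ z * C j) := hfl.isUnit
  rw [hB, isFloatSolution_syData_iff]
  refine ⟨hfl, fun i => ?_, ?_, ?_⟩
  · rw [mem_filt_one_iff filt_one_cliffordAlgebra, map_sub, sub_eq_zero, map_mul,
      constantCoeff_combine_cl q a (hW.map_inv hc), hκ, scalarSeries,
      MvPowerSeries.constantCoeff_map, hz0, ← Algebra.smul_def, smul_smul, mul_inv_cancel₀ hs,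
      one_smul]
    rfl
  · simp only [Pi.sub_apply, sub_mul, Finset.sum_sub_distrib, Ring.mul_inverse_cancel _ (hu _)]
    have : ∑ j, A j * Ring.inverse (κ z * C j) = -(κ z' * ∑ j, A j * C j) := by
      simp only [hinv, mul_neg, Finset.sum_neg_distrib, (hcomm z' _).eq, Finset.sum_mul,
        ← mul_assoc]
    rw [this, hsum.1, htr, mul_neg, neg_neg, ← mul_assoc, (hcomm z' _).eq, mul_assoc, hκz']
    simp
  · simp only [Pi.sub_apply, mul_sub, Finset.sum_sub_distrib, Ring.inverse_mul_cancel _ (hu _)]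
    have : ∑ j, Ring.inverse (κ z * C j) * A j = -(κ z' * ∑ j, C j * A j) := by
      simp only [hinv, neg_mul, Finset.sum_neg_distrib, Finset.mul_sum, mul_assoc]
    rw [this, hsum.2, htr, mul_neg, neg_neg, ← mul_assoc, (hcomm z' _).eq, mul_assoc, hκz']
    simp

end FormalVectors

/-! ### Assembly of the properties of the procedures. -/

section Procedures

variable {n : ℕ}

theorem signs_mul_self (e : Fin n → Fin 2) (i : Fin n) :
    (-1 : ℝ) ^ (e i : ℕ) * (-1 : ℝ) ^ (e i : ℕ) = 1 := by
  rw [← mul_pow]; norm_num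

theorem isFormalOrthogonalization (ω : ConnectionData n) :
    IsFormalOrthogonalization (orthogonalization.{u} ω) where
  singleValued _ _ _ _ A B B' h h' :=
    ((orthogonalization_iff ω A B).mp h).unique ((orthogonalization_iff ω A B').mp h')
  natural := ⟨fun _ _ _ _ _ _ _ _ φ hφ A B h =>
      (orthogonalization_iff ω _ _).mpr (((orthogonalization_iff ω A B).mp h).map φ hφ),
    fun _ _ _ _ _ _ _ _ A B A' B' h h' => ⟨_, (orthogonalization_iff ω _ _).mpr
      (((orthogonalization_iff ω A B).mp h).prod ((orthogonalization_iff ω A' B').mp h')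
        fun _ ha _ hb => ⟨ha, hb⟩)⟩⟩
  formalDomain _ _ _ _ A := ⟨fun ⟨_, h⟩ => h.1, fun h =>
    (exists_solution ω h).imp fun _ hB => (orthogonalization_iff ω _ _).mpr hB⟩
  analytic := formallyAnalytic_orthogonalization ω
  productive _ _ _ _ A B h := ((orthogonalization_iff ω A B).mp h).clifford

theorem isFormalConformOrthogonalization (ω : ConnectionData (n + 1)) :
    IsFormalConformOrthogonalization (conformOrthogonalization.{u} ω) where
  singleValued _ _ _ _ A B B' h h' :=
    ((conformOrthogonalization_iff ω A B).mp h).unique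
      ((conformOrthogonalization_iff ω A B').mp h')
  natural := ⟨fun _ _ _ _ _ _ _ _ φ hφ A B h => (conformOrthogonalization_iff ω _ _).mpr
      (((conformOrthogonalization_iff ω A B).mp h).map φ hφ),
    fun _ _ _ _ _ _ _ _ A B A' B' h h' => ⟨_, (conformOrthogonalization_iff ω _ _).mpr
      (((conformOrthogonalization_iff ω A B).mp h).prod
        ((conformOrthogonalization_iff ω A' B').mp h') fun _ ha _ hb => ⟨ha, hb⟩)⟩⟩
  bivariant _ _ _ _ A B u v hu hv h := (conformOrthogonalization_iff ω _ _).mpr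
    (((conformOrthogonalization_iff ω A B).mp h).bivariant hu hv)
  formalDomain _ _ _ _ A := ⟨fun ⟨_, h⟩ => h.1, fun h =>
    (exists_floatSolution ω h).imp fun _ hB => (conformOrthogonalization_iff ω _ _).mpr hB⟩
  analytic := floatFormallyAnalytic_conformOrthogonalization ω
  productive _ _ _ _ A B h := ((conformOrthogonalization_iff ω A B).mp h).floating

theorem signLinear_orthogonalization (ω : ConnectionData n) :
    SignLinear (orthogonalization.{u} ω) := fun _ _ _ _ A B e h =>
  (orthogonalization_iff ω _ _).mpr
    (((orthogonalization_iff ω A B).mp h).smul (signs_mul_self e))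

theorem signLinear_conformOrthogonalization (ω : ConnectionData (n + 1)) :
    SignLinear (conformOrthogonalization.{u} ω) := fun _ _ _ _ A B e h =>
  (conformOrthogonalization_iff ω _ _).mpr
    (((conformOrthogonalization_iff ω A B).mp h).smul (signs_mul_self e))

theorem fiberStar_orthogonalization (ω : ConnectionData n) :
    FiberStar (orthogonalization.{u} ω) := fun _ _ _ _ A B h t =>
  (orthogonalization_iff ω _ _).mpr (((orthogonalization_iff ω A B).mp h).fiberStar t)

theorem fiberStar_conformOrthogonalization (ω : ConnectionData (n + 1)) :
    FiberStar (conformOrthogonalization.{u} ω) := fun _ _ _ _ A B h t =>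
  (conformOrthogonalization_iff ω _ _).mpr
    (((conformOrthogonalization_iff ω A B).mp h).fiberStar t)

theorem orthogonallyEquivariant_orthogonalization (n : ℕ) :
    OrthogonallyEquivariant (orthogonalization.{u} (syData n)) := fun _ _ _ _ A B U hU h =>
  (orthogonalization_iff _ _ _).mpr (((orthogonalization_iff _ A B).mp h).rotate hU)

theorem orthogonallyEquivariant_conformOrthogonalization (n : ℕ) :
    OrthogonallyEquivariant (conformOrthogonalization.{u} (syData (n + 1))) :=
  fun _ _ _ _ A B U hU h => (conformOrthogonalization_iff _ _ _).mpr
    (((conformOrthogonalization_iff _ A B).mp h).rotate hU)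

theorem OrthogonallyEquivariant.permutationSymmetric {Ψ : Operation.{u} n}
    (h : OrthogonallyEquivariant Ψ) : PermutationSymmetric Ψ := fun 𝔄 _ _ _ A B σ hAB => by
  have h1 : Ψ 𝔄 (rotate (permMatrix σ) A) (rotate (permMatrix σ) B) :=
    h 𝔄 A B _ (permMatrix_mem σ) hAB
  rwa [rotate_permMatrix, rotate_permMatrix] at h1

theorem symmetricPermanent_orthogonalization (n : ℕ) :
    SymmetricPermanent (orthogonalization.{u} (syData n)) := fun V _ _ _ q _ m a ha => by
  obtain ⟨W, hW, hWt⟩ := exists_isFormalSqrt one_pos (map_gram q a ha) (gram_transpose q a)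
  exact ⟨W, hW, (orthogonalization_iff _ _ _).mpr (isSolution_syData_cl hW hWt)⟩

theorem conformSymmetricPermanent_conformOrthogonalization (n : ℕ) :
    ConformSymmetricPermanent (conformOrthogonalization.{u} (syData (n + 1))) :=
  fun V _ _ _ q _ m a c hc ha => by
    obtain ⟨W, hW, hWt⟩ := exists_isFormalSqrt hc (map_gram q a ha) (gram_transpose q a)
    exact ⟨W, hW, (conformOrthogonalization_iff _ _ _).mpr (isFloatSolution_syData_cl hc hW hWt)⟩

end Procedures

end FQ

end

theorem theorem5p6 (n : ℕ) :
    ((∀ ω : FQ.ConnectionData n,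
        FQ.IsFormalOrthogonalization (FQ.orthogonalization.{u} ω) ∧
        FQ.SignLinear (FQ.orthogonalization.{u} ω) ∧
        FQ.CliffordConservative (FQ.orthogonalization.{u} ω) ∧
        FQ.FormallyHomogeneous (FQ.orthogonalization.{u} ω) ∧
        FQ.FiberStar (FQ.orthogonalization.{u} ω)) ∧
      (∀ (𝔄 : Type u) [Ring 𝔄] [Algebra ℝ 𝔄] [FQ.ConvenientAlgebra 𝔄] (A B : Fin n → 𝔄),
        FQ.orthogonalization (FQ.gsData n) 𝔄 A B ↔
          FQ.FormalDomain A ∧ FQ.IsGramSchmidt A B) ∧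
      FQ.SymmetricPermanent (FQ.orthogonalization.{u} (FQ.syData n)) ∧
      FQ.PermutationSymmetric (FQ.orthogonalization.{u} (FQ.syData n)) ∧
      FQ.OrthogonallyEquivariant (FQ.orthogonalization.{u} (FQ.syData n))) ∧
    ((∀ ω : FQ.ConnectionData (n + 1),
        FQ.IsFormalConformOrthogonalization (FQ.conformOrthogonalization.{u} ω) ∧
        FQ.SignLinear (FQ.conformOrthogonalization.{u} ω) ∧
        FQ.FloatCliffordConservative (FQ.conformOrthogonalization.{u} ω) ∧
        FQ.FiberStar (FQ.conformOrthogonalization.{u} ω)) ∧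
      (∀ (𝔄 : Type u) [Ring 𝔄] [Algebra ℝ 𝔄] [FQ.ConvenientAlgebra 𝔄] (A B : Fin (n + 1) → 𝔄),
        FQ.conformOrthogonalization (FQ.gsData (n + 1)) 𝔄 A B ↔
          FQ.FloatFormalDomain A ∧ FQ.IsConformGramSchmidt A B) ∧
      FQ.ConformSymmetricPermanent (FQ.conformOrthogonalization.{u} (FQ.syData (n + 1))) ∧
      FQ.PermutationSymmetric (FQ.conformOrthogonalization.{u} (FQ.syData (n + 1))) ∧
      FQ.OrthogonallyEquivariant (FQ.conformOrthogonalization.{u} (FQ.syData (n + 1)))) := by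
  refine ⟨⟨fun ω => ⟨FQ.isFormalOrthogonalization ω, FQ.signLinear_orthogonalization ω,
      fun _ _ _ _ Q hQ => (FQ.orthogonalization_iff ω Q Q).mpr (hQ.isSolution_self ω),
      fun _ _ _ _ A B h => (FQ.orthogonalization_iff ω _ _).mpr
        ((FQ.orthogonalization_iff ω A B).mp h).homogeneous,
      FQ.fiberStar_orthogonalization ω⟩,
    fun _ _ _ _ A B => (FQ.orthogonalization_iff _ A B).trans (FQ.isSolution_gsData_iff A B),
    FQ.symmetricPermanent_orthogonalization n,
    (FQ.orthogonallyEquivariant_orthogonalization n).permutationSymmetric,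
    FQ.orthogonallyEquivariant_orthogonalization n⟩,
    fun ω => ⟨FQ.isFormalConformOrthogonalization ω, FQ.signLinear_conformOrthogonalization ω,
      fun _ _ _ _ Q hQ =>
        (FQ.conformOrthogonalization_iff ω Q Q).mpr (hQ.isFloatSolution_self ω),
      FQ.fiberStar_conformOrthogonalization ω⟩,
    fun _ _ _ _ A B =>
      (FQ.conformOrthogonalization_iff _ A B).trans (FQ.isFloatSolution_gsData_iff A B),
    FQ.conformSymmetricPermanent_conformOrthogonalization n,
    (FQ.orthogonallyEquivariant_conformOrthogonalization n).permutationSymmetric,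
    FQ.orthogonallyEquivariant_conformOrthogonalization n⟩
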